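/- Let $M$ be a connected smooth manifold (Hausdorff, second countable) of dimension $n\ge 2$, and let $F:TM\to[0,\infty)$ be a Finsler structure: $F$ is $C^\infty$ on $TM_0=TM\setminus 0$, $F(x,\lambda y)=\lambda F(x,y)$ for $\lambda>0$, and $g_{ij}=\frac12[F^2]_{y^iy^j}$ is positive definite on $TM_0$. Let $$G^i=\tfrac12 g^{il}\big([F^2]_{x^ky^l}y^k-[F^2]_{x^l}\big),\qquad G^i_j=\tfrac12\frac{\partial G^i}{\partial y^j},\qquad \frac{\delta}{\delta x^k}=\frac{\partial}{\partial x^k}-G^l_k\frac{\partial}{\partial y^l},$$ so that geodesics solve $\ddot x^i+G^i(x,\dot x)=0$; let $F^2\mathrm{Ric}=(G^i)_{x^i}-\frac14 (G^i)_{y^j}(G^j)_{y^i}-\frac12 y^j(G^i)_{y^ix^j}+\frac12 G^j(G^i)_{y^iy^j}$, and let $\mathrm{Ric}_{ij}=\frac12[F^2\mathrm{Ric}]_{y^iy^j}$ be the Ricci tensor. A projective map is a geodesic $f:(-1,1)\to M$ whose parameter $u\in(-1,1)$ is, as a function of the arc length $s$, a projective parameter: $du/ds\ne0$ and the Schwarzian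 derivative satisfies $\{u,s\}=\frac{2}{n-1}\mathrm{Ric}_{jk}\frac{dx^j}{ds}\frac{dx^k}{ds}$ (a projective map may traverse the geodesic in either sense). With $\rho(a,b)=\left|\ln\frac{(1-a)(1+b)}{(1-b)(1+a)}\right|$ on $(-1,1)$, let $d_M(x,y)$ be the infimum of $\sum_{i=1}^k\rho(a_i,b_i)$ over all chains from $x$ to $y$, i.e. all $k\geq 1$, points $x=x_0,\dots,x_k=y$ of $M$, points $a_i,b_i\in(-1,1)$ and projective maps $f_i$ with $f_i(a_i)=x_{i-1}$, $f_i(b_i)=x_i$. The Ricci tensor is called horizontally parallel for the Berwald (resp. Chern) connection if $$\frac{\delta \mathrm{Ric}_{ij}}{\delta x^k}-\mathrm{Ric}_{ir}C^r_{jk}-\mathrm{Ric}_{jr}C^r_{ik}=0\quad\text{on }TM_0,$$ where $C^i_{jk}=\frac{\partial G^i_j}{\partial y^k}$ (resp. $C^i_{jk}=\frac12g^{ih}\big(\frac{\delta g_{hj}}{\delta x^k}+\frac{\delta g_{kh}}{\delta x^j}-\frac{\delta g_{jk}}{\delta x^h}\big)$). It is called parallel if moreover its vertical covariant derivative, which for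 both connections is $\partial\mathrm{Ric}_{ij}/\partial y^k$, vanishes on $TM_0$. Theorem. Assume that $(\mathrm{Ric}_{ij})$ is negative definite on $TM_0$. (1) If the Ricci tensor is parallel with respect to the Berwald or the Chern connection (for this part horizontally parallel suffices), then $d_M$ is a distance: it is finite, symmetric, satisfies the triangle inequality, and $d_M(x,y)=0$ if and only if $x=y$. (2) If the Ricci tensor is parallel with respect to the Berwald or the Chern connection and $(M,F)$ is (forward geodesically) complete, i.e. the geodesic with any given nonzero initial velocity is defined for all positive times, then $d_M$ is a complete distance: a distance for which every $d_M$-Cauchy sequence converges. -/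

import Mathlib

open Set Filter Topology
open scoped Manifold ContDiff ENNReal

noncomputable section

namespace Finsler

/-- Coordinate space. -/
abbrev E (n : ℕ) : Type := EuclideanSpace ℝ (Fin n)

/-! ### Coordinate calculus

All tensors of a Finsler structure are computed in coordinates from its coordinate expression
`L x y` (`x` the position, `y` the direction), on the domain where `y ≠ 0`. -/

section Coordinates

variable {n : ℕ}

/-- Partial derivative with respect to the position coordinate `x^k`. -/
def dx (k : Fin n) (u : E n → E n → ℝ) (x y : E n) : ℝ :=
  fderiv ℝ (fun x' => u x' y) x (EuclideanSpace.single k 1)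

/-- Partial derivative with respect to the direction coordinate `y^k`. -/
def dy (k : Fin n) (u : E n → E n → ℝ) (x y : E n) : ℝ :=
  fderiv ℝ (fun y' => u x y') y (EuclideanSpace.single k 1)

/-- `F²`. -/
def sqr (L : E n → E n → ℝ) (x y : E n) : ℝ := L x y ^ 2

/-- The fundamental tensor `g_{ij} = (F²/2)_{y^i y^j}`. -/
def metric (L : E n → E n → ℝ) (i j : Fin n) (x y : E n) : ℝ :=
  (1 / 2) * dy j (dy i (sqr L)) x y

/-- The inverse matrix `g^{ij}`. -/
def metricInv (L : E n → E n → ℝ) (i j : Fin n) (x y : E n) : ℝ :=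
  (Matrix.of fun k l => metric L k l x y)⁻¹ i j

/-- The spray coefficients `G^i = (1/2) g^{il} ([F²]_{x^k y^l} y^k - [F²]_{x^l})`,
normalized so that geodesics solve `x'' + G(x, x') = 0`. -/
def spray (L : E n → E n → ℝ) (i : Fin n) (x y : E n) : ℝ :=
  (1 / 2) * ∑ l, metricInv L i l x y *
    ((∑ k, dx k (dy l (sqr L)) x y * y k) - dx l (sqr L) x y)

/-- The nonlinear connection `G^i_j = (1/2) ∂G^i/∂y^j`. -/
def nonlin (L : E n → E n → ℝ) (i j : Fin n) (x y : E n) : ℝ :=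
  (1 / 2) * dy j (spray L i) x y

/-- The trace of the Riemann curvature `R_y`, i.e. `F²` times the Ricci scalar:
`F² Ric = G^i_{x^i} - (1/4) G^i_{y^j} G^j_{y^i} - (1/2) y^j G^i_{y^i x^j} +
(1/2) G^j G^i_{y^i y^j}`. -/
def ricScalar (L : E n → E n → ℝ) (x y : E n) : ℝ :=
  (∑ i, dx i (spray L i) x y)
    - (1 / 4) * (∑ i, ∑ j, dy j (spray L i) x y * dy i (spray L j) x y)
    - (1 / 2) * (∑ i, ∑ j, y j * dx j (dy i (spray L i)) x y)
    + (1 / 2) * (∑ i, ∑ j, spray L j x y * dy j (dy i (spray L i)) x y)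

/-- The Ricci tensor of Akbar-Zadeh, `Ric_{ij} = (1/2) (F² Ric)_{y^i y^j}`. -/
def ricci (L : E n → E n → ℝ) (i j : Fin n) (x y : E n) : ℝ :=
  (1 / 2) * dy j (dy i (ricScalar L)) x y

/-- The horizontal derivative `δ/δx^k = ∂/∂x^k - G^l_k ∂/∂y^l`. -/
def delta (L : E n → E n → ℝ) (k : Fin n) (u : E n → E n → ℝ) (x y : E n) : ℝ :=
  dx k u x y - ∑ l, nonlin L l k x y * dy l u x y

/-- Coefficients `Γ^i_{jk}` of the Chern connection. -/
def chern (L : E n → E n → ℝ) (i j k : Fin n) (x y : E n) : ℝ :=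
  (1 / 2) * ∑ h, metricInv L i h x y *
    (delta L k (metric L h j) x y + delta L j (metric L k h) x y - delta L h (metric L j k) x y)

/-- Coefficients `G^i_{jk} = ∂G^i_j/∂y^k` of the Berwald connection. -/
def berwald (L : E n → E n → ℝ) (i j k : Fin n) (x y : E n) : ℝ :=
  dy k (nonlin L i j) x y

/-- The horizontal covariant derivative, in the direction `δ/δx^k`, of the Ricci tensor, for the
connection with horizontal coefficients `C`. -/
def ricciHor (L : E n → E n → ℝ) (C : Fin n → Fin n → Fin n → E n → E n → ℝ)
    (i j k : Fin n) (x y : E n) : ℝ :=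
  delta L k (ricci L i j) x y
    - (∑ r, ricci L i r x y * C r j k x y) - (∑ r, ricci L j r x y * C r i k x y)

/-- The vertical covariant derivative of the Ricci tensor in the direction `∂/∂y^k`: for the
Berwald and for the Chern connection it is the plain partial derivative. -/
def ricciVert (L : E n → E n → ℝ) (i j k : Fin n) (x y : E n) : ℝ :=
  dy k (ricci L i j) x y

end Coordinates

/-! ### Finsler spaces -/

variable {n : ℕ} {M : Type*} [TopologicalSpace M] [ChartedSpace (E n) M]

/-- The expression, in the chart `chartAt (E n) p`, of a function on the tangent bundle. -/
def localRep (F : TangentBundle (𝓡 n) M → ℝ) (p : M) (x y : E n) : ℝ :=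
  F ⟨(chartAt (E n) p).symm x, mfderiv (𝓡 n) (𝓡 n) (chartAt (E n) p).symm x y⟩

variable (n M) in
/-- A Finsler structure on `M`; it is not assumed to be reversible. -/
structure FinslerStructure [IsManifold (𝓡 n) ∞ M] where
  /-- the underlying function on the tangent bundle -/
  F : TangentBundle (𝓡 n) M → ℝ
  nonneg : ∀ v, 0 ≤ F v
  /-- smoothness on the slit tangent bundle -/
  smooth : ContMDiffOn (𝓡 n).tangent 𝓘(ℝ, ℝ) ∞ F {v | v.2 ≠ 0}
  /-- positive homogeneity -/
  homog : ∀ (x : M) (y : TangentSpace (𝓡 n) x) (c : ℝ), 0 < c → F ⟨x, c • y⟩ = c * F ⟨x, y⟩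
  /-- strong convexity -/
  convex : ∀ (p : M), ∀ x ∈ (chartAt (E n) p).target, ∀ y : E n, y ≠ 0 → ∀ w : E n, w ≠ 0 →
    0 < ∑ i, ∑ j, metric (localRep F p) i j x y * w i * w j

variable [IsManifold (𝓡 n) ∞ M]

namespace FinslerStructure

/-- The coordinate expression of `F` in the chart around `p`. -/
def loc (𝓕 : FinslerStructure n M) (p : M) : E n → E n → ℝ := localRep 𝓕.F p

/-- The Ricci tensor is negative definite. -/
def RicciNegDef (𝓕 : FinslerStructure n M) : Prop :=
  ∀ (p : M), ∀ x ∈ (chartAt (E n) p).target, ∀ y : E n, y ≠ 0 → ∀ w : E n, w ≠ 0 →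
    ∑ i, ∑ j, ricci (𝓕.loc p) i j x y * w i * w j < 0

/-- The horizontal Berwald covariant derivative of the Ricci tensor vanishes. -/
def BerwaldHorParallel (𝓕 : FinslerStructure n M) : Prop :=
  ∀ (p : M), ∀ x ∈ (chartAt (E n) p).target, ∀ y : E n, y ≠ 0 → ∀ i j k,
    ricciHor (𝓕.loc p) (berwald (𝓕.loc p)) i j k x y = 0

/-- The horizontal Chern covariant derivative of the Ricci tensor vanishes. -/
def ChernHorParallel (𝓕 : FinslerStructure n M) : Prop :=
  ∀ (p : M), ∀ x ∈ (chartAt (E n) p).target, ∀ y : E n, y ≠ 0 → ∀ i j k,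
    ricciHor (𝓕.loc p) (chern (𝓕.loc p)) i j k x y = 0

/-- The vertical (Berwald or Chern) covariant derivative of the Ricci tensor vanishes. -/
def VertParallel (𝓕 : FinslerStructure n M) : Prop :=
  ∀ (p : M), ∀ x ∈ (chartAt (E n) p).target, ∀ y : E n, y ≠ 0 → ∀ i j k,
    ricciVert (𝓕.loc p) i j k x y = 0

/-- The Ricci tensor is parallel with respect to the Berwald connection: its covariant derivative
vanishes in all directions tangent to the slit tangent bundle. -/
def BerwaldParallel (𝓕 : FinslerStructure n M) : Prop :=
  𝓕.BerwaldHorParallel ∧ 𝓕.VertParallel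

/-- The Ricci tensor is parallel with respect to the Chern connection: its covariant derivative
vanishes in all directions tangent to the slit tangent bundle. -/
def ChernParallel (𝓕 : FinslerStructure n M) : Prop :=
  𝓕.ChernHorParallel ∧ 𝓕.VertParallel

end FinslerStructure

/-! ### Geodesics and completeness -/

/-- The curve `γ` read in the chart around `γ t`. -/
def coordCurve (γ : ℝ → M) (t : ℝ) : ℝ → E n := fun τ => chartAt (E n) (γ t) (γ τ)

/-- The coordinate velocity of `γ` at time `t`, in the chart around `γ t`. -/
def velocity (γ : ℝ → M) (t : ℝ) : E n := deriv (coordCurve (n := n) γ t) t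

namespace FinslerStructure

/-- `γ` is a (nonconstant, affinely parametrized) geodesic on the open set `J` of times:
`x'' + G(x, x') = 0`. -/
structure IsGeodesicOn (𝓕 : FinslerStructure n M) (γ : ℝ → M) (J : Set ℝ) : Prop where
  smooth : ContMDiffOn 𝓘(ℝ, ℝ) (𝓡 n) ∞ γ J
  regular : ∀ t ∈ J, velocity (n := n) γ t ≠ 0
  equation : ∀ t ∈ J, ∀ i,
    (deriv (deriv (coordCurve (n := n) γ t)) t) i
      + spray (𝓕.loc (γ t)) i (coordCurve (n := n) γ t t) (velocity (n := n) γ t) = 0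

/-- The curve `γ` is parametrized by arc length on `J`: `F(γ, γ') = 1`. -/
def UnitSpeedOn (𝓕 : FinslerStructure n M) (γ : ℝ → M) (J : Set ℝ) : Prop :=
  ∀ t ∈ J, 𝓕.loc (γ t) (coordCurve (n := n) γ t t) (velocity (n := n) γ t) = 1

/-- `Ric_{jk} (dx^j/ds) (dx^k/ds)` along a curve. -/
def ricciAlong (𝓕 : FinslerStructure n M) (γ : ℝ → M) (s : ℝ) : ℝ :=
  ∑ j, ∑ k, ricci (𝓕.loc (γ s)) j k (coordCurve (n := n) γ s s) (velocity (n := n) γ s)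
    * velocity (n := n) γ s j * velocity (n := n) γ s k

/-- (Forward geodesic) completeness: the geodesic with any given nonzero initial velocity is
defined for all positive times. -/
def IsComplete (𝓕 : FinslerStructure n M) : Prop :=
  ∀ (x : M) (v : E n), v ≠ 0 → ∃ (γ : ℝ → M) (a : ℝ), a < 0 ∧
    𝓕.IsGeodesicOn γ (Ioi a) ∧ γ 0 = x ∧ velocity (n := n) γ 0 = v

end FinslerStructure

/-! ### Projective parameters and the pseudo-distance -/

/-- The Schwarzian derivative `{p, s}`. -/
def schwarzian (p : ℝ → ℝ) (s : ℝ) : ℝ :=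
  iteratedDeriv 3 p s / deriv p s - (3 / 2) * (iteratedDeriv 2 p s / deriv p s) ^ 2

/-- The Poincaré distance on the interval `(-1, 1)`. -/
def poincare (a b : ℝ) : ℝ :=
  |Real.log (((1 - a) * (1 + b)) / ((1 - b) * (1 + a)))|

namespace FinslerStructure

/-- `p` is a projective parameter of the geodesic `γ`, which is parametrized by arc length on
the open set `J`: `{p, s} = 2/(n-1) Ric_{jk} (dx^j/ds) (dx^k/ds)`. -/
structure IsProjectiveParameter (𝓕 : FinslerStructure n M) (γ : ℝ → M) (J : Set ℝ)
    (p : ℝ → ℝ) : Prop where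
  smooth : ContDiffOn ℝ ∞ p J
  deriv_ne : ∀ s ∈ J, deriv p s ≠ 0
  equation : ∀ s ∈ J, schwarzian p s = 2 / ((n : ℝ) - 1) * 𝓕.ricciAlong γ s

/-- Projective maps `f : (-1, 1) → M` (the values of `f` elsewhere are irrelevant): geodesics
of `M`, parametrized so that the natural parameter of `(-1, 1)` is a projective parameter. -/
def IsProjectiveMap (𝓕 : FinslerStructure n M) (f : ℝ → M) : Prop :=
  ∃ (J : Set ℝ) (γ : ℝ → M) (p : ℝ → ℝ), IsOpen J ∧ J.OrdConnected ∧
    𝓕.IsGeodesicOn γ J ∧ 𝓕.UnitSpeedOn γ J ∧ 𝓕.IsProjectiveParameter γ J p ∧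
    p '' J = Ioo (-1) 1 ∧ ∀ s ∈ J, f (p s) = γ s

/-- The lengths of the chains of geodesic segments from `x` to `y`. -/
def chainLengths (𝓕 : FinslerStructure n M) (x y : M) : Set ℝ :=
  {ℓ | ∃ (k : ℕ) (z : Fin (k + 1) → M) (a b : Fin k → ℝ) (f : Fin k → ℝ → M),
    0 < k ∧ z 0 = x ∧ z (Fin.last k) = y ∧
    (∀ i, a i ∈ Ioo (-1 : ℝ) 1 ∧ b i ∈ Ioo (-1 : ℝ) 1 ∧ 𝓕.IsProjectiveMap (f i) ∧
      f i (a i) = z i.castSucc ∧ f i (b i) = z i.succ) ∧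
    ℓ = ∑ i, poincare (a i) (b i)}

/-- The intrinsic projectively invariant pseudo-distance `d_M` (`∞` if there is no chain). -/
def projDist (𝓕 : FinslerStructure n M) (x y : M) : ℝ≥0∞ :=
  ⨅ ℓ ∈ 𝓕.chainLengths x y, ENNReal.ofReal ℓ

end FinslerStructure

/-- `d` is a (finite, symmetric) distance. -/
structure IsDistance {X : Type*} (d : X → X → ℝ≥0∞) : Prop where
  finite : ∀ x y, d x y ≠ ⊤
  eq_zero_iff : ∀ x y, d x y = 0 ↔ x = y
  symm : ∀ x y, d x y = d y x
  triangle : ∀ x y z, d x z ≤ d x y + d y z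

/-- `d` is a complete distance: every Cauchy sequence converges. -/
structure IsCompleteDistance {X : Type*} (d : X → X → ℝ≥0∞) : Prop where
  isDistance : IsDistance d
  complete : ∀ u : ℕ → X, (∀ ε > 0, ∃ N, ∀ l ≥ N, ∀ m ≥ N, d (u l) (u m) < ε) →
    ∃ x, ∀ ε > 0, ∃ N, ∀ m ≥ N, d (u m) x < ε

end Finsler

end

/-! Contract the equation of horizontal parallelism with y^i y^j y^k. Both connections satisfy
C^r_{jk} y^j y^k = G^r (`berwald_contract`, `chern_contract`), so what remains says that F²Ric is a
first integral of the geodesic flow (`fderiv_ricScalar_spray`). F²Ric is the trace of the curvature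
of the spray and does not depend on the chart (`traceCurv_tangentLift`). Hence along a geodesic γ of
unit F-speed the prescribed Schwarzian is a negative constant -c²/2, where c² = -4/(n-1) Ric(γ',
γ').

Part (1). The core is a one-dimensional Schwarz lemma, `two_mul_abs_sub_le_poincare`: if {p, s} =
-2k² and p maps its interval onto (-1, 1), then 2k|s - t| ≤ ρ(p(s), p(t)). With k = c/2, every
projective segment is at least as long as the underlying geodesic segment measured by the norm
√(-4/(n-1) Ric) (`IsProjectiveMap.exists_unitGeod`). On a compact coordinate ball this norm
dominates a multiple of the Euclidean one, so a chain of small length cannot move far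
(`chain_stays`), and points are separated. Finiteness follows from connectedness, once the points
near P are known to be joined to P (`eventually_exists_chain`).

Part (2). Vertical parallelism makes Ric_ij independent of y, because the complement of the origin
is connected for n ≥ 2. So h = -4/(n-1) Ric is a Riemannian metric, and horizontal parallelism for a
symmetric connection identifies the spray of F with that of h (`sprayVec_eq_metricSpray`). Geodesics
are therefore reversible, forward completeness gives completeness in both directions, and every unit
h-geodesic extends to the whole line. There tanh(s/2) is a projective parameter and the Schwarz
lemma is an equality, so a geodesic segment is a link of exactly its h-length (`Step.link`): d_M is
the infimum of the h-lengths of broken geodesics.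

Completeness is then a Hopf-Rinow argument, run for the function f(x) = lim d_M(x, u_l) of a Cauchy
sequence u. The function f is 1-Lipschitz; from a given point there is a geodesic along which f
decreases at unit rate (`IsLimitDist.eventually_exists_unitGeod`), this property persists
(`IsLimitDist.eventually_extend`), and so f reaches 0, at the limit of u. The local facts needed,
that short geodesics minimize and that minimizing broken geodesics have no corners, come from the
calibrating function `calib` (`Calibrates.le_chain`, `Calibrates.eqOn`); no normal coordinates are
used. -/

noncomputable section

namespace Finsler

set_option maxSynthPendingDepth 3
set_option linter.unusedSectionVars false

section

variable {n : ℕ}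

/-! ### Functions on the slit tangent bundle of a coordinate domain -/

/-- The slit tangent bundle `U × (V ∖ 0)` of a coordinate domain. -/
def slit {V : Type*} [Zero V] (U : Set V) : Set (V × V) := U ×ˢ {0}ᶜ

theorem isOpen_slit {V : Type*} [Zero V] [TopologicalSpace V] [T1Space V] {U : Set V} (hU : IsOpen U) : IsOpen (slit U) :=
  hU.prod isOpen_compl_singleton

/-- Smoothness on the slit tangent bundle. -/
def SmoothOn (U : Set (E n)) (u : E n → E n → ℝ) : Prop :=
  ContDiffOn ℝ ∞ (Function.uncurry u) (slit U)

theorem SmoothOn.contDiffAt {U : Set (E n)} {u : E n → E n → ℝ} (h : SmoothOn U u)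
    (hU : IsOpen U) {z : E n × E n} (hz : z ∈ slit U) :
    ContDiffAt ℝ ∞ (Function.uncurry u) z :=
  ContDiffOn.contDiffAt h ((isOpen_slit hU).mem_nhds hz)

theorem SmoothOn.hasFDerivAt {U : Set (E n)} {u : E n → E n → ℝ} (h : SmoothOn U u)
    (hU : IsOpen U) {z : E n × E n} (hz : z ∈ slit U) :
    HasFDerivAt (Function.uncurry u) (fderiv ℝ (Function.uncurry u) z) z :=
  ((h.contDiffAt hU hz).differentiableAt (by simp)).hasFDerivAt

theorem SmoothOn.hasFDerivAt_left {U : Set (E n)} {u : E n → E n → ℝ} (h : SmoothOn U u)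
    (hU : IsOpen U) {z : E n × E n} (hz : z ∈ slit U) : HasFDerivAt (fun x' => u x' z.2)
      ((fderiv ℝ (Function.uncurry u) z).comp (ContinuousLinearMap.inl ℝ (E n) (E n))) z.1 :=
  HasFDerivAt.comp (g := Function.uncurry u) (f := fun x' => (x', z.2)) z.1 (h.hasFDerivAt hU hz)
    (hasFDerivAt_prodMk_left (𝕜 := ℝ) z.1 z.2)

theorem SmoothOn.hasFDerivAt_right {U : Set (E n)} {u : E n → E n → ℝ} (h : SmoothOn U u)
    (hU : IsOpen U) {z : E n × E n} (hz : z ∈ slit U) : HasFDerivAt (fun y' => u z.1 y')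
      ((fderiv ℝ (Function.uncurry u) z).comp (ContinuousLinearMap.inr ℝ (E n) (E n))) z.2 :=
  HasFDerivAt.comp (g := Function.uncurry u) (f := fun y' => (z.1, y')) z.2 (h.hasFDerivAt hU hz)
    (hasFDerivAt_prodMk_right (𝕜 := ℝ) z.1 z.2)

/-- Partial derivatives are traded for the Fréchet derivative on pairs, where the chain rule and the
symmetry of second derivatives are available; nearly all tensor identities below are proved in that
form. -/
theorem SmoothOn.dx_eq {U : Set (E n)} {u : E n → E n → ℝ} (h : SmoothOn U u)
    (hU : IsOpen U) {z : E n × E n} (hz : z ∈ slit U) (k : Fin n) :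
    dx k u z.1 z.2 = fderiv ℝ (Function.uncurry u) z (EuclideanSpace.single k 1, 0) := by
  rw [dx, (h.hasFDerivAt_left hU hz).fderiv]
  simp

theorem SmoothOn.dy_eq {U : Set (E n)} {u : E n → E n → ℝ} (h : SmoothOn U u)
    (hU : IsOpen U) {z : E n × E n} (hz : z ∈ slit U) (k : Fin n) :
    dy k u z.1 z.2 = fderiv ℝ (Function.uncurry u) z (0, EuclideanSpace.single k 1) := by
  rw [dy, (h.hasFDerivAt_right hU hz).fderiv]
  simp

theorem SmoothOn.fderiv_smooth {U : Set (E n)} {u : E n → E n → ℝ} (h : SmoothOn U u)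
    (hU : IsOpen U) : ContDiffOn ℝ ∞ (fderiv ℝ (Function.uncurry u)) (slit U) :=
  ContDiffOn.fderiv_of_isOpen h (isOpen_slit hU) (by simp)

theorem SmoothOn.dx {U : Set (E n)} {u : E n → E n → ℝ} (h : SmoothOn U u)
    (hU : IsOpen U) (k : Fin n) : SmoothOn U (dx k u) :=
  ((h.fderiv_smooth hU).clm_apply contDiffOn_const).congr fun _ hz => h.dx_eq hU hz k

theorem SmoothOn.dy {U : Set (E n)} {u : E n → E n → ℝ} (h : SmoothOn U u)
    (hU : IsOpen U) (k : Fin n) : SmoothOn U (dy k u) :=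
  ((h.fderiv_smooth hU).clm_apply contDiffOn_const).congr fun _ hz => h.dy_eq hU hz k

theorem SmoothOn.fderiv_dx {U : Set (E n)} {u : E n → E n → ℝ} (h : SmoothOn U u)
    (hU : IsOpen U) {z : E n × E n} (hz : z ∈ slit U) (k : Fin n) (ζ : E n × E n) :
    fderiv ℝ (Function.uncurry (Finsler.dx k u)) z ζ =
      fderiv ℝ (fderiv ℝ (Function.uncurry u)) z ζ (EuclideanSpace.single k 1, 0) := by
  have h1 : Function.uncurry (Finsler.dx k u) =ᶠ[𝓝 z]
      fun z' => fderiv ℝ (Function.uncurry u) z' (EuclideanSpace.single k 1, 0) := by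
    filter_upwards [(isOpen_slit hU).mem_nhds hz] with z' hz' using h.dx_eq hU hz' k
  have h2 : DifferentiableAt ℝ (fderiv ℝ (Function.uncurry u)) z :=
    (((h.fderiv_smooth hU).contDiffAt ((isOpen_slit hU).mem_nhds hz))).differentiableAt (by simp)
  rw [h1.fderiv_eq, fderiv_clm_apply h2 (differentiableAt_const _)]
  simp

theorem SmoothOn.fderiv_dy {U : Set (E n)} {u : E n → E n → ℝ} (h : SmoothOn U u)
    (hU : IsOpen U) {z : E n × E n} (hz : z ∈ slit U) (k : Fin n) (ζ : E n × E n) :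
    fderiv ℝ (Function.uncurry (Finsler.dy k u)) z ζ =
      fderiv ℝ (fderiv ℝ (Function.uncurry u)) z ζ (0, EuclideanSpace.single k 1) := by
  have h1 : Function.uncurry (Finsler.dy k u) =ᶠ[𝓝 z]
      fun z' => fderiv ℝ (Function.uncurry u) z' (0, EuclideanSpace.single k 1) := by
    filter_upwards [(isOpen_slit hU).mem_nhds hz] with z' hz' using h.dy_eq hU hz' k
  have h2 : DifferentiableAt ℝ (fderiv ℝ (Function.uncurry u)) z :=
    (((h.fderiv_smooth hU).contDiffAt ((isOpen_slit hU).mem_nhds hz))).differentiableAt (by simp)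
  rw [h1.fderiv_eq, fderiv_clm_apply h2 (differentiableAt_const _)]
  simp

theorem SmoothOn.fderiv_fderiv_symm {U : Set (E n)} {u : E n → E n → ℝ} (h : SmoothOn U u)
    (hU : IsOpen U) {z : E n × E n} (hz : z ∈ slit U) (ζ ξ : E n × E n) :
    fderiv ℝ (fderiv ℝ (Function.uncurry u)) z ζ ξ =
      fderiv ℝ (fderiv ℝ (Function.uncurry u)) z ξ ζ :=
  ((h.contDiffAt hU hz).isSymmSndFDerivAt (by simpa using ENat.LEInfty.out)) ζ ξ

theorem sum_mul_single (w : E n) : ∑ i, w i • EuclideanSpace.single i (1 : ℝ) = w := by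
  ext j
  simp [Pi.single_apply]

theorem map_eq_sum {F : Type*} [AddCommGroup F] [Module ℝ F] [TopologicalSpace F]
    (ℓ : E n →L[ℝ] F) (w : E n) :
    ℓ w = ∑ i, w i • ℓ (EuclideanSpace.single i 1) := by
  conv_lhs => rw [← sum_mul_single w]
  simp

theorem map_inl_eq_sum {F : Type*} [AddCommGroup F] [Module ℝ F] [TopologicalSpace F]
    (ℓ : E n × E n →L[ℝ] F) (w : E n) :
    ℓ (w, 0) = ∑ i, w i • ℓ (EuclideanSpace.single i 1, 0) :=
  map_eq_sum (ℓ.comp (ContinuousLinearMap.inl ℝ (E n) (E n))) w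

theorem map_inr_eq_sum {F : Type*} [AddCommGroup F] [Module ℝ F] [TopologicalSpace F]
    (ℓ : E n × E n →L[ℝ] F) (w : E n) :
    ℓ (0, w) = ∑ i, w i • ℓ (0, EuclideanSpace.single i 1) :=
  map_eq_sum (ℓ.comp (ContinuousLinearMap.inr ℝ (E n) (E n))) w

theorem SmoothOn.sum_dx {U : Set (E n)} {u : E n → E n → ℝ} (h : SmoothOn U u)
    (hU : IsOpen U) {z : E n × E n} (hz : z ∈ slit U) (w : E n) :
    ∑ k, w k * Finsler.dx k u z.1 z.2 = fderiv ℝ (Function.uncurry u) z (w, 0) := by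
  rw [map_inl_eq_sum]
  simp [h.dx_eq hU hz]

theorem SmoothOn.sum_dy {U : Set (E n)} {u : E n → E n → ℝ} (h : SmoothOn U u)
    (hU : IsOpen U) {z : E n × E n} (hz : z ∈ slit U) (w : E n) :
    ∑ k, w k * Finsler.dy k u z.1 z.2 = fderiv ℝ (Function.uncurry u) z (0, w) := by
  rw [map_inr_eq_sum]
  simp [h.dy_eq hU hz]

section Algebra

variable {U : Set (E n)} {u v : E n → E n → ℝ}

theorem SmoothOn.add (hu : SmoothOn U u) (hv : SmoothOn U v) :
    SmoothOn U (fun x y => u x y + v x y) := ContDiffOn.add hu hv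

theorem SmoothOn.sub (hu : SmoothOn U u) (hv : SmoothOn U v) :
    SmoothOn U (fun x y => u x y - v x y) := ContDiffOn.sub hu hv

theorem SmoothOn.mul (hu : SmoothOn U u) (hv : SmoothOn U v) :
    SmoothOn U (fun x y => u x y * v x y) := ContDiffOn.mul hu hv

theorem smoothOn_const (c : ℝ) : SmoothOn U (fun _ _ => c) := contDiffOn_const

theorem SmoothOn.sum {ι : Type*} {s : Finset ι} {f : ι → E n → E n → ℝ}
    (h : ∀ i ∈ s, SmoothOn U (f i)) : SmoothOn U (fun x y => ∑ i ∈ s, f i x y) :=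
  ContDiffOn.sum (f := fun i (z : E n × E n) => f i z.1 z.2) h

theorem SmoothOn.prod {ι : Type*} {s : Finset ι} {f : ι → E n → E n → ℝ}
    (h : ∀ i ∈ s, SmoothOn U (f i)) : SmoothOn U (fun x y => ∏ i ∈ s, f i x y) :=
  contDiffOn_prod (f := fun i (z : E n × E n) => f i z.1 z.2) h

theorem smoothOn_snd_apply (k : Fin n) : SmoothOn U (fun _ y => y k) := by
  have : ContDiff ℝ ∞ (fun z : E n × E n => z.2 k) := by fun_prop
  exact this.contDiffOn

theorem SmoothOn.det {A : Fin n → Fin n → E n → E n → ℝ} (h : ∀ i j, SmoothOn U (A i j)) :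
    SmoothOn U (fun x y => (Matrix.of fun i j => A i j x y).det) := by
  simp only [Matrix.det_apply']
  exact SmoothOn.sum fun σ _ => (smoothOn_const _).mul (SmoothOn.prod fun i _ => h _ _)

theorem SmoothOn.matrix_inv {A : Fin n → Fin n → E n → E n → ℝ} (h : ∀ i j, SmoothOn U (A i j))
    (hdet : ∀ x ∈ U, ∀ y ≠ 0, (Matrix.of fun i j => A i j x y).det ≠ 0) (i j : Fin n) :
    SmoothOn U (fun x y => (Matrix.of fun i j => A i j x y)⁻¹ i j) := by
  simp only [Matrix.inv_def, Matrix.smul_apply, Ring.inverse_eq_inv', smul_eq_mul]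
  refine SmoothOn.mul ?_ ?_
  · exact ContDiffOn.inv (SmoothOn.det h) fun z hz => hdet _ hz.1 _ hz.2
  -- Cramer's rule: the entries of the adjugate are determinants of matrices with smooth entries.
  · simp only [Matrix.adjugate_apply]
    have : ∀ x y, (Matrix.of fun i j => A i j x y).updateRow j (Pi.single i 1) =
        Matrix.of fun k l => if k = j then (if l = i then 1 else 0) else A k l x y := by
      intro x y
      ext k l
      by_cases hk : k = j <;> simp [Matrix.updateRow_apply, hk, Pi.single_apply]
    simp only [this]
    refine SmoothOn.det fun k l => ?_
    by_cases hk : k = j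
    · simpa [hk] using smoothOn_const _
    · simpa [hk] using h k l

end Algebra

/-! ### Homogeneity -/

/-- Positive homogeneity of degree `d` in the direction. -/
def Homog (U : Set (E n)) (d : ℕ) (u : E n → E n → ℝ) : Prop :=
  ∀ x ∈ U, ∀ y : E n, y ≠ 0 → ∀ c : ℝ, 0 < c → u x (c • y) = c ^ d * u x y

section Homog

variable {U : Set (E n)} {u v : E n → E n → ℝ} {d e : ℕ}

theorem Homog.dx (h : Homog U d u) (hU : IsOpen U) (k : Fin n) (hu : SmoothOn U u) :
    Homog U d (dx k u) := by
  intro x hx y hy c hc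
  have h1 : (fun x' => u x' (c • y)) =ᶠ[𝓝 x] fun x' => c ^ d * u x' y := by
    filter_upwards [hU.mem_nhds hx] with x' hx' using h x' hx' y hy c hc
  have h2 : DifferentiableAt ℝ (fun x' => u x' y) x :=
    (hu.hasFDerivAt_left hU (z := (x, y)) ⟨hx, hy⟩).differentiableAt
  rw [Finsler.dx, h1.fderiv_eq, fderiv_const_mul h2]
  simp [Finsler.dx]

/-- The chain rule applied to u(x, cy) = c^(d+1) u(x, y) produces one factor c on the left;
cancelling it lowers the degree by one. -/
theorem Homog.dy (h : Homog U (d + 1) u) (hU : IsOpen U) (k : Fin n) (hu : SmoothOn U u) :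
    Homog U d (dy k u) := by
  intro x hx y hy c hc
  have hcy : c • y ≠ 0 := smul_ne_zero hc.ne' hy
  have key : ∀ y', y' ≠ 0 → DifferentiableAt ℝ (fun y' => u x y') y' := fun y' hy' =>
    (hu.hasFDerivAt_right hU (z := (x, y')) ⟨hx, hy'⟩).differentiableAt
  have h1 : (fun y' => u x (c • y')) =ᶠ[𝓝 y] fun y' => c ^ (d + 1) * u x y' := by
    filter_upwards [isOpen_compl_singleton.mem_nhds hy] with y' hy' using h x hx y' hy' c hc
  have h2 : HasFDerivAt (fun y' => u x (c • y'))
      ((fderiv ℝ (fun y' => u x y') (c • y)).comp (c • ContinuousLinearMap.id ℝ (E n))) y :=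
    HasFDerivAt.comp (g := fun y' => u x y') (f := fun y' => c • y') y (key _ hcy).hasFDerivAt
      ((hasFDerivAt_id y).const_smul c)
  have h3 := h1.fderiv_eq (𝕜 := ℝ)
  rw [h2.fderiv, fderiv_const_mul (key y hy)] at h3
  have h4 := congrArg (fun ℓ : E n →L[ℝ] ℝ => ℓ (EuclideanSpace.single k 1)) h3
  simp only [ContinuousLinearMap.comp_apply, smul_apply,
    ContinuousLinearMap.id_apply, map_smul, smul_eq_mul] at h4
  have h5 : c * Finsler.dy k u x (c • y) = c * (c ^ d * Finsler.dy k u x y) := by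
    rw [Finsler.dy, Finsler.dy, h4]; ring
  exact mul_left_cancel₀ hc.ne' h5

/-- Euler's identity: differentiate c ↦ u(x, cy) at c = 1 in two ways. -/
theorem Homog.euler (h : Homog U d u) (hU : IsOpen U) (hu : SmoothOn U u) {z : E n × E n}
    (hz : z ∈ slit U) :
    fderiv ℝ (Function.uncurry u) z (0, z.2) = d * u z.1 z.2 := by
  have h0 : HasDerivAt (fun c : ℝ => (z.1, c • z.2)) ((0 : E n), z.2) 1 := by
    have := (hasDerivAt_const (1 : ℝ) z.1).prodMk ((hasDerivAt_id (1 : ℝ)).smul_const z.2)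
    simpa using this
  have h1 : HasDerivAt (fun c : ℝ => u z.1 (c • z.2))
      (fderiv ℝ (Function.uncurry u) z (0, z.2)) 1 := by
    have hf : HasFDerivAt (Function.uncurry u) (fderiv ℝ (Function.uncurry u) z)
        ((fun c : ℝ => (z.1, c • z.2)) 1) := by simpa using hu.hasFDerivAt hU hz
    exact hf.comp_hasDerivAt (1 : ℝ) h0
  have h2 : (fun c : ℝ => u z.1 (c • z.2)) =ᶠ[𝓝 1] fun c => c ^ d * u z.1 z.2 := by
    filter_upwards [lt_mem_nhds (zero_lt_one' ℝ)] with c hc using h _ hz.1 _ hz.2 c hc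
  have h3 : HasDerivAt (fun c : ℝ => c ^ d * u z.1 z.2) (d * u z.1 z.2) 1 := by
    simpa using (hasDerivAt_pow d (1 : ℝ)).mul_const (u z.1 z.2)
  exact (h1.congr_of_eventuallyEq h2.symm).unique h3

theorem Homog.add (hu : Homog U d u) (hv : Homog U d v) :
    Homog U d (fun x y => u x y + v x y) := fun x hx y hy c hc => by
  simp only [hu x hx y hy c hc, hv x hx y hy c hc]; ring

theorem Homog.sub (hu : Homog U d u) (hv : Homog U d v) :
    Homog U d (fun x y => u x y - v x y) := fun x hx y hy c hc => by
  simp only [hu x hx y hy c hc, hv x hx y hy c hc]; ring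

theorem Homog.mul (hu : Homog U d u) (hv : Homog U e v) :
    Homog U (d + e) (fun x y => u x y * v x y) := fun x hx y hy c hc => by
  simp only [hu x hx y hy c hc, hv x hx y hy c hc]; ring

theorem homog_const (a : ℝ) : Homog U 0 (fun _ _ => a) := fun x hx y hy c hc => by simp

theorem homog_snd_apply (k : Fin n) : Homog U 1 (fun _ y => y k) := fun x hx y hy c hc => by
  simp

theorem Homog.sum {ι : Type*} {s : Finset ι} {f : ι → E n → E n → ℝ}
    (h : ∀ i ∈ s, Homog U d (f i)) : Homog U d (fun x y => ∑ i ∈ s, f i x y) :=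
  fun x hx y hy c hc => by
    rw [Finset.mul_sum]
    exact Finset.sum_congr rfl fun i hi => h i hi x hx y hy c hc

end Homog

end

section

variable {n : ℕ} {V : Type*} [NormedAddCommGroup V] [NormedSpace ℝ V]
  [FiniteDimensional ℝ V]


/-! ### The trace of the Riemann curvature of a spray and its invariance -/

/-- The trace of endomorphisms of the coordinate space, as a continuous linear form. -/
def tr : (V →L[ℝ] V) →L[ℝ] ℝ :=
  LinearMap.toContinuousLinearMap
    ((LinearMap.trace ℝ (V)).comp (ContinuousLinearMap.coeLM ℝ))

theorem tr_mul_comm (A B : V →L[ℝ] V) : tr (A * B) = tr (B * A) :=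
  LinearMap.trace_mul_comm ℝ (A : V →ₗ[ℝ] V) (B : V →ₗ[ℝ] V)

/-- The derivative of a map in the position variable. -/
def derivX (G : V × V → V) (z : V × V) : V →L[ℝ] V :=
  (fderiv ℝ G z).comp (ContinuousLinearMap.inl ℝ (V) (V))

/-- The derivative of a map in the direction variable. -/
def derivY (G : V × V → V) (z : V × V) : V →L[ℝ] V :=
  (fderiv ℝ G z).comp (ContinuousLinearMap.inr ℝ (V) (V))

/-- The trace of the Riemann curvature of the spray `x'' + G(x, x') = 0`. -/
def traceCurv (G : V × V → V) (z : V × V) : ℝ :=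
  tr (derivX G z) - (1 / 4) * tr (derivY G z * derivY G z)
    - (1 / 2) * fderiv ℝ (fun z' => tr (derivY G z')) z (z.2, -G z)

/-- The tangent map of `φ`. -/
def tangentLift (φ : V → V) (z : V × V) : V × V := (φ z.1, fderiv ℝ φ z.1 z.2)

theorem tr_apply (A : E n →L[ℝ] E n) : tr A = ∑ i, A (EuclideanSpace.single i 1) i := by
  have : tr A = LinearMap.trace ℝ (E n) A := rfl
  rw [this, LinearMap.trace_eq_matrix_trace ℝ (EuclideanSpace.basisFun (Fin n) ℝ).toBasis,
    Matrix.trace]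
  refine Finset.sum_congr rfl fun i _ => ?_
  simp [LinearMap.toMatrix_apply]

section ChangeOfCoordinates

variable {U : Set (V)} {φ : V → V}

theorem hasFDerivAt_fderiv (hU : IsOpen U) (hφ : ContDiffOn ℝ ∞ φ U) {x : V} (hx : x ∈ U) :
    HasFDerivAt (fderiv ℝ φ) (fderiv ℝ (fderiv ℝ φ) x) x :=
  (((hφ.fderiv_of_isOpen hU (m := ∞) (by simp)).contDiffAt (hU.mem_nhds hx)).differentiableAt
    (by simp)).hasFDerivAt

theorem fderiv_fderiv_symm (hU : IsOpen U) (hφ : ContDiffOn ℝ ∞ φ U) {x : V} (hx : x ∈ U)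
    (a b : V) : fderiv ℝ (fderiv ℝ φ) x a b = fderiv ℝ (fderiv ℝ φ) x b a :=
  ((hφ.contDiffAt (hU.mem_nhds hx)).isSymmSndFDerivAt (by simpa using ENat.LEInfty.out)) a b

theorem hasFDerivAt_tangentLift (hU : IsOpen U) (hφ : ContDiffOn ℝ ∞ φ U) {z : V × V}
    (hz : z.1 ∈ U) :
    HasFDerivAt (tangentLift φ) (((fderiv ℝ φ z.1).comp (ContinuousLinearMap.fst ℝ (V) (V))).prod
      ((fderiv ℝ φ z.1).comp (ContinuousLinearMap.snd ℝ (V) (V)) +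
        ((fderiv ℝ (fderiv ℝ φ) z.1).comp (ContinuousLinearMap.fst ℝ (V) (V))).flip z.2)) z := by
  have h1 : HasFDerivAt (fun z : V × V => φ z.1)
      ((fderiv ℝ φ z.1).comp (ContinuousLinearMap.fst ℝ (V) (V))) z :=
    ((hφ.contDiffAt (hU.mem_nhds hz)).differentiableAt (by simp)).hasFDerivAt.comp z
      (hasFDerivAt_fst (p := z))
  have h2 : HasFDerivAt (fun z : V × V => fderiv ℝ φ z.1)
      ((fderiv ℝ (fderiv ℝ φ) z.1).comp (ContinuousLinearMap.fst ℝ (V) (V))) z :=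
    (hasFDerivAt_fderiv hU hφ hz).comp z (hasFDerivAt_fst (p := z))
  exact h1.prodMk (h2.clm_apply (hasFDerivAt_snd (p := z)))

theorem derivY_apply (G : V × V → V) (z : V × V) (b : V) :
    derivY G z b = fderiv ℝ G z (0, b) := by simp [derivY]

theorem derivX_apply (G : V × V → V) (z : V × V) (a : V) :
    derivX G z a = fderiv ℝ G z (a, 0) := by simp [derivX]

theorem contDiffOn_derivY {Ω : Set (V × V)} (hΩ : IsOpen Ω) {G : V × V → V}
    (hG : ContDiffOn ℝ ∞ G Ω) : ContDiffOn ℝ ∞ (derivY G) Ω :=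
  ContDiffOn.clm_comp (hG.fderiv_of_isOpen hΩ (by simp)) contDiffOn_const

/-- The law of transformation of the spray coefficients, differentiated. -/
theorem fderiv_spray_transform {U' : Set (V)} (hU : IsOpen U) (hU' : IsOpen U')
    (hφ : ContDiffOn ℝ ∞ φ U) (hmaps : MapsTo (tangentLift φ) (slit U) (slit U'))
    {G G' : V × V → V} (hG : ContDiffOn ℝ ∞ G (slit U)) (hG' : ContDiffOn ℝ ∞ G' (slit U'))
    (hlaw : ∀ z ∈ slit U, G' (tangentLift φ z) =
      fderiv ℝ φ z.1 (G z) - fderiv ℝ (fderiv ℝ φ) z.1 z.2 z.2)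
    {z : V × V} (hz : z ∈ slit U) (a b : V) :
    fderiv ℝ G' (tangentLift φ z)
        (fderiv ℝ φ z.1 a, fderiv ℝ φ z.1 b + fderiv ℝ (fderiv ℝ φ) z.1 a z.2) =
      fderiv ℝ (fderiv ℝ φ) z.1 a (G z) + fderiv ℝ φ z.1 (fderiv ℝ G z (a, b))
        - (fderiv ℝ (fderiv ℝ (fderiv ℝ φ)) z.1 a z.2 z.2
          + 2 • fderiv ℝ (fderiv ℝ φ) z.1 z.2 b) := by
  have hΩ := isOpen_slit hU
  have hφ1 : ContDiffOn ℝ ∞ (fderiv ℝ φ) U := hφ.fderiv_of_isOpen hU (by simp)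
  have hφ2 : ContDiffOn ℝ ∞ (fderiv ℝ (fderiv ℝ φ)) U := hφ1.fderiv_of_isOpen hU (by simp)
  have d0 : HasFDerivAt G (fderiv ℝ G z) z :=
    ((hG.contDiffAt (hΩ.mem_nhds hz)).differentiableAt (by simp)).hasFDerivAt
  have d0' : HasFDerivAt G' (fderiv ℝ G' (tangentLift φ z)) (tangentLift φ z) :=
    ((hG'.contDiffAt ((isOpen_slit hU').mem_nhds (hmaps hz))).differentiableAt
      (by simp)).hasFDerivAt
  have d1 : HasFDerivAt (fun z : V × V => fderiv ℝ φ z.1)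
      ((fderiv ℝ (fderiv ℝ φ) z.1).comp (ContinuousLinearMap.fst ℝ (V) (V))) z :=
    (hasFDerivAt_fderiv hU hφ hz.1).comp z (hasFDerivAt_fst (p := z))
  have d2 : HasFDerivAt (fun z : V × V => fderiv ℝ (fderiv ℝ φ) z.1)
      ((fderiv ℝ (fderiv ℝ (fderiv ℝ φ)) z.1).comp (ContinuousLinearMap.fst ℝ (V) (V))) z :=
    HasFDerivAt.comp z (((hφ2.contDiffAt (hU.mem_nhds hz.1)).differentiableAt
      (by simp)).hasFDerivAt) (hasFDerivAt_fst (p := z))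
  have d3 := (d1.clm_apply d0).sub
    ((d2.clm_apply (hasFDerivAt_snd (p := z))).clm_apply (hasFDerivAt_snd (p := z)))
  have d4 := d0'.comp z (hasFDerivAt_tangentLift hU hφ hz.1)
  have heq : (G' ∘ tangentLift φ) =ᶠ[𝓝 z] fun z =>
      fderiv ℝ φ z.1 (G z) - fderiv ℝ (fderiv ℝ φ) z.1 z.2 z.2 := by
    filter_upwards [hΩ.mem_nhds hz] with z' hz' using hlaw z' hz'
  -- Both sides of the transformation law are differentiated; the identity is the equality of the
  -- two derivatives evaluated at (a, b).
  have d5 := (d4.congr_of_eventuallyEq heq.symm).unique d3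
  have d6 := congrArg (fun ℓ : V × V →L[ℝ] V => ℓ (a, b)) d5
  simp at d6
  rw [d6, fderiv_fderiv_symm hU hφ hz.1 b z.2]
  module

/-- The trace of the curvature of a spray is invariant under changes of coordinates. -/
theorem traceCurv_tangentLift {U' : Set (V)} (hU : IsOpen U) (hU' : IsOpen U')
    (hφ : ContDiffOn ℝ ∞ φ U) (hmaps : MapsTo (tangentLift φ) (slit U) (slit U'))
    {K : V → V →L[ℝ] V} (hK : ContDiffOn ℝ ∞ K U)
    (hJK : ∀ x ∈ U, fderiv ℝ φ x * K x = 1) (hKJ : ∀ x ∈ U, K x * fderiv ℝ φ x = 1)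
    {G G' : V × V → V} (hG : ContDiffOn ℝ ∞ G (slit U)) (hG' : ContDiffOn ℝ ∞ G' (slit U'))
    (hlaw : ∀ z ∈ slit U, G' (tangentLift φ z) =
      fderiv ℝ φ z.1 (G z) - fderiv ℝ (fderiv ℝ φ) z.1 z.2 z.2)
    {z : V × V} (hz : z ∈ slit U) :
    traceCurv G' (tangentLift φ z) = traceCurv G z := by
  have hΩ := isOpen_slit hU
  have hφ1 : ContDiffOn ℝ ∞ (fderiv ℝ φ) U := hφ.fderiv_of_isOpen hU (by simp)
  have hφ2 : ContDiffOn ℝ ∞ (fderiv ℝ (fderiv ℝ φ)) U := hφ1.fderiv_of_isOpen hU (by simp)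
  have law := fun z hz => fderiv_spray_transform hU hU' hφ hmaps hG hG' hlaw (z := z) hz
  -- the vertical derivative
  have hB : ∀ z ∈ slit U, derivY G' (tangentLift φ z) =
      (fderiv ℝ φ z.1 * derivY G z - 2 • fderiv ℝ (fderiv ℝ φ) z.1 z.2) * K z.1 := by
    intro z hz
    have h1 : derivY G' (tangentLift φ z) * fderiv ℝ φ z.1 =
        fderiv ℝ φ z.1 * derivY G z - 2 • fderiv ℝ (fderiv ℝ φ) z.1 z.2 := by
      ext1 b
      have := law z hz 0 b
      simp only [map_zero, zero_apply, add_zero, zero_add] at this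
      simp only [mul_apply_eq_comp, derivY_apply, this,
        sub_apply, smul_apply]
    rw [← h1, mul_assoc, hJK _ hz.1, mul_one]
  obtain ⟨x, y⟩ := z
  set J := fderiv ℝ φ x with hJ
  set J' := fderiv ℝ (fderiv ℝ φ) x y with hJ'
  set A := fderiv ℝ (fderiv ℝ (fderiv ℝ φ)) x y y - fderiv ℝ (fderiv ℝ φ) x (G (x, y)) with hA
  set B := derivY G (x, y) with hBdef
  have JK : J * K x = 1 := hJK x hz.1
  have KJ : K x * J = 1 := hKJ x hz.1
  -- the derivative of the inverse Jacobian
  have hKd : HasFDerivAt K (fderiv ℝ K x) x :=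
    ((hK.contDiffAt (hU.mem_nhds hz.1)).differentiableAt (by simp)).hasFDerivAt
  have hK' : fderiv ℝ K x y = -(K x * J' * K x) := by
    have h1 := HasFDerivAt.mul' (hasFDerivAt_fderiv hU hφ hz.1) hKd
    have h2 : (fun x => fderiv ℝ φ x * K x) =ᶠ[𝓝 x] fun _ => 1 := by
      filter_upwards [hU.mem_nhds hz.1] with x' hx' using hJK x' hx'
    have h3 := (h1.congr_of_eventuallyEq h2.symm).unique (hasFDerivAt_const _ _)
    have h4 := congrArg (fun ℓ : V →L[ℝ] V →L[ℝ] V => ℓ y) h3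
    simp only [add_apply, smul_apply,
      zero_apply, smul_eq_mul, MulOpposite.smul_eq_mul_unop,
      MulOpposite.unop_op] at h4
    have h5 : J * fderiv ℝ K x y = -(J' * K x) := eq_neg_of_add_eq_zero_left h4
    calc fderiv ℝ K x y = K x * J * fderiv ℝ K x y := by rw [KJ, one_mul]
      _ = K x * (J * fderiv ℝ K x y) := mul_assoc _ _ _
      _ = -(K x * J' * K x) := by rw [h5, mul_neg, mul_assoc]
  -- the derivative of the trace of the vertical derivative along the spray
  have hderB : DifferentiableAt ℝ (fun z => tr (derivY G z)) (x, y) :=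
    ((tr (V := V)).contDiff.contDiffAt.comp _ ((contDiffOn_derivY hΩ hG).contDiffAt
      (hΩ.mem_nhds hz))).differentiableAt (n := ∞) (by simp)
  have hderB' : DifferentiableAt ℝ (fun z => tr (derivY G' z)) (tangentLift φ (x, y)) :=
    ((tr (V := V)).contDiff.contDiffAt.comp _ ((contDiffOn_derivY (isOpen_slit hU') hG').contDiffAt
      ((isOpen_slit hU').mem_nhds (hmaps hz)))).differentiableAt (n := ∞) (by simp)
  have d2 : HasFDerivAt (fun z : V × V => fderiv ℝ (fderiv ℝ φ) z.1)
      ((fderiv ℝ (fderiv ℝ (fderiv ℝ φ)) x).comp (ContinuousLinearMap.fst ℝ (V) (V))) (x, y) :=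
    HasFDerivAt.comp (x, y) (((hφ2.contDiffAt (hU.mem_nhds hz.1)).differentiableAt
      (by simp)).hasFDerivAt) (hasFDerivAt_fst (p := (x, y)))
  have d3 : HasFDerivAt (fun z : V × V => K z.1)
      ((fderiv ℝ K x).comp (ContinuousLinearMap.fst ℝ (V) (V))) (x, y) :=
    HasFDerivAt.comp (x, y) hKd (hasFDerivAt_fst (p := (x, y)))
  have d4 := tr.hasFDerivAt.comp (x, y)
    ((d2.clm_apply (hasFDerivAt_snd (p := (x, y)))).mul' d3)
  have d5 := hderB.hasFDerivAt.sub (d4.const_mul 2)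
  have d6 := hderB'.hasFDerivAt.comp (x, y) (hasFDerivAt_tangentLift hU hφ hz.1)
  have heq : ((fun z => tr (derivY G' z)) ∘ tangentLift φ) =ᶠ[𝓝 (x, y)] fun z =>
      tr (derivY G z) - 2 * (tr ∘ fun z : V × V =>
        (fderiv ℝ (fderiv ℝ φ) z.1 z.2 * K z.1)) z := by
    filter_upwards [hΩ.mem_nhds hz] with z' hz'
    simp only [Function.comp_apply, hB z' hz', sub_mul, map_sub, smul_mul_assoc, map_nsmul,
      mul_assoc]
    -- The conjugation by the Jacobian disappears under the trace; only the inhomogeneous term -2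
    -- tr(D²φ(y) K) is left.
    rw [tr_mul_comm, mul_assoc, hKJ _ hz'.1, mul_one]
    simp
  have d7 := (d6.congr_of_eventuallyEq heq.symm).unique d5
  have d8 : fderiv ℝ (fun z' => tr (derivY G' z')) (tangentLift φ (x, y))
      (J y, J (-G (x, y)) + fderiv ℝ (fderiv ℝ φ) x y y) =
      fderiv ℝ (fun z' => tr (derivY G z')) (x, y) (y, -G (x, y))
        - 2 * tr (J' * (fderiv ℝ K x y) + (fderiv ℝ (fderiv ℝ φ) x (-G (x, y)) +
          fderiv ℝ (fderiv ℝ (fderiv ℝ φ)) x y y) * K x) :=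
    congrArg (fun ℓ : V × V →L[ℝ] ℝ => ℓ (y, -G (x, y))) d7
  have hS : fderiv ℝ (fun z' => tr (derivY G' z')) (tangentLift φ (x, y))
      ((tangentLift φ (x, y)).2, -G' (tangentLift φ (x, y))) =
      fderiv ℝ (fun z' => tr (derivY G z')) (x, y) (y, -G (x, y))
        - 2 * (tr (A * K x) - tr (J' * K x * (J' * K x))) := by
    have e1 : ((tangentLift φ (x, y)).2, -G' (tangentLift φ (x, y))) =
        (J y, J (-G (x, y)) + fderiv ℝ (fderiv ℝ φ) x y y) := by
      rw [hlaw _ hz]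
      simp only [tangentLift, Prod.mk.injEq, map_neg]
      exact ⟨rfl, by abel⟩
    have e2 : tr (A * K x) - tr (J' * K x * (J' * K x)) =
        tr (J' * (fderiv ℝ K x y) + A * K x) := by
      rw [hK', map_add]
      have : J' * -(K x * J' * K x) = -(J' * K x * (J' * K x)) := by noncomm_ring
      rw [this, map_neg]; ring
    rw [e1, e2]
    have e3 : A = fderiv ℝ (fderiv ℝ φ) x (-G (x, y)) +
      fderiv ℝ (fderiv ℝ (fderiv ℝ φ)) x y y := by rw [hA, map_neg]; abel
    rw [e3, d8]
  -- the horizontal derivative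
  have hX : derivX G' (tangentLift φ (x, y)) =
      (J * derivX G (x, y) - A - derivY G' (tangentLift φ (x, y)) * J') * K x := by
    have h1 : derivX G' (tangentLift φ (x, y)) * J =
        J * derivX G (x, y) - A - derivY G' (tangentLift φ (x, y)) * J' := by
      ext1 a
      have h2 := law _ hz a 0
      simp only [map_zero, zero_add, smul_zero, add_zero] at h2
      have h3 : fderiv ℝ G' (tangentLift φ (x, y)) (J a, fderiv ℝ (fderiv ℝ φ) x a y) =
          derivX G' (tangentLift φ (x, y)) (J a) +
            derivY G' (tangentLift φ (x, y)) (J' a) := by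
        rw [derivX_apply, derivY_apply, ← map_add, Prod.mk_add_mk, add_zero, zero_add, hJ',
          fderiv_fderiv_symm hU hφ hz.1 a y]
      have h4 : fderiv ℝ (fderiv ℝ (fderiv ℝ φ)) x a y y =
          fderiv ℝ (fderiv ℝ (fderiv ℝ φ)) x y y a := by
        have s1 : fderiv ℝ (fderiv ℝ (fderiv ℝ φ)) x a y =
            fderiv ℝ (fderiv ℝ (fderiv ℝ φ)) x y a :=
          ((hφ1.contDiffAt (hU.mem_nhds hz.1)).isSymmSndFDerivAt
            (by simpa using ENat.LEInfty.out)) a y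
        have s2 : ∀ a b c, fderiv ℝ (fderiv ℝ (fderiv ℝ φ)) x a b c =
            fderiv ℝ (fderiv ℝ (fderiv ℝ φ)) x a c b := by
          intro a b c
          have hd : HasFDerivAt (fderiv ℝ (fderiv ℝ φ)) (fderiv ℝ (fderiv ℝ (fderiv ℝ φ)) x) x :=
            ((hφ2.contDiffAt (hU.mem_nhds hz.1)).differentiableAt (by simp)).hasFDerivAt
          have t1 := (hd.clm_apply (hasFDerivAt_const b x)).clm_apply (hasFDerivAt_const c x)
          have t2 := (hd.clm_apply (hasFDerivAt_const c x)).clm_apply (hasFDerivAt_const b x)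
          have t3 : (fun x => fderiv ℝ (fderiv ℝ φ) x b c) =ᶠ[𝓝 x]
              fun x => fderiv ℝ (fderiv ℝ φ) x c b := by
            filter_upwards [hU.mem_nhds hz.1] with x' hx' using fderiv_fderiv_symm hU hφ hx' b c
          have t4 := (t1.congr_of_eventuallyEq t3.symm).unique t2
          have t5 := congrArg (fun ℓ : V →L[ℝ] V => ℓ a) t4
          simpa using t5
        rw [s1, s2]
      rw [h3, h4] at h2
      have h5 := eq_sub_of_add_eq h2
      simp only [mul_apply_eq_comp, sub_apply, h5, hA,
        derivX_apply]
      rw [fderiv_fderiv_symm hU hφ hz.1 a]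
      abel
    rw [← h1, mul_assoc, JK, mul_one]
  have hBz := hB _ hz
  simp only [← hJ, ← hJ', ← hBdef] at hBz
  have t1 : tr (derivX G' (tangentLift φ (x, y))) =
      tr (derivX G (x, y)) - tr (A * K x) - tr (B * K x * J') +
        2 * tr (J' * K x * (J' * K x)) := by
    rw [hX, hBz]
    have : (J * derivX G (x, y) - A - (J * B - 2 • J') * K x * J') * K x =
        J * (derivX G (x, y) * K x) - A * K x - J * (B * K x * J' * K x) +
          2 • (J' * K x * (J' * K x)) := by noncomm_ring
    rw [this, map_add, map_sub, map_sub, tr_mul_comm J, tr_mul_comm J, map_nsmul]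
    simp only [mul_assoc, KJ, mul_one, nsmul_eq_mul, Nat.cast_ofNat]
  have t2 : tr (derivY G' (tangentLift φ (x, y)) * derivY G' (tangentLift φ (x, y))) =
      tr (B * B) - 4 * tr (B * K x * J') + 4 * tr (J' * K x * (J' * K x)) := by
    rw [hBz]
    have : (J * B - 2 • J') * K x * ((J * B - 2 • J') * K x) =
        J * (B * (K x * J) * B * K x) - 2 • (J * (B * K x * J' * K x)) -
          2 • (J' * (K x * J) * (B * K x)) + 4 • (J' * K x * (J' * K x)) := by noncomm_ring
    rw [this, KJ, map_add, map_sub, map_sub, tr_mul_comm J]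
    simp only [map_nsmul, mul_one]
    rw [tr_mul_comm J, tr_mul_comm J']
    simp only [mul_assoc, KJ, mul_one, nsmul_eq_mul, Nat.cast_ofNat]
    ring
  -- With the weights 1, -1/4 and -1/2 the correction terms cancel: tr(AK) between the horizontal
  -- and the spray derivative, tr(BKJ') between the first two traces, and tr((J'K)²) with total
  -- coefficient 2 - 1 - 1 = 0.
  rw [traceCurv, traceCurv, t1, t2, hS]
  ring

end ChangeOfCoordinates

end

section

variable {n : ℕ}

/-! ### Coordinate Finsler structures and their sprays -/

/-- A Finsler structure on a coordinate domain. -/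
structure IsCoordFinsler (U : Set (E n)) (L : E n → E n → ℝ) : Prop where
  isOpen : IsOpen U
  smooth : SmoothOn U L
  homog : Homog U 1 L
  convex : ∀ x ∈ U, ∀ y : E n, y ≠ 0 → ∀ w : E n, w ≠ 0 →
    0 < ∑ i, ∑ j, metric L i j x y * w i * w j

/-- The spray coefficients as a vector. -/
def sprayVec (L : E n → E n → ℝ) (z : E n × E n) : E n :=
  WithLp.toLp 2 fun i => spray L i z.1 z.2

@[simp] theorem sprayVec_apply (L : E n → E n → ℝ) (z : E n × E n) (i : Fin n) :
    sprayVec L z i = spray L i z.1 z.2 := rfl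

/-- The energy `F²` on pairs. -/
def energy (L : E n → E n → ℝ) : E n × E n → ℝ := Function.uncurry (sqr L)

namespace IsCoordFinsler

variable {U : Set (E n)} {L : E n → E n → ℝ} {z : E n × E n}

theorem smooth_sqr (h : IsCoordFinsler U L) : SmoothOn U (sqr L) := by
  have := h.smooth.mul h.smooth
  simpa [sqr, ← pow_two] using! this

theorem homog_sqr (h : IsCoordFinsler U L) : Homog U 2 (sqr L) := by
  have := h.homog.mul h.homog
  simpa [sqr, ← pow_two] using! this

theorem smooth_metric (h : IsCoordFinsler U L) (i j : Fin n) : SmoothOn U (metric L i j) :=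
  (smoothOn_const _).mul ((h.smooth_sqr.dy h.isOpen i).dy h.isOpen j)

theorem homog_metric (h : IsCoordFinsler U L) (i j : Fin n) : Homog U 0 (metric L i j) := by
  exact (homog_const (1 / 2)).mul
    ((h.homog_sqr.dy h.isOpen i h.smooth_sqr).dy h.isOpen j (h.smooth_sqr.dy h.isOpen i))

theorem metric_eq (h : IsCoordFinsler U L) (hz : z ∈ slit U) (i j : Fin n) :
    metric L i j z.1 z.2 = (1 / 2) * fderiv ℝ (fderiv ℝ (energy L)) z
      (0, EuclideanSpace.single j 1) (0, EuclideanSpace.single i 1) := by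
  rw [metric, (h.smooth_sqr.dy h.isOpen i).dy_eq h.isOpen hz,
    h.smooth_sqr.fderiv_dy h.isOpen hz, energy]

theorem sum_metric (h : IsCoordFinsler U L) (hz : z ∈ slit U) (i : Fin n) (b : E n) :
    ∑ j, metric L i j z.1 z.2 * b j = (1 / 2) * fderiv ℝ (fderiv ℝ (energy L)) z
      (0, b) (0, EuclideanSpace.single i 1) := by
  rw [map_inr_eq_sum (fderiv ℝ (fderiv ℝ (energy L)) z) b]
  simp only [h.metric_eq hz, sum_apply, smul_apply, smul_eq_mul, Finset.mul_sum]
  exact Finset.sum_congr rfl fun j _ => by ring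

theorem sum_sum_metric (h : IsCoordFinsler U L) (hz : z ∈ slit U) (a b : E n) :
    ∑ i, ∑ j, metric L i j z.1 z.2 * a i * b j =
      (1 / 2) * fderiv ℝ (fderiv ℝ (energy L)) z (0, b) (0, a) := by
  rw [map_inr_eq_sum _ a, Finset.mul_sum]
  refine Finset.sum_congr rfl fun i _ => ?_
  rw [smul_eq_mul, mul_left_comm, ← h.sum_metric hz, Finset.mul_sum]
  exact Finset.sum_congr rfl fun j _ => by ring

theorem fderiv_fderiv_pos (h : IsCoordFinsler U L) (hz : z ∈ slit U) {w : E n} (hw : w ≠ 0) :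
    0 < fderiv ℝ (fderiv ℝ (energy L)) z (0, w) (0, w) := by
  have := h.convex _ hz.1 _ hz.2 w hw
  rw [h.sum_sum_metric hz] at this
  linarith

theorem det_ne_zero (h : IsCoordFinsler U L) {x y : E n} (hx : x ∈ U) (hy : y ≠ 0) :
    (Matrix.of fun i j => metric L i j x y).det ≠ 0 := by
  intro h0
  obtain ⟨v, hv, hv0⟩ := Matrix.exists_mulVec_eq_zero_iff.mpr h0
  have h1 := h.convex x hx y hy (WithLp.toLp 2 v) (by simpa using hv)
  have h2 : ∀ i, ∑ j, metric L i j x y * v j = 0 := fun i => by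
    simpa [Matrix.mulVec, dotProduct] using congrFun hv0 i
  have h3 : ∑ i, ∑ j, metric L i j x y * v i * v j = ∑ i, v i * ∑ j, metric L i j x y * v j := by
    refine Finset.sum_congr rfl fun i _ => ?_
    rw [Finset.mul_sum]
    exact Finset.sum_congr rfl fun j _ => by ring
  simp [h2] at h3
  simp [h3] at h1

theorem smooth_metricInv (h : IsCoordFinsler U L) (i j : Fin n) : SmoothOn U (metricInv L i j) :=
  SmoothOn.matrix_inv h.smooth_metric (fun _ hx _ hy => h.det_ne_zero hx hy) i j

theorem homog_metricInv (h : IsCoordFinsler U L) (i j : Fin n) :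
    Homog U 0 (metricInv L i j) := by
  intro x hx y hy c hc
  have : (Matrix.of fun k l => metric L k l x (c • y)) =
      Matrix.of fun k l => metric L k l x y := by
    ext k l
    simpa using h.homog_metric k l x hx y hy c hc
  simp [metricInv, this]

theorem smooth_spray (h : IsCoordFinsler U L) (i : Fin n) : SmoothOn U (spray L i) := by
  refine (smoothOn_const _).mul (SmoothOn.sum fun l _ => (h.smooth_metricInv i l).mul ?_)
  refine (SmoothOn.sum fun k _ => ?_).sub (h.smooth_sqr.dx h.isOpen l)
  exact ((h.smooth_sqr.dy h.isOpen l).dx h.isOpen k).mul (smoothOn_snd_apply k)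

theorem homog_spray (h : IsCoordFinsler U L) (i : Fin n) : Homog U 2 (spray L i) := by
  have := (homog_const (U := U) (1 / 2)).mul (Homog.sum (s := Finset.univ) fun l _ =>
    (h.homog_metricInv i l).mul ((Homog.sum (s := Finset.univ) fun k _ =>
      (((h.homog_sqr.dy h.isOpen l h.smooth_sqr).dx h.isOpen k
        (h.smooth_sqr.dy h.isOpen l))).mul (homog_snd_apply k)).sub
      (h.homog_sqr.dx h.isOpen l h.smooth_sqr)))
  exact this

theorem contDiffOn_sprayVec (h : IsCoordFinsler U L) : ContDiffOn ℝ ∞ (sprayVec L) (slit U) := by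
  rw [contDiffOn_euclidean]
  exact fun i => h.smooth_spray i

theorem sprayVec_smul (h : IsCoordFinsler U L) (hz : z ∈ slit U) {c : ℝ} (hc : 0 < c) :
    sprayVec L (z.1, c • z.2) = c ^ 2 • sprayVec L z := by
  ext i
  simpa using h.homog_spray i _ hz.1 _ hz.2 c hc

/-- The Euler-Lagrange form of the definition of the spray. -/
theorem euler_lagrange (h : IsCoordFinsler U L) (hz : z ∈ slit U) (w : E n) :
    fderiv ℝ (fderiv ℝ (energy L)) z (z.2, -sprayVec L z) (0, w) =
      fderiv ℝ (energy L) z (w, 0) := by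
  have key : ∀ i, fderiv ℝ (fderiv ℝ (energy L)) z (0, sprayVec L z)
      (0, EuclideanSpace.single i 1) = fderiv ℝ (fderiv ℝ (energy L)) z (z.2, 0)
        (0, EuclideanSpace.single i 1) -
        fderiv ℝ (energy L) z (EuclideanSpace.single i 1, 0) := by
    intro i
    set A := Matrix.of fun k l => metric L k l z.1 z.2
    set r : Fin n → ℝ := fun l => (∑ k, dx k (dy l (sqr L)) z.1 z.2 * z.2 k) -
      dx l (sqr L) z.1 z.2
    have hr : r i = fderiv ℝ (fderiv ℝ (energy L)) z (z.2, 0)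
        (0, EuclideanSpace.single i 1) -
        fderiv ℝ (energy L) z (EuclideanSpace.single i 1, 0) := by
      simp only [r]
      rw [h.smooth_sqr.dx_eq h.isOpen hz, energy,
        ← (h.smooth_sqr.fderiv_dy h.isOpen hz i (z.2, 0)),
        ← (h.smooth_sqr.dy h.isOpen i).sum_dx h.isOpen hz]
      simp only [mul_comm]
    have hA : IsUnit A.det := (h.det_ne_zero hz.1 hz.2).isUnit
    have hG : (fun i => spray L i z.1 z.2) = (1 / 2 : ℝ) • A⁻¹.mulVec r := by
      ext j
      simp [spray, metricInv, Matrix.mulVec, dotProduct, A, r]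
    -- Multiplying by g_{ij} removes the inverse matrix from the definition of the spray.
    have h1 : A.mulVec (fun i => spray L i z.1 z.2) = (1 / 2 : ℝ) • r := by
      rw [hG, Matrix.mulVec_smul, Matrix.mulVec_mulVec, Matrix.mul_nonsing_inv _ hA,
        Matrix.one_mulVec]
    have h2 := congrFun h1 i
    have h3 := h.sum_metric hz i (sprayVec L z)
    simp only [Matrix.mulVec, dotProduct, A, Matrix.of_apply, Pi.smul_apply, smul_eq_mul] at h2
    simp only [sprayVec_apply] at h3
    rw [h2, hr] at h3
    linarith
  have e1 : (z.2, -sprayVec L z) = (z.2, (0 : E n)) - (0, sprayVec L z) := by simp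
  rw [e1, map_sub, sub_apply, map_inr_eq_sum (fderiv ℝ (fderiv ℝ (energy L)) z (0, _)) w,
    map_inr_eq_sum (fderiv ℝ (fderiv ℝ (energy L)) z (z.2, _)) w,
    map_inl_eq_sum (fderiv ℝ (energy L) z) w, ← Finset.sum_sub_distrib]
  refine Finset.sum_congr rfl fun i _ => ?_
  rw [key i, ← smul_sub]
  congr 1
  ring

/-- The vertical Hessian of F² is positive definite, and it would vanish on the difference of two
solutions of the Euler-Lagrange equation. -/
theorem eq_sprayVec (h : IsCoordFinsler U L) (hz : z ∈ slit U) {a : E n}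
    (ha : ∀ w, fderiv ℝ (fderiv ℝ (energy L)) z (z.2, -a) (0, w) =
      fderiv ℝ (energy L) z (w, 0)) : a = sprayVec L z := by
  by_contra hne
  have h1 := h.fderiv_fderiv_pos hz (sub_ne_zero.mpr hne)
  have h2 : ((0 : E n), a - sprayVec L z) = (z.2, -sprayVec L z) - (z.2, -a) := by
    simp; abel
  have h3 := ha (a - sprayVec L z)
  have h4 := h.euler_lagrange hz (a - sprayVec L z)
  rw [show fderiv ℝ (fderiv ℝ (energy L)) z (0, a - sprayVec L z) =
    fderiv ℝ (fderiv ℝ (energy L)) z (z.2, -sprayVec L z) -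
    fderiv ℝ (fderiv ℝ (energy L)) z (z.2, -a) by rw [← map_sub, ← h2], sub_apply, h3, h4] at h1
  simp at h1

theorem hasFDerivAt_fderiv_energy (h : IsCoordFinsler U L) (hz : z ∈ slit U) :
    HasFDerivAt (fderiv ℝ (energy L)) (fderiv ℝ (fderiv ℝ (energy L)) z) z :=
  ((((h.smooth_sqr.fderiv_smooth h.isOpen).contDiffAt
    ((isOpen_slit h.isOpen).mem_nhds hz))).differentiableAt (by simp)).hasFDerivAt

/-- The energy is constant along the geodesic flow. -/
theorem fderiv_energy_spray (h : IsCoordFinsler U L) (hz : z ∈ slit U) :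
    fderiv ℝ (energy L) z (z.2, -sprayVec L z) = 0 := by
  have h1 := (h.hasFDerivAt_fderiv_energy hz).clm_apply
    ((hasFDerivAt_const (0 : E n) z).prodMk (hasFDerivAt_snd (p := z)))
  have h2 := (h.smooth_sqr.hasFDerivAt h.isOpen hz).const_mul 2
  -- Euler's identity for F² is differentiated along (y, -G). Combined with the Euler-Lagrange
  -- equation tested on w = y, it reads D = 2D for the derivative D of F² along the flow.
  have h3 : (fun z : E n × E n => fderiv ℝ (energy L) z (0, z.2)) =ᶠ[𝓝 z]
      fun z => 2 * Function.uncurry (sqr L) z := by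
    filter_upwards [(isOpen_slit h.isOpen).mem_nhds hz] with z' hz'
    simpa using! h.homog_sqr.euler h.isOpen h.smooth_sqr hz'
  have h4 := (h1.congr_of_eventuallyEq h3.symm).unique h2
  have h5 := congrArg (fun ℓ : E n × E n →L[ℝ] ℝ => ℓ (z.2, -sprayVec L z)) h4
  have h6 : fderiv ℝ (energy L) z (0, -sprayVec L z) +
      fderiv ℝ (fderiv ℝ (energy L)) z (z.2, -sprayVec L z) (0, z.2) =
      2 * fderiv ℝ (energy L) z (z.2, -sprayVec L z) := by simpa using! h5
  have h7 : fderiv ℝ (energy L) z (z.2, -sprayVec L z) =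
      fderiv ℝ (energy L) z (z.2, 0) + fderiv ℝ (energy L) z (0, -sprayVec L z) := by
    rw [← map_add]; simp
  rw [h.euler_lagrange hz] at h6
  linarith

/-- The law of transformation of the spray coefficients. -/
theorem sprayVec_tangentLift {U' : Set (E n)} {L' : E n → E n → ℝ} (h : IsCoordFinsler U L)
    (h' : IsCoordFinsler U' L') {φ : E n → E n} (hφ : ContDiffOn ℝ ∞ φ U)
    (hmaps : MapsTo (tangentLift φ) (slit U) (slit U'))
    (hsurj : ∀ x ∈ U, Function.Surjective (fderiv ℝ φ x))
    (hL : ∀ z ∈ slit U, energy L z = energy L' (tangentLift φ z)) (hz : z ∈ slit U) :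
    sprayVec L' (tangentLift φ z) =
      fderiv ℝ φ z.1 (sprayVec L z) - fderiv ℝ (fderiv ℝ φ) z.1 z.2 z.2 := by
  symm
  -- By uniqueness it suffices that the transformed coefficients solve the Euler-Lagrange equation
  -- of the second structure; surjectivity of the Jacobian lets the test vector be pulled back.
  refine h'.eq_sprayVec (hmaps hz) fun w' => ?_
  obtain ⟨w, rfl⟩ := hsurj _ hz.1 w'
  have hD : ∀ z ∈ slit U, ∀ a b, fderiv ℝ (energy L) z (a, b) =
      fderiv ℝ (energy L') (tangentLift φ z)
        (fderiv ℝ φ z.1 a, fderiv ℝ φ z.1 b + fderiv ℝ (fderiv ℝ φ) z.1 a z.2) := by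
    intro z hz a b
    have h1 := (h'.smooth_sqr.hasFDerivAt h'.isOpen (hmaps hz)).comp z
      (hasFDerivAt_tangentLift h.isOpen hφ hz.1)
    have h2 : energy L =ᶠ[𝓝 z] energy L' ∘ tangentLift φ := by
      filter_upwards [(isOpen_slit h.isOpen).mem_nhds hz] with z' hz' using hL z' hz'
    rw [(h1.congr_of_eventuallyEq h2).fderiv]
    simp [energy]
  have d1 := (h'.hasFDerivAt_fderiv_energy (hmaps hz)).comp z
      (hasFDerivAt_tangentLift h.isOpen hφ hz.1)
  have d2 : HasFDerivAt (fun z : E n × E n => fderiv ℝ φ z.1)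
      ((fderiv ℝ (fderiv ℝ φ) z.1).comp (ContinuousLinearMap.fst ℝ (E n) (E n))) z :=
    (hasFDerivAt_fderiv h.isOpen hφ hz.1).comp z (hasFDerivAt_fst (p := z))
  have d3 := d1.clm_apply ((hasFDerivAt_const (0 : E n) z).prodMk
    (d2.clm_apply (hasFDerivAt_const w z)))
  have d4 := (h.hasFDerivAt_fderiv_energy hz).clm_apply (hasFDerivAt_const ((0 : E n), w) z)
  have d5 : (fun z => fderiv ℝ (energy L) z (0, w)) =ᶠ[𝓝 z]
      fun z => fderiv ℝ (energy L') (tangentLift φ z) (0, fderiv ℝ φ z.1 w) := by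
    filter_upwards [(isOpen_slit h.isOpen).mem_nhds hz] with z' hz'
    simp [hD z' hz' 0 w]
  have d6 := (d4.congr_of_eventuallyEq d5.symm).unique d3
  have d7 := congrArg (fun ℓ : E n × E n →L[ℝ] ℝ => ℓ (z.2, -sprayVec L z)) d6
  have d8 : fderiv ℝ (fderiv ℝ (energy L)) z (z.2, -sprayVec L z) (0, w) =
      fderiv ℝ (energy L') (tangentLift φ z) (0, fderiv ℝ (fderiv ℝ φ) z.1 z.2 w) +
      fderiv ℝ (fderiv ℝ (energy L')) (tangentLift φ z)
        (fderiv ℝ φ z.1 z.2, fderiv ℝ φ z.1 (-sprayVec L z) + fderiv ℝ (fderiv ℝ φ) z.1 z.2 z.2)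
        (0, fderiv ℝ φ z.1 w) := by simpa using! d7
  rw [h.euler_lagrange hz, hD z hz w 0, map_zero, zero_add,
    fderiv_fderiv_symm h.isOpen hφ hz.1 w] at d8
  have e1 : (fderiv ℝ φ z.1 w, fderiv ℝ (fderiv ℝ φ) z.1 z.2 w) =
      (fderiv ℝ φ z.1 w, 0) + (0, fderiv ℝ (fderiv ℝ φ) z.1 z.2 w) := by simp
  rw [e1, map_add, add_comm, add_left_cancel_iff] at d8
  rw [d8, map_neg, neg_sub, neg_add_eq_sub]
  rfl

end IsCoordFinsler

end

section

variable {n : ℕ}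

/-! ### The Ricci curvature in coordinates -/

namespace IsCoordFinsler

variable {U : Set (E n)} {L : E n → E n → ℝ} {z : E n × E n}

theorem fderiv_sprayVec_apply (h : IsCoordFinsler U L) (hz : z ∈ slit U) (ζ : E n × E n)
    (i : Fin n) : fderiv ℝ (sprayVec L) z ζ i = fderiv ℝ (Function.uncurry (spray L i)) z ζ := by
  have h1 : HasFDerivAt (sprayVec L) (fderiv ℝ (sprayVec L) z) z :=
    ((h.contDiffOn_sprayVec.contDiffAt ((isOpen_slit h.isOpen).mem_nhds hz)).differentiableAt
      (by simp)).hasFDerivAt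
  have h2 := (EuclideanSpace.proj (𝕜 := ℝ) i).hasFDerivAt.comp z h1
  have h3 : HasFDerivAt (Function.uncurry (spray L i))
    ((EuclideanSpace.proj (𝕜 := ℝ) i).comp (fderiv ℝ (sprayVec L) z)) z := h2
  rw [h3.fderiv]
  rfl

theorem derivY_sprayVec (h : IsCoordFinsler U L) (hz : z ∈ slit U) (i j : Fin n) :
    derivY (sprayVec L) z (EuclideanSpace.single j 1) i = dy j (spray L i) z.1 z.2 := by
  rw [derivY_apply, h.fderiv_sprayVec_apply hz, (h.smooth_spray i).dy_eq h.isOpen hz]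

theorem smooth_dy_spray (h : IsCoordFinsler U L) (i j : Fin n) : SmoothOn U (dy j (spray L i)) :=
  (h.smooth_spray i).dy h.isOpen j

/-- The Ricci scalar is the trace of the curvature of the spray. -/
theorem ricScalar_eq_traceCurv (h : IsCoordFinsler U L) (hz : z ∈ slit U) :
    ricScalar L z.1 z.2 = traceCurv (sprayVec L) z := by
  have t1 : tr (derivX (sprayVec L) z) = ∑ i, dx i (spray L i) z.1 z.2 := by
    rw [tr_apply]
    refine Finset.sum_congr rfl fun i _ => ?_
    rw [derivX_apply, h.fderiv_sprayVec_apply hz, (h.smooth_spray i).dx_eq h.isOpen hz]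
  have t2 : tr (derivY (sprayVec L) z * derivY (sprayVec L) z) =
      ∑ i, ∑ j, dy j (spray L i) z.1 z.2 * dy i (spray L j) z.1 z.2 := by
    rw [tr_apply]
    refine Finset.sum_congr rfl fun i _ => ?_
    rw [mul_apply_eq_comp,
      map_eq_sum (derivY (sprayVec L) z) (derivY (sprayVec L) z _)]
    simp only [WithLp.ofLp_sum, WithLp.ofLp_smul, Finset.sum_apply, Pi.smul_apply, smul_eq_mul,
      h.derivY_sprayVec hz]
    exact Finset.sum_congr rfl fun j _ => mul_comm _ _
  have t3 : fderiv ℝ (fun z => tr (derivY (sprayVec L) z)) z (z.2, -sprayVec L z) =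
      (∑ i, ∑ j, z.2 j * dx j (dy i (spray L i)) z.1 z.2) -
        ∑ i, ∑ j, spray L j z.1 z.2 * dy j (dy i (spray L i)) z.1 z.2 := by
    have e1 : (fun z => tr (derivY (sprayVec L) z)) =ᶠ[𝓝 z]
        ∑ i, Function.uncurry (dy i (spray L i)) := by
      filter_upwards [(isOpen_slit h.isOpen).mem_nhds hz] with z' hz'
      rw [tr_apply, Finset.sum_apply]
      exact Finset.sum_congr rfl fun i _ => h.derivY_sprayVec hz' i i
    have e2 := HasFDerivAt.sum (u := Finset.univ) fun i _ =>
      (h.smooth_dy_spray i i).hasFDerivAt h.isOpen hz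
    rw [e1.fderiv_eq, e2.fderiv, sum_apply, ← Finset.sum_sub_distrib]
    refine Finset.sum_congr rfl fun i _ => ?_
    have e3 := (h.smooth_dy_spray i i).sum_dy h.isOpen hz (sprayVec L z)
    simp only [sprayVec_apply] at e3
    rw [(h.smooth_dy_spray i i).sum_dx h.isOpen hz, e3, ← map_sub]
    simp
  rw [ricScalar, traceCurv, t1, t2, t3]
  ring

theorem smooth_ricScalar (h : IsCoordFinsler U L) : SmoothOn U (ricScalar L) := by
  have hG := h.smooth_spray
  have hd := h.smooth_dy_spray
  refine (((SmoothOn.sum fun i _ => (hG i).dx h.isOpen i).sub ((smoothOn_const _).mul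
    (SmoothOn.sum fun i _ => SmoothOn.sum fun j _ => (hd i j).mul (hd j i)))).sub
    ((smoothOn_const _).mul (SmoothOn.sum fun i _ => SmoothOn.sum fun j _ =>
      (smoothOn_snd_apply j).mul ((hd i i).dx h.isOpen j)))).add
    ((smoothOn_const _).mul (SmoothOn.sum fun i _ => SmoothOn.sum fun j _ =>
      (hG j).mul ((hd i i).dy h.isOpen j)))

theorem homog_ricScalar (h : IsCoordFinsler U L) : Homog U 2 (ricScalar L) := by
  have hG := h.homog_spray
  have sG := h.smooth_spray
  have sd := h.smooth_dy_spray
  have hd : ∀ i j, Homog U 1 (dy j (spray L i)) := fun i j => (hG i).dy h.isOpen j (sG i)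
  have p1 : Homog U 2 (fun x y => (1 / 4) * ∑ i, ∑ j, dy j (spray L i) x y *
      dy i (spray L j) x y) := (homog_const (1 / 4)).mul (e := 2)
    (Homog.sum fun i _ => Homog.sum fun j _ => (hd i j).mul (hd j i))
  have p2 : Homog U 2 (fun x y => (1 / 2) * ∑ i, ∑ j, y j * dx j (dy i (spray L i)) x y) :=
    (homog_const (1 / 2)).mul (e := 2) (Homog.sum fun i _ => Homog.sum fun j _ =>
      (homog_snd_apply j).mul ((hd i i).dx h.isOpen j (sd i i)))
  have p3 : Homog U 2 (fun x y => (1 / 2) * ∑ i, ∑ j, spray L j x y *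
      dy j (dy i (spray L i)) x y) :=
    (homog_const (1 / 2)).mul (e := 2) (Homog.sum fun i _ => Homog.sum fun j _ =>
      (hG j).mul (e := 0) ((hd i i).dy h.isOpen j (sd i i)))
  exact (((Homog.sum fun i _ => (hG i).dx h.isOpen i (sG i)).sub p1).sub p2).add p3

theorem smooth_ricci (h : IsCoordFinsler U L) (i j : Fin n) : SmoothOn U (ricci L i j) :=
  (smoothOn_const _).mul ((h.smooth_ricScalar.dy h.isOpen i).dy h.isOpen j)

theorem ricci_symm (h : IsCoordFinsler U L) (hz : z ∈ slit U) (i j : Fin n) :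
    ricci L i j z.1 z.2 = ricci L j i z.1 z.2 := by
  rw [ricci, ricci, (h.smooth_ricScalar.dy h.isOpen i).dy_eq h.isOpen hz,
    (h.smooth_ricScalar.dy h.isOpen j).dy_eq h.isOpen hz,
    h.smooth_ricScalar.fderiv_dy h.isOpen hz, h.smooth_ricScalar.fderiv_dy h.isOpen hz,
    h.smooth_ricScalar.fderiv_fderiv_symm h.isOpen hz]

/-- Euler's identity twice: F²Ric has degree 2 and its vertical derivatives have degree 1. -/
theorem sum_sum_ricci (h : IsCoordFinsler U L) (hz : z ∈ slit U) :
    ∑ i, ∑ j, ricci L i j z.1 z.2 * z.2 i * z.2 j = ricScalar L z.1 z.2 := by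
  have h1 : ∀ i, ∑ j, ricci L i j z.1 z.2 * z.2 i * z.2 j =
      (1 / 2) * (z.2 i * dy i (ricScalar L) z.1 z.2) := by
    intro i
    have e1 := (h.homog_ricScalar.dy h.isOpen i h.smooth_ricScalar).euler h.isOpen
      (h.smooth_ricScalar.dy h.isOpen i) hz
    rw [← (h.smooth_ricScalar.dy h.isOpen i).sum_dy h.isOpen hz] at e1
    simp only [Nat.cast_one, one_mul] at e1
    rw [← e1, Finset.mul_sum, Finset.mul_sum]
    refine Finset.sum_congr rfl fun j _ => ?_
    rw [ricci]
    ring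
  have e2 := h.homog_ricScalar.euler h.isOpen h.smooth_ricScalar hz
  rw [← h.smooth_ricScalar.sum_dy h.isOpen hz] at e2
  rw [Finset.sum_congr rfl fun i _ => h1 i, ← Finset.mul_sum, e2]
  push_cast
  ring

theorem smooth_nonlin (h : IsCoordFinsler U L) (i j : Fin n) : SmoothOn U (nonlin L i j) :=
  (smoothOn_const _).mul (h.smooth_dy_spray i j)

theorem homog_nonlin (h : IsCoordFinsler U L) (i j : Fin n) : Homog U 1 (nonlin L i j) := by
  have := (homog_const (U := U) (1 / 2)).mul (e := 1)
    ((h.homog_spray i).dy h.isOpen j (h.smooth_spray i))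
  rw [zero_add] at this
  exact this

theorem sum_nonlin (h : IsCoordFinsler U L) (hz : z ∈ slit U) (i : Fin n) :
    ∑ j, z.2 j * nonlin L i j z.1 z.2 = spray L i z.1 z.2 := by
  have e1 := (h.homog_spray i).euler h.isOpen (h.smooth_spray i) hz
  rw [← (h.smooth_spray i).sum_dy h.isOpen hz] at e1
  simp only [nonlin, mul_left_comm _ (1 / 2 : ℝ), ← Finset.mul_sum, e1]
  push_cast
  ring

theorem delta_eq (h : IsCoordFinsler U L) {u : E n → E n → ℝ} (hu : SmoothOn U u)
    (hz : z ∈ slit U) (k : Fin n) :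
    delta L k u z.1 z.2 = fderiv ℝ (Function.uncurry u) z
      (EuclideanSpace.single k 1, -WithLp.toLp 2 fun l => nonlin L l k z.1 z.2) := by
  rw [delta, hu.dx_eq h.isOpen hz]
  have := hu.sum_dy h.isOpen hz (WithLp.toLp 2 fun l => nonlin L l k z.1 z.2)
  simp only at this
  rw [this, ← map_sub]
  simp

/-- Since y^k G^l_k = G^l, the contraction of δ/δx^k with y^k is the geodesic spray. -/
theorem sum_delta (h : IsCoordFinsler U L) {u : E n → E n → ℝ} (hu : SmoothOn U u)
    (hz : z ∈ slit U) :
    ∑ k, z.2 k * delta L k u z.1 z.2 =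
      fderiv ℝ (Function.uncurry u) z (z.2, -sprayVec L z) := by
  have e1 : ∑ k, z.2 k * ∑ l, nonlin L l k z.1 z.2 * dy l u z.1 z.2 =
      ∑ l, spray L l z.1 z.2 * dy l u z.1 z.2 := by
    simp only [← h.sum_nonlin hz, Finset.mul_sum, Finset.sum_mul]
    rw [Finset.sum_comm]
    exact Finset.sum_congr rfl fun l _ => Finset.sum_congr rfl fun k _ => by ring
  have e2 := hu.sum_dy h.isOpen hz (sprayVec L z)
  simp only [sprayVec_apply] at e2
  simp only [delta, mul_sub, Finset.sum_sub_distrib, e1, e2, hu.sum_dx h.isOpen hz]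
  rw [← map_sub]
  simp

/-- Euler's identity, once for G^i_j of degree 1 and once for G^i of degree 2. -/
theorem berwald_contract (h : IsCoordFinsler U L) (hz : z ∈ slit U) (r : Fin n) :
    ∑ j, ∑ k, berwald L r j k z.1 z.2 * z.2 j * z.2 k = spray L r z.1 z.2 := by
  rw [← h.sum_nonlin hz]
  refine Finset.sum_congr rfl fun j _ => ?_
  have e1 := (h.homog_nonlin r j).euler h.isOpen (h.smooth_nonlin r j) hz
  rw [← (h.smooth_nonlin r j).sum_dy h.isOpen hz] at e1
  simp only [Nat.cast_one, one_mul] at e1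
  rw [← e1, Finset.mul_sum]
  exact Finset.sum_congr rfl fun k _ => by rw [berwald]; ring

theorem berwald_symm (h : IsCoordFinsler U L) (hz : z ∈ slit U) (r j k : Fin n) :
    berwald L r j k z.1 z.2 = berwald L r k j z.1 z.2 := by
  have e : ∀ j k, berwald L r j k z.1 z.2 = (1 / 2) * dy k (dy j (spray L r)) z.1 z.2 := by
    intro j k
    have : DifferentiableAt ℝ (fun y' => dy j (spray L r) z.1 y') z.2 :=
      ((h.smooth_dy_spray r j).hasFDerivAt_right h.isOpen hz).differentiableAt
    have h1 : (fun y' => nonlin L r j z.1 y') = fun y' => (1 / 2) * dy j (spray L r) z.1 y' := rfl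
    rw [berwald, dy, h1, fderiv_const_mul this]
    rfl
  rw [e, e, (h.smooth_dy_spray r j).dy_eq h.isOpen hz, (h.smooth_dy_spray r k).dy_eq h.isOpen hz,
    (h.smooth_spray r).fderiv_dy h.isOpen hz, (h.smooth_spray r).fderiv_dy h.isOpen hz,
    (h.smooth_spray r).fderiv_fderiv_symm h.isOpen hz]

theorem metric_symm (h : IsCoordFinsler U L) (hz : z ∈ slit U) (i j : Fin n) :
    metric L i j z.1 z.2 = metric L j i z.1 z.2 := by
  rw [h.metric_eq hz, h.metric_eq hz, energy, h.smooth_sqr.fderiv_fderiv_symm h.isOpen hz]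

theorem fderiv_metric_symm (h : IsCoordFinsler U L) (hz : z ∈ slit U) (i j : Fin n) :
    fderiv ℝ (Function.uncurry (metric L i j)) z = fderiv ℝ (Function.uncurry (metric L j i)) z := by
  refine Filter.EventuallyEq.fderiv_eq ?_
  filter_upwards [(isOpen_slit h.isOpen).mem_nhds hz] with z' hz' using h.metric_symm hz' i j

/-- Differentiate g_ij y^j = (1/2) (F²)_{y^i}. The vertical direction b contributes g_ij b^j on both
sides and drops out, so the right-hand side involves a only. -/
theorem sum_fderiv_metric (h : IsCoordFinsler U L) (hz : z ∈ slit U) (i : Fin n) (a b : E n) :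
    ∑ j, z.2 j * fderiv ℝ (Function.uncurry (metric L i j)) z (a, b) =
      (1 / 2) * fderiv ℝ (fderiv ℝ (energy L)) z (a, 0) (0, EuclideanSpace.single i 1) := by
  have d1 : HasFDerivAt (fun z : E n × E n => ∑ j, metric L i j z.1 z.2 * z.2 j) _ z :=
    HasFDerivAt.fun_sum (u := Finset.univ) fun j _ =>
      ((h.smooth_metric i j).hasFDerivAt h.isOpen hz).mul
        ((EuclideanSpace.proj (𝕜 := ℝ) j).hasFDerivAt.comp z (hasFDerivAt_snd (p := z)))
  have d2 := ((h.smooth_sqr.dy h.isOpen i).hasFDerivAt h.isOpen hz).const_mul (1 / 2)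
  have e1 : (fun z : E n × E n => ∑ j, metric L i j z.1 z.2 * z.2 j) =ᶠ[𝓝 z]
      fun z => (1 / 2) * Function.uncurry (dy i (sqr L)) z := by
    filter_upwards [(isOpen_slit h.isOpen).mem_nhds hz] with z' hz'
    have e2 := (h.homog_sqr.dy h.isOpen i h.smooth_sqr).euler h.isOpen
      (h.smooth_sqr.dy h.isOpen i) hz'
    rw [h.sum_metric hz', energy, ← h.smooth_sqr.fderiv_dy h.isOpen hz', e2]
    simp [Function.uncurry]
  have e3 := (d1.congr_of_eventuallyEq e1.symm).unique d2
  have e4 := congrArg (fun ℓ : E n × E n →L[ℝ] ℝ => ℓ (a, b)) e3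
  have e5 : ∑ j, (metric L i j z.1 z.2 * b j +
      z.2 j * fderiv ℝ (Function.uncurry (metric L i j)) z (a, b)) =
      (1 / 2) * fderiv ℝ (fderiv ℝ (energy L)) z (a, b) (0, EuclideanSpace.single i 1) := by
    rw [energy, ← h.smooth_sqr.fderiv_dy h.isOpen hz]
    simpa using! e4
  rw [Finset.sum_add_distrib, h.sum_metric hz] at e5
  have e6 : fderiv ℝ (fderiv ℝ (energy L)) z (a, b) =
      fderiv ℝ (fderiv ℝ (energy L)) z (a, 0) + fderiv ℝ (fderiv ℝ (energy L)) z (0, b) := by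
    rw [← map_add]; simp
  rw [e6, add_apply] at e5
  linarith

/-- By `sum_fderiv_metric` the vertical parts of the derivatives δ/δx disappear under contraction.
The first two summands give (1/2) y^k (F²)_{x^k y^l} each, the third gives (F²)_{x^l}: together they
are the bracket in the definition of the spray. -/
theorem chern_contract (h : IsCoordFinsler U L) (hz : z ∈ slit U) (r : Fin n) :
    ∑ j, ∑ k, chern L r j k z.1 z.2 * z.2 j * z.2 k = spray L r z.1 z.2 := by
  have key : ∀ l, ∑ j, ∑ k, (delta L k (metric L l j) z.1 z.2 + delta L j (metric L k l) z.1 z.2 -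
      delta L l (metric L j k) z.1 z.2) * z.2 j * z.2 k =
      (∑ k, dx k (dy l (sqr L)) z.1 z.2 * z.2 k) - dx l (sqr L) z.1 z.2 := by
    intro l
    have a1 : ∑ j, ∑ k, delta L k (metric L l j) z.1 z.2 * z.2 j * z.2 k =
        (1 / 2) * fderiv ℝ (fderiv ℝ (energy L)) z (z.2, 0) (0, EuclideanSpace.single l 1) := by
      rw [← h.sum_fderiv_metric hz l z.2 (-sprayVec L z)]
      refine Finset.sum_congr rfl fun j _ => ?_
      rw [← h.sum_delta (h.smooth_metric l j) hz, Finset.mul_sum]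
      exact Finset.sum_congr rfl fun k _ => by ring
    have a2 : ∑ j, ∑ k, delta L j (metric L k l) z.1 z.2 * z.2 j * z.2 k =
        (1 / 2) * fderiv ℝ (fderiv ℝ (energy L)) z (z.2, 0) (0, EuclideanSpace.single l 1) := by
      rw [← h.sum_fderiv_metric hz l z.2 (-sprayVec L z), Finset.sum_comm]
      refine Finset.sum_congr rfl fun k _ => ?_
      rw [h.fderiv_metric_symm hz, ← h.sum_delta (h.smooth_metric k l) hz, Finset.mul_sum]
      exact Finset.sum_congr rfl fun k _ => by ring
    have a3 : ∑ j, ∑ k, delta L l (metric L j k) z.1 z.2 * z.2 j * z.2 k =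
        dx l (sqr L) z.1 z.2 := by
      have b1 : ∀ j, ∑ k, delta L l (metric L j k) z.1 z.2 * z.2 j * z.2 k =
          z.2 j * ((1 / 2) * fderiv ℝ (fderiv ℝ (energy L)) z (EuclideanSpace.single l 1, 0)
            (0, EuclideanSpace.single j 1)) := by
        intro j
        rw [← h.sum_fderiv_metric hz j _ (-WithLp.toLp 2 fun m => nonlin L m l z.1 z.2),
          Finset.mul_sum]
        refine Finset.sum_congr rfl fun k _ => ?_
        rw [h.delta_eq (h.smooth_metric j k) hz]
        ring
      have b2 := map_inr_eq_sum (fderiv ℝ (fderiv ℝ (energy L)) z (EuclideanSpace.single l 1, 0)) z.2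
      have b3 := (h.homog_sqr.dx h.isOpen l h.smooth_sqr).euler h.isOpen
        (h.smooth_sqr.dx h.isOpen l) hz
      rw [h.smooth_sqr.fderiv_dx h.isOpen hz,
        h.smooth_sqr.fderiv_fderiv_symm h.isOpen hz] at b3
      rw [energy, b3] at b2
      simp only [smul_eq_mul] at b2
      rw [Finset.sum_congr rfl fun j _ => b1 j]
      simp only [mul_left_comm _ (1 / 2 : ℝ), ← Finset.mul_sum, energy, ← b2]
      push_cast
      ring
    have a4 : ∑ k, dx k (dy l (sqr L)) z.1 z.2 * z.2 k =
        fderiv ℝ (fderiv ℝ (energy L)) z (z.2, 0) (0, EuclideanSpace.single l 1) := by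
      rw [energy, ← h.smooth_sqr.fderiv_dy h.isOpen hz,
        ← (h.smooth_sqr.dy h.isOpen l).sum_dx h.isOpen hz]
      exact Finset.sum_congr rfl fun k _ => mul_comm _ _
    simp only [add_mul, sub_mul, Finset.sum_add_distrib, Finset.sum_sub_distrib, a1, a2, a3, a4]
    ring
  rw [spray]
  simp only [← key, chern, Finset.mul_sum, Finset.sum_mul]
  rw [Finset.sum_congr rfl fun j _ => Finset.sum_comm, Finset.sum_comm]
  exact Finset.sum_congr rfl fun l _ => Finset.sum_congr rfl fun j _ =>
    Finset.sum_congr rfl fun k _ => by ring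

theorem chern_symm (h : IsCoordFinsler U L) (hz : z ∈ slit U) (r j k : Fin n) :
    chern L r j k z.1 z.2 = chern L r k j z.1 z.2 := by
  have e : ∀ l i j, delta L l (metric L i j) z.1 z.2 = delta L l (metric L j i) z.1 z.2 := by
    intro l i j
    rw [h.delta_eq (h.smooth_metric i j) hz, h.delta_eq (h.smooth_metric j i) hz,
      h.fderiv_metric_symm hz]
  rw [chern, chern]
  congr 1
  refine Finset.sum_congr rfl fun l _ => ?_
  rw [e k l j, e j k l, e l j k]
  ring

/-- In F²Ric = Ric_ij y^i y^j the derivative along (y, -G) produces -Ric(G, y) twice from the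
factors y, and y^k δ_k Ric_ij y^i y^j from the coefficients. Parallelism and the contraction `hC`
turn the latter into +Ric(G, y) twice. Nothing else about C matters, which is why one proof serves
both connections. -/
theorem fderiv_ricScalar_spray (h : IsCoordFinsler U L) (hz : z ∈ slit U)
    {C : Fin n → Fin n → Fin n → E n → E n → ℝ}
    (hC : ∀ r, ∑ j, ∑ k, C r j k z.1 z.2 * z.2 j * z.2 k = spray L r z.1 z.2)
    (hpar : ∀ i j k, ricciHor L C i j k z.1 z.2 = 0) :
    fderiv ℝ (Function.uncurry (ricScalar L)) z (z.2, -sprayVec L z) = 0 := by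
  have d1 : HasFDerivAt (fun z : E n × E n => ∑ i, ∑ j, ricci L i j z.1 z.2 * z.2 i * z.2 j) _ z :=
    HasFDerivAt.fun_sum (u := Finset.univ) fun i _ => HasFDerivAt.fun_sum (u := Finset.univ)
      fun j _ => (((h.smooth_ricci i j).hasFDerivAt h.isOpen hz).mul
        ((EuclideanSpace.proj (𝕜 := ℝ) i).hasFDerivAt.comp z (hasFDerivAt_snd (p := z)))).mul
        ((EuclideanSpace.proj (𝕜 := ℝ) j).hasFDerivAt.comp z (hasFDerivAt_snd (p := z)))
  have e1 : Function.uncurry (ricScalar L) =ᶠ[𝓝 z]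
      fun z : E n × E n => ∑ i, ∑ j, ricci L i j z.1 z.2 * z.2 i * z.2 j := by
    filter_upwards [(isOpen_slit h.isOpen).mem_nhds hz] with z' hz' using
      (h.sum_sum_ricci hz').symm
  have e2 : fderiv ℝ (Function.uncurry (ricScalar L)) z (z.2, -sprayVec L z) =
      ∑ i, ∑ j, ((ricci L i j z.1 z.2 * z.2 i) * -spray L j z.1 z.2 +
        z.2 j * (ricci L i j z.1 z.2 * -spray L i z.1 z.2 +
          z.2 i * fderiv ℝ (Function.uncurry (ricci L i j)) z (z.2, -sprayVec L z))) := by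
    rw [(d1.congr_of_eventuallyEq e1).fderiv]
    simp only [sum_apply]
    rfl
  have e3 : ∑ i, ∑ j, z.2 j * (z.2 i *
      fderiv ℝ (Function.uncurry (ricci L i j)) z (z.2, -sprayVec L z)) =
      ∑ i, ∑ j, (ricci L i j z.1 z.2 * z.2 i * spray L j z.1 z.2 +
        z.2 j * (ricci L i j z.1 z.2 * spray L i z.1 z.2)) := by
    have f1 : ∀ i j, z.2 j * (z.2 i *
        fderiv ℝ (Function.uncurry (ricci L i j)) z (z.2, -sprayVec L z)) =
        ∑ k, z.2 i * z.2 j * z.2 k * ((∑ r, ricci L i r z.1 z.2 * C r j k z.1 z.2) +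
          ∑ r, ricci L j r z.1 z.2 * C r i k z.1 z.2) := by
      intro i j
      rw [← h.sum_delta (h.smooth_ricci i j) hz, Finset.mul_sum, Finset.mul_sum]
      refine Finset.sum_congr rfl fun k _ => ?_
      have := hpar i j k
      rw [ricciHor] at this
      rw [show delta L k (ricci L i j) z.1 z.2 = (∑ r, ricci L i r z.1 z.2 * C r j k z.1 z.2) +
          ∑ r, ricci L j r z.1 z.2 * C r i k z.1 z.2 by linarith]
      ring
    have f2 : ∀ i, ∑ j, ∑ k, z.2 j * z.2 k * ∑ r, ricci L i r z.1 z.2 * C r j k z.1 z.2 =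
        ∑ r, ricci L i r z.1 z.2 * spray L r z.1 z.2 := by
      intro i
      simp only [← hC, Finset.mul_sum]
      rw [Finset.sum_congr rfl fun j _ => Finset.sum_comm, Finset.sum_comm]
      exact Finset.sum_congr rfl fun r _ => Finset.sum_congr rfl fun j _ =>
        Finset.sum_congr rfl fun k _ => by ring
    have f3 : ∑ i, ∑ j, ∑ k, z.2 i * z.2 j * z.2 k *
        ∑ r, ricci L i r z.1 z.2 * C r j k z.1 z.2 =
        ∑ i, ∑ j, ricci L i j z.1 z.2 * z.2 i * spray L j z.1 z.2 := by
      refine Finset.sum_congr rfl fun i _ => ?_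
      rw [← Finset.sum_congr rfl fun j _ => show z.2 i * (ricci L i j z.1 z.2 * spray L j z.1 z.2) =
        ricci L i j z.1 z.2 * z.2 i * spray L j z.1 z.2 by ring, ← Finset.mul_sum, ← f2 i]
      simp only [Finset.mul_sum, mul_assoc]
    have f4 : ∑ i, ∑ j, ∑ k, z.2 i * z.2 j * z.2 k *
        ∑ r, ricci L j r z.1 z.2 * C r i k z.1 z.2 =
        ∑ i, ∑ j, z.2 j * (ricci L i j z.1 z.2 * spray L i z.1 z.2) := by
      rw [Finset.sum_comm, Finset.sum_comm (f := fun i j =>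
        z.2 j * (ricci L i j z.1 z.2 * spray L i z.1 z.2))]
      refine Finset.sum_congr rfl fun j _ => ?_
      rw [← Finset.mul_sum, Finset.sum_congr rfl fun i _ => show ricci L i j z.1 z.2 *
        spray L i z.1 z.2 = ricci L j i z.1 z.2 * spray L i z.1 z.2 by rw [h.ricci_symm hz],
        ← f2 j]
      simp only [Finset.mul_sum]
      exact Finset.sum_congr rfl fun r _ => Finset.sum_congr rfl fun j _ =>
        Finset.sum_congr rfl fun k _ => by ring
    simp only [f1, mul_add, Finset.sum_add_distrib]
    rw [f3, f4]
  rw [e2]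
  have e4 : ∀ i j, ((ricci L i j z.1 z.2 * z.2 i) * -spray L j z.1 z.2 +
        z.2 j * (ricci L i j z.1 z.2 * -spray L i z.1 z.2 +
          z.2 i * fderiv ℝ (Function.uncurry (ricci L i j)) z (z.2, -sprayVec L z))) =
      z.2 j * (z.2 i * fderiv ℝ (Function.uncurry (ricci L i j)) z (z.2, -sprayVec L z)) -
      (ricci L i j z.1 z.2 * z.2 i * spray L j z.1 z.2 +
        z.2 j * (ricci L i j z.1 z.2 * spray L i z.1 z.2)) := fun i j => by ring
  simp only [e4]
  simp only [Finset.sum_sub_distrib] at e3 ⊢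
  rw [e3, sub_self]

end IsCoordFinsler

end

section

variable {n : ℕ}

/-! ### The Riemannian metric of a parallel Ricci tensor -/

/-- The coordinate bilinear form `(a, b) ↦ a^i b^j`. -/
def coordForm (i j : Fin n) : E n →L[ℝ] E n →L[ℝ] ℝ :=
  (EuclideanSpace.proj (𝕜 := ℝ) i).smulRight
    (EuclideanSpace.proj (𝕜 := ℝ) j : E n →L[ℝ] ℝ)

theorem coordForm_apply (i j : Fin n) (a b : E n) : coordForm i j a b = a i * b j := rfl

/-- The bilinear form `-4/(n-1) Ric`, evaluated in the direction `e`. -/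
def ricForm (L : E n → E n → ℝ) (e x : E n) : E n →L[ℝ] E n →L[ℝ] ℝ :=
  ∑ i, ∑ j, (-(4 / ((n : ℝ) - 1)) * ricci L i j x e) • coordForm i j

theorem ricForm_apply (L : E n → E n → ℝ) (e x a b : E n) :
    ricForm L e x a b =
      -(4 / ((n : ℝ) - 1)) * ∑ i, ∑ j, ricci L i j x e * a i * b j := by
  simp only [ricForm, sum_apply, smul_apply, coordForm_apply, smul_eq_mul, Finset.mul_sum]
  exact Finset.sum_congr rfl fun i _ => Finset.sum_congr rfl fun j _ => by ring

namespace IsCoordFinsler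

variable {U : Set (E n)} {L : E n → E n → ℝ} {e x : E n}

theorem contDiffOn_ricForm (h : IsCoordFinsler U L) (he : e ≠ 0) :
    ContDiffOn ℝ ∞ (ricForm L e) U := by
  have h1 : ∀ i j, ContDiffOn ℝ ∞ (fun x => ricci L i j x e) U := fun i j =>
    ContDiffOn.comp (g := Function.uncurry (ricci L i j)) (f := fun x => (x, e))
      (h.smooth_ricci i j) (contDiffOn_id.prodMk contDiffOn_const) fun x hx => ⟨hx, he⟩
  have h2 : ∀ i j, ContDiffOn ℝ ∞ (fun x => -(4 / ((n : ℝ) - 1)) * ricci L i j x e) U :=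
    fun i j => contDiffOn_const.mul (h1 i j)
  have h3 : ∀ i j, ContDiffOn ℝ ∞
      (fun x => (-(4 / ((n : ℝ) - 1)) * ricci L i j x e) • coordForm i j) U :=
    fun i j => (h2 i j).smul contDiffOn_const
  exact ContDiffOn.sum fun i _ => ContDiffOn.sum fun j _ => h3 i j

theorem ricForm_symm (h : IsCoordFinsler U L) (he : e ≠ 0) (hx : x ∈ U) (a b : E n) :
    ricForm L e x a b = ricForm L e x b a := by
  rw [ricForm_apply, ricForm_apply, Finset.sum_comm]
  congr 1
  refine Finset.sum_congr rfl fun i _ => Finset.sum_congr rfl fun j _ => ?_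
  rw [h.ricci_symm (z := (x, e)) ⟨hx, he⟩]
  ring

theorem fderiv_ricForm (h : IsCoordFinsler U L) (he : e ≠ 0) (hx : x ∈ U) (w a b : E n) :
    fderiv ℝ (ricForm L e) x w a b = -(4 / ((n : ℝ) - 1)) *
      ∑ i, ∑ j, fderiv ℝ (Function.uncurry (ricci L i j)) (x, e) (w, 0) * a i * b j := by
  have h1 : HasFDerivAt (ricForm L e) _ x := HasFDerivAt.fun_sum (u := Finset.univ) fun i _ =>
    HasFDerivAt.fun_sum (u := Finset.univ) fun j _ =>
      (((h.smooth_ricci i j).hasFDerivAt_left h.isOpen (z := (x, e)) ⟨hx, he⟩).const_mul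
        (-(4 / ((n : ℝ) - 1)))).smul_const (coordForm i j)
  rw [h1.fderiv]
  simp only [sum_apply, smul_apply, ContinuousLinearMap.smulRight_apply, coordForm_apply,
    smul_eq_mul, Finset.mul_sum, ContinuousLinearMap.comp_apply, ContinuousLinearMap.inl_apply]
  exact Finset.sum_congr rfl fun i _ => Finset.sum_congr rfl fun j _ => by ring

section VertParallel

variable (h : IsCoordFinsler U L) (hn : 2 ≤ n)
  (hvert : ∀ x ∈ U, ∀ y : E n, y ≠ 0 → ∀ i j k, ricciVert L i j k x y = 0)

include h hvert

theorem fderiv_ricci_inr {z : E n × E n} (hz : z ∈ slit U) (i j : Fin n) (w : E n) :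
    fderiv ℝ (Function.uncurry (ricci L i j)) z (0, w) = 0 := by
  rw [← (h.smooth_ricci i j).sum_dy h.isOpen hz]
  exact Finset.sum_eq_zero fun k _ => by
    rw [show dy k (ricci L i j) z.1 z.2 = 0 from hvert _ hz.1 _ hz.2 i j k, mul_zero]

include hn

/-- The coefficients are locally constant in y, and the complement of the origin is connected
because n ≥ 2. -/
theorem ricci_eq_of_vertParallel (hx : x ∈ U) {y : E n} (he : e ≠ 0) (hy : y ≠ 0) (i j : Fin n) :
    ricci L i j x y = ricci L i j x e := by
  have hrank : 1 < Module.rank ℝ (E n) := by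
    rw [← Module.finrank_eq_rank, finrank_euclideanSpace_fin]
    exact_mod_cast hn
  have h1 : ∀ y : E n, y ≠ 0 → HasFDerivAt (fun y => ricci L i j x y) (0 : E n →L[ℝ] ℝ) y := by
    intro y hy
    have h2 := (h.smooth_ricci i j).hasFDerivAt_right h.isOpen (z := (x, y)) ⟨hx, hy⟩
    convert h2 using 1
    ext w
    simp [h.fderiv_ricci_inr hvert (z := (x, y)) ⟨hx, hy⟩]
  exact isOpen_compl_singleton.is_const_of_fderiv_eq_zero
    (isConnected_compl_singleton_of_one_lt_rank hrank 0).isPreconnected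
    (fun y hy => (h1 y hy).differentiableAt.differentiableWithinAt)
    (fun y hy => (h1 y hy).fderiv) hy he

theorem ricForm_self (hx : x ∈ U) {y : E n} (he : e ≠ 0) (hy : y ≠ 0) :
    ricForm L e x y y = -(4 / ((n : ℝ) - 1)) * ricScalar L x y := by
  rw [ricForm_apply, ← h.sum_sum_ricci (z := (x, y)) ⟨hx, hy⟩]
  simp only [h.ricci_eq_of_vertParallel hn hvert hx he hy]

/-- The geodesic equation of the Finsler structure is the one of the form `ricForm`. -/
theorem ricForm_sprayVec {y : E n} (hx : x ∈ U) (he : e ≠ 0) (hy : y ≠ 0)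
    {C : Fin n → Fin n → Fin n → E n → E n → ℝ}
    (hC : ∀ r, ∑ j, ∑ k, C r j k x y * y j * y k = spray L r x y)
    (hsymm : ∀ r j k, C r j k x y = C r k j x y)
    (hpar : ∀ i j k, ricciHor L C i j k x y = 0) (ξ : E n) :
    ricForm L e x (sprayVec L (x, y)) ξ =
      fderiv ℝ (ricForm L e) x y y ξ - (1 / 2) * fderiv ℝ (ricForm L e) x ξ y y := by
  have heq : ∀ a b, ricForm L e x a b = ricForm L y x a b := fun a b => by
    simp only [ricForm_apply, h.ricci_eq_of_vertParallel hn hvert hx hy he]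
  have heq' : fderiv ℝ (ricForm L e) x = fderiv ℝ (ricForm L y) x := by
    refine Filter.EventuallyEq.fderiv_eq ?_
    filter_upwards [h.isOpen.mem_nhds hx] with x' hx'
    ext a b
    simp only [ricForm_apply, h.ricci_eq_of_vertParallel hn hvert hx' hy he]
  have hz : (x, y) ∈ slit U := ⟨hx, hy⟩
  have hdx : ∀ i j (w : E n), fderiv ℝ (Function.uncurry (ricci L i j)) (x, y) (w, 0) =
      ∑ k, w k * ((∑ r, ricci L i r x y * C r j k x y) + ∑ r, ricci L j r x y * C r i k x y) := by
    intro i j w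
    rw [← (h.smooth_ricci i j).sum_dx h.isOpen hz]
    refine Finset.sum_congr rfl fun k _ => ?_
    have h1 := hpar i j k
    rw [ricciHor, delta] at h1
    have h2 : ∀ l, dy l (ricci L i j) x y = 0 := fun l => hvert x hx y hy i j l
    simp only [h2, mul_zero, Finset.sum_const_zero, sub_zero] at h1
    rw [show dx k (ricci L i j) x y = (∑ r, ricci L i r x y * C r j k x y) +
      ∑ r, ricci L j r x y * C r i k x y by linarith]
  rw [heq, heq', h.fderiv_ricForm hy hx, h.fderiv_ricForm hy hx, ricForm_apply]
  -- Symmetry of C in its lower indices exchanges y and a, as in the derivation of the Koszul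
  -- formula: D_yh(y, ξ) = h(G, ξ) + h(y, C(y, ξ)) and D_ξh(y, y) = 2 h(y, C(y, ξ)), so the stated
  -- combination leaves h(G, ξ).
  have hswap : ∀ (a : E n), ∑ i, ∑ j, (∑ k, a k * ∑ r, ricci L i r x y * C r j k x y) * y i * y j =
      ∑ i, ∑ j, (∑ k, y k * ∑ r, ricci L i r x y * C r j k x y) * y i * a j := by
    intro a
    refine Finset.sum_congr rfl fun i _ => ?_
    simp only [Finset.sum_mul]
    rw [Finset.sum_comm]
    refine Finset.sum_congr rfl fun j _ => Finset.sum_congr rfl fun k _ => ?_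
    simp only [hsymm _ k j]
    ring
  have hswap' : ∀ (a : E n), ∑ i, ∑ j, (∑ k, a k * ∑ r, ricci L j r x y * C r i k x y) * y i * y j =
      ∑ i, ∑ j, (∑ k, y k * ∑ r, ricci L i r x y * C r j k x y) * y i * a j := by
    intro a
    rw [← hswap a, Finset.sum_comm]
    exact Finset.sum_congr rfl fun i _ => Finset.sum_congr rfl fun j _ => by ring
  have hG : ∑ i, ∑ j, (∑ k, y k * ∑ r, ricci L j r x y * C r i k x y) * y i * ξ j =
      ∑ i, ∑ j, ricci L i j x y * sprayVec L (x, y) i * ξ j := by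
    rw [Finset.sum_comm, Finset.sum_comm (f := fun i j =>
      ricci L i j x y * sprayVec L (x, y) i * ξ j)]
    refine Finset.sum_congr rfl fun j _ => ?_
    rw [← Finset.sum_mul, ← Finset.sum_mul]
    congr 1
    simp only [sprayVec_apply, ← hC, Finset.mul_sum, Finset.sum_mul]
    rw [Finset.sum_congr rfl fun i _ => Finset.sum_comm, Finset.sum_comm]
    refine Finset.sum_congr rfl fun r _ => Finset.sum_congr rfl fun i _ =>
      Finset.sum_congr rfl fun k _ => ?_
    rw [h.ricci_symm hz j r]
    ring
  simp only [hdx, mul_add, add_mul, Finset.sum_add_distrib, hswap, hswap', hG]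
  ring

end VertParallel

end IsCoordFinsler

end

section

variable {n : ℕ}


variable {M : Type*} [TopologicalSpace M] [ChartedSpace (E n) M]

/-! ### Changes of charts -/

section Transition

/-- The change of coordinates from the chart around `p` to the chart around `q`. -/
def trans (p q : M) (x : E n) : E n := chartAt (E n) q ((chartAt (E n) p).symm x)

/-- The domain of the change of coordinates from the chart around `p` to that around `q`. -/
def transDom (p q : M) : Set (E n) :=
  (chartAt (E n) p).target ∩ (chartAt (E n) p).symm ⁻¹' (chartAt (E n) q).source

theorem isOpen_transDom (p q : M) : IsOpen (transDom (n := n) p q) :=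
  (chartAt (E n) p).isOpen_inter_preimage_symm (chartAt (E n) q).open_source

theorem mapsTo_trans (p q : M) : MapsTo (trans (n := n) p q) (transDom p q) (transDom q p) := by
  intro x hx
  refine ⟨(chartAt (E n) q).map_source hx.2, ?_⟩
  simp only [trans, mem_preimage, (chartAt (E n) q).left_inv hx.2]
  exact (chartAt (E n) p).map_target hx.1

theorem trans_trans (p q : M) {x : E n} (hx : x ∈ transDom p q) :
    trans q p (trans p q x) = x := by
  simp only [trans, (chartAt (E n) q).left_inv hx.2, (chartAt (E n) p).right_inv hx.1]

variable [IsManifold (𝓡 n) ∞ M]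

theorem contDiffOn_trans (p q : M) : ContDiffOn ℝ ∞ (trans (n := n) p q) (transDom p q) := by
  rw [← contMDiffOn_iff_contDiffOn]
  exact (contMDiffOn_chart (I := 𝓡 n) (x := q)).comp
    ((contMDiffOn_chart_symm (I := 𝓡 n) (x := p)).mono inter_subset_left) fun x hx => hx.2

theorem differentiableAt_trans (p q : M) {x : E n} (hx : x ∈ transDom p q) :
    DifferentiableAt ℝ (trans p q) x :=
  ((contDiffOn_trans p q).contDiffAt ((isOpen_transDom p q).mem_nhds hx)).differentiableAt
    (by simp)

theorem fderiv_trans_mul (p q : M) {x : E n} (hx : x ∈ transDom p q) :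
    fderiv ℝ (trans q p) (trans p q x) * fderiv ℝ (trans p q) x = 1 := by
  have h1 := (differentiableAt_trans q p (mapsTo_trans p q hx)).hasFDerivAt.comp x
    (differentiableAt_trans p q hx).hasFDerivAt
  have h2 : trans q p ∘ trans p q =ᶠ[𝓝 x] id := by
    filter_upwards [(isOpen_transDom p q).mem_nhds hx] with x' hx' using trans_trans p q hx'
  exact (h1.congr_of_eventuallyEq h2.symm).unique (hasFDerivAt_id x)

theorem fderiv_trans_mul' (p q : M) {x : E n} (hx : x ∈ transDom p q) :
    fderiv ℝ (trans p q) x * fderiv ℝ (trans q p) (trans p q x) = 1 := by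
  have := fderiv_trans_mul q p (mapsTo_trans p q hx)
  rwa [trans_trans p q hx] at this

theorem fderiv_trans_injective (p q : M) {x : E n} (hx : x ∈ transDom p q) :
    Function.Injective (fderiv ℝ (trans p q) x) :=
  Function.LeftInverse.injective (g := fderiv ℝ (trans q p) (trans p q x)) fun w =>
    congrArg (fun A : E n →L[ℝ] E n => A w) (fderiv_trans_mul p q hx)

theorem fderiv_trans_surjective (p q : M) {x : E n} (hx : x ∈ transDom p q) :
    Function.Surjective (fderiv ℝ (trans p q) x) :=
  Function.RightInverse.surjective (g := fderiv ℝ (trans q p) (trans p q x)) fun w =>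
    congrArg (fun A : E n →L[ℝ] E n => A w) (fderiv_trans_mul' p q hx)

theorem mapsTo_tangentLift_trans (p q : M) :
    MapsTo (tangentLift (trans p q)) (slit (transDom (n := n) p q))
      (slit (chartAt (E n) q).target) := by
  intro z hz
  refine ⟨(mapsTo_trans p q hz.1).1, fun h0 => hz.2 ?_⟩
  exact fderiv_trans_injective p q hz.1 (by simpa [tangentLift] using h0)

theorem mdifferentiableAt_chart_symm (p : M) {x : E n} (hx : x ∈ (chartAt (E n) p).target) :
    MDifferentiableAt (𝓡 n) (𝓡 n) (chartAt (E n) p).symm x :=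
  ((contMDiffOn_chart_symm (I := 𝓡 n) (n := ∞) (x := p)).contMDiffAt
    ((chartAt (E n) p).open_target.mem_nhds hx)).mdifferentiableAt (by simp)

theorem tangent_mk_eq {a b : M} {v w : E n} (h : a = b) (hv : v = w) :
    (⟨a, v⟩ : TangentBundle (𝓡 n) M) = ⟨b, w⟩ := by
  subst h hv
  rfl

/-- The two inverse charts differ by the change of coordinates, and so do their differentials by the
chain rule. -/
theorem localRep_tangentLift (F : TangentBundle (𝓡 n) M → ℝ) (p q : M) {z : E n × E n}
    (hz : z.1 ∈ transDom p q) :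
    localRep F q (tangentLift (trans p q) z).1 (tangentLift (trans p q) z).2 =
      localRep F p z.1 z.2 := by
  have h1 : (chartAt (E n) q).symm ∘ trans p q =ᶠ[𝓝 z.1] (chartAt (E n) p).symm := by
    filter_upwards [(isOpen_transDom p q).mem_nhds hz] with x' hx'
    exact (chartAt (E n) q).left_inv hx'.2
  have h2 : mfderiv (𝓡 n) (𝓡 n) ((chartAt (E n) q).symm ∘ trans p q) z.1 =
      (mfderiv (𝓡 n) (𝓡 n) (chartAt (E n) q).symm (trans p q z.1)).comp
        (mfderiv (𝓡 n) (𝓡 n) (trans p q) z.1) :=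
    mfderiv_comp z.1 (mdifferentiableAt_chart_symm q (mapsTo_trans p q hz).1)
      (differentiableAt_trans p q hz).mdifferentiableAt
  have h3 := h1.mfderiv_eq (I := 𝓡 n) (I' := 𝓡 n)
  rw [localRep, localRep]
  congr 1
  refine tangent_mk_eq h1.eq_of_nhds ?_
  have h4 := h2.symm.trans h3
  rw [mfderiv_eq_fderiv] at h4
  exact congrArg (fun A : E n →L[ℝ] E n => A z.2) h4

end Transition

section Smooth

variable [IsManifold (𝓡 n) ∞ M]

/-- F is composed with the tangent map of the inverse chart, which preserves the slit bundle because
the differential of the chart is a left inverse. -/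
theorem smoothOn_localRep {F : TangentBundle (𝓡 n) M → ℝ}
    (hF : ContMDiffOn (𝓡 n).tangent 𝓘(ℝ, ℝ) ∞ F {v | v.2 ≠ 0}) (p : M) :
    SmoothOn (chartAt (E n) p).target (localRep F p) := by
  have h1 : ContMDiffOn (𝓡 n).tangent (𝓡 n).tangent ∞
      (tangentMapWithin (𝓡 n) (𝓡 n) (chartAt (E n) p).symm (chartAt (E n) p).target)
      (Bundle.TotalSpace.proj ⁻¹' (chartAt (E n) p).target) :=
    (contMDiffOn_chart_symm (I := 𝓡 n) (n := ∞) (x := p)).contMDiffOn_tangentMapWithin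
      (by simp) (chartAt (E n) p).open_target.uniqueMDiffOn
  have h2 : ContMDiff 𝓘(ℝ, E n × E n) (𝓡 n).tangent ∞
      (fun z : E n × E n => (⟨z.1, z.2⟩ : TangentBundle (𝓡 n) (E n))) := by
    rw [modelWithCornersSelf_prod]
    exact contMDiff_tangentBundleModelSpaceHomeomorph_symm (I := 𝓡 n) (n := ∞)
  have hU := (chartAt (E n) p).open_target
  have h4 : ∀ z ∈ slit (chartAt (E n) p).target,
      tangentMapWithin (𝓡 n) (𝓡 n) (chartAt (E n) p).symm (chartAt (E n) p).target
        (⟨z.1, z.2⟩ : TangentBundle (𝓡 n) (E n)) =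
      ⟨(chartAt (E n) p).symm z.1,
        mfderiv (𝓡 n) (𝓡 n) (chartAt (E n) p).symm z.1 z.2⟩ := by
    intro z hz
    rw [tangentMapWithin_eq_tangentMap (hU.uniqueMDiffWithinAt hz.1)
      (mdifferentiableAt_chart_symm p hz.1)]
    rfl
  have h3 : ContMDiffOn 𝓘(ℝ, E n × E n) 𝓘(ℝ, ℝ) ∞ (Function.uncurry (localRep F p))
      (slit (chartAt (E n) p).target) := by
    have h5 := h1.comp (h2.contMDiffOn (s := slit (chartAt (E n) p).target)) 
      (fun z (hz : z ∈ slit (chartAt (E n) p).target) => hz.1)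
    refine ContMDiffOn.congr (hF.comp h5 ?_) ?_
    · intro z hz
      simp only [mem_preimage, Function.comp_apply, h4 z hz, mem_ofPred_eq]
      intro h0
      have h6 := (contMDiffOn_chart (I := 𝓡 n) (n := ∞) (x := p)).contMDiffAt
        ((chartAt (E n) p).open_source.mem_nhds ((chartAt (E n) p).map_target hz.1))
      have h7 := mfderiv_comp z.1 (h6.mdifferentiableAt (by simp))
        (mdifferentiableAt_chart_symm p hz.1)
      have h8 : chartAt (E n) p ∘ (chartAt (E n) p).symm =ᶠ[𝓝 z.1] id := by
        filter_upwards [hU.mem_nhds hz.1] with x' hx' using (chartAt (E n) p).right_inv hx'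
      have h9 := h7.symm.trans (h8.mfderiv_eq (I := 𝓡 n) (I' := 𝓡 n))
      rw [mfderiv_id] at h9
      have h10 := congrArg (fun A : E n →L[ℝ] E n => A z.2) h9
      refine hz.2 ((h10.symm.trans ?_ : z.2 = 0))
      exact (congrArg (mfderiv (𝓡 n) (𝓡 n) (chartAt (E n) p)
        ((chartAt (E n) p).symm z.1)) h0).trans (map_zero _)
    · intro z hz
      simp only [Function.comp_apply, h4 z hz]
      rfl
  exact contMDiffOn_iff_contDiffOn.mp h3

end Smooth

theorem IsCoordFinsler.mono {U V : Set (E n)} {L : E n → E n → ℝ} (h : IsCoordFinsler U L)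
    (hV : IsOpen V) (hVU : V ⊆ U) : IsCoordFinsler V L where
  isOpen := hV
  smooth := ContDiffOn.mono h.smooth (prod_mono hVU subset_rfl)
  homog x hx := h.homog x (hVU hx)
  convex x hx := h.convex x (hVU hx)

/-! ### Coordinate expressions of a Finsler structure and their invariance -/

namespace FinslerStructure

variable [IsManifold (𝓡 n) ∞ M] (𝓕 : FinslerStructure n M)

theorem isCoordFinsler (p : M) : IsCoordFinsler (chartAt (E n) p).target (𝓕.loc p) where
  isOpen := (chartAt (E n) p).open_target
  smooth := smoothOn_localRep 𝓕.smooth p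
  homog x hx y hy c hc := by
    have h1 : mfderiv (𝓡 n) (𝓡 n) (chartAt (E n) p).symm x (c • y) =
      c • mfderiv (𝓡 n) (𝓡 n) (chartAt (E n) p).symm x y := map_smul _ _ _
    rw [loc, localRep, localRep, h1, 𝓕.homog _ _ c hc, pow_one]
  convex x hx y hy w hw := 𝓕.convex p x hx y hy w hw

theorem isCoordFinsler_transDom (p q : M) : IsCoordFinsler (transDom p q) (𝓕.loc p) :=
  (𝓕.isCoordFinsler p).mono (isOpen_transDom p q) inter_subset_left

theorem loc_tangentLift (p q : M) {z : E n × E n} (hz : z.1 ∈ transDom p q) :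
    𝓕.loc q (tangentLift (trans p q) z).1 (tangentLift (trans p q) z).2 = 𝓕.loc p z.1 z.2 :=
  localRep_tangentLift 𝓕.F p q hz

theorem sprayVec_tangentLift (p q : M) {z : E n × E n} (hz : z ∈ slit (transDom p q)) :
    sprayVec (𝓕.loc q) (tangentLift (trans p q) z) =
      fderiv ℝ (trans p q) z.1 (sprayVec (𝓕.loc p) z) -
        fderiv ℝ (fderiv ℝ (trans p q)) z.1 z.2 z.2 := by
  refine (𝓕.isCoordFinsler_transDom p q).sprayVec_tangentLift (𝓕.isCoordFinsler q)
    (contDiffOn_trans p q) (mapsTo_tangentLift_trans p q)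
    (fun x hx => fderiv_trans_surjective p q hx) (fun z hz => ?_) hz
  simp only [energy, sqr, Function.uncurry_def, 𝓕.loc_tangentLift p q hz.1]

/-- This allows `ricciAlong`, defined through the chart at the moving point, to be computed near a
given time in one fixed chart. -/
theorem ricScalar_tangentLift (p q : M) {z : E n × E n} (hz : z ∈ slit (transDom p q)) :
    ricScalar (𝓕.loc q) (tangentLift (trans p q) z).1 (tangentLift (trans p q) z).2 =
      ricScalar (𝓕.loc p) z.1 z.2 := by
  rw [(𝓕.isCoordFinsler q).ricScalar_eq_traceCurv (mapsTo_tangentLift_trans p q hz),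
    (𝓕.isCoordFinsler_transDom p q).ricScalar_eq_traceCurv hz]
  have hK : ContDiffOn ℝ ∞ (fun x => fderiv ℝ (trans q p) (trans p q x)) (transDom (n := n) p q) :=
    ((contDiffOn_trans q p).fderiv_of_isOpen (isOpen_transDom q p) (by simp)).comp
      (contDiffOn_trans p q) (mapsTo_trans p q)
  exact traceCurv_tangentLift (isOpen_transDom p q) (chartAt (E n) q).open_target
    (contDiffOn_trans p q) (mapsTo_tangentLift_trans p q) hK
    (fun x hx => fderiv_trans_mul' p q hx) (fun x hx => fderiv_trans_mul p q hx)
    (𝓕.isCoordFinsler_transDom p q).contDiffOn_sprayVec (𝓕.isCoordFinsler q).contDiffOn_sprayVec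
    (fun z hz => 𝓕.sprayVec_tangentLift p q hz) hz

end FinslerStructure

end

section

variable {n : ℕ}


variable {M : Type*} [TopologicalSpace M] [ChartedSpace (E n) M]

/-! ### Geodesics in arbitrary charts -/

/-- The curve `γ` read in the chart around `p`. -/
def readIn (p : M) (γ : ℝ → M) (t : ℝ) : E n := chartAt (E n) p (γ t)

/-- The position and the velocity of `γ` in the chart around `p`. -/
def jet (p : M) (γ : ℝ → M) (t : ℝ) : E n × E n := (readIn p γ t, deriv (readIn p γ) t)

section Curves

variable {γ : ℝ → M} {t : ℝ} {p q : M}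

theorem readIn_mem_transDom (hp : γ t ∈ (chartAt (E n) p).source)
    (hq : γ t ∈ (chartAt (E n) q).source) : readIn p γ t ∈ transDom (n := n) p q :=
  ⟨(chartAt (E n) p).map_source hp, by
    simpa only [mem_preimage, readIn, (chartAt (E n) p).left_inv hp] using hq⟩

theorem readIn_eventuallyEq (hγ : ContinuousAt γ t) (hp : γ t ∈ (chartAt (E n) p).source) :
    readIn q γ =ᶠ[𝓝 t] fun τ => trans (n := n) p q (readIn p γ τ) := by
  filter_upwards [hγ.preimage_mem_nhds ((chartAt (E n) p).open_source.mem_nhds hp)] with τ hτ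
  simp only [trans, readIn, (chartAt (E n) p).left_inv hτ]

variable [IsManifold (𝓡 n) ∞ M]

theorem contDiffAt_readIn (hγ : ContMDiffAt 𝓘(ℝ, ℝ) (𝓡 n) ∞ γ t)
    (hp : γ t ∈ (chartAt (E n) p).source) : ContDiffAt ℝ ∞ (readIn (n := n) p γ) t := by
  rw [← contMDiffAt_iff_contDiffAt]
  exact ((contMDiffOn_chart (I := 𝓡 n) (x := p)).contMDiffAt
    ((chartAt (E n) p).open_source.mem_nhds hp)).comp t hγ

theorem hasDerivAt_readIn (hγ : ContMDiffAt 𝓘(ℝ, ℝ) (𝓡 n) ∞ γ t)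
    (hp : γ t ∈ (chartAt (E n) p).source) :
    HasDerivAt (readIn (n := n) p γ) (deriv (readIn p γ) t) t :=
  ((contDiffAt_readIn hγ hp).differentiableAt (by simp)).hasDerivAt

theorem hasDerivAt_deriv_readIn (hγ : ContMDiffAt 𝓘(ℝ, ℝ) (𝓡 n) ∞ γ t)
    (hp : γ t ∈ (chartAt (E n) p).source) :
    HasDerivAt (deriv (readIn (n := n) p γ)) (deriv (deriv (readIn p γ)) t) t := by
  have h1 : ContDiffAt ℝ 1 (fderiv ℝ (readIn (n := n) p γ)) t :=
    (contDiffAt_readIn hγ hp).fderiv_right (by simpa [one_add_one_eq_two] using ENat.LEInfty.out)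
  have h2 : DifferentiableAt ℝ (fun t => fderiv ℝ (readIn (n := n) p γ) t 1) t :=
    (h1.differentiableAt (by simp)).clm_apply (differentiableAt_const _)
  exact h2.hasDerivAt

theorem deriv_readIn (hγ : ContMDiffAt 𝓘(ℝ, ℝ) (𝓡 n) ∞ γ t)
    (hp : γ t ∈ (chartAt (E n) p).source) (hq : γ t ∈ (chartAt (E n) q).source) :
    deriv (readIn (n := n) q γ) t =
      fderiv ℝ (trans p q) (readIn p γ t) (deriv (readIn p γ) t) := by
  rw [(readIn_eventuallyEq (q := q) hγ.continuousAt hp).deriv_eq]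
  exact ((differentiableAt_trans p q (readIn_mem_transDom hp hq)).hasFDerivAt.comp_hasDerivAt t
    (hasDerivAt_readIn hγ hp)).deriv

theorem jet_eq_tangentLift (hγ : ContMDiffAt 𝓘(ℝ, ℝ) (𝓡 n) ∞ γ t)
    (hp : γ t ∈ (chartAt (E n) p).source) (hq : γ t ∈ (chartAt (E n) q).source) :
    jet (n := n) q γ t = tangentLift (trans p q) (jet p γ t) :=
  Prod.ext (readIn_eventuallyEq hγ.continuousAt hp).eq_of_nhds (deriv_readIn hγ hp hq)

theorem eventually_mem (hγ : ContMDiffAt 𝓘(ℝ, ℝ) (𝓡 n) ∞ γ t)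
    (hp : γ t ∈ (chartAt (E n) p).source) :
    ∀ᶠ τ in 𝓝 t, γ τ ∈ (chartAt (E n) p).source :=
  hγ.continuousAt.preimage_mem_nhds ((chartAt (E n) p).open_source.mem_nhds hp)

theorem deriv_deriv_readIn {J : Set ℝ} (hJ : IsOpen J) (hγ : ContMDiffOn 𝓘(ℝ, ℝ) (𝓡 n) ∞ γ J)
    (ht : t ∈ J) (hp : γ t ∈ (chartAt (E n) p).source) (hq : γ t ∈ (chartAt (E n) q).source) :
    deriv (deriv (readIn (n := n) q γ)) t =
      fderiv ℝ (trans p q) (readIn p γ t) (deriv (deriv (readIn p γ)) t) +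
      fderiv ℝ (fderiv ℝ (trans p q)) (readIn p γ t) (deriv (readIn p γ) t)
        (deriv (readIn p γ) t) := by
  have hγt := hγ.contMDiffAt (hJ.mem_nhds ht)
  have h1 : deriv (readIn (n := n) q γ) =ᶠ[𝓝 t]
      fun τ => fderiv ℝ (trans p q) (readIn p γ τ) (deriv (readIn p γ) τ) := by
    filter_upwards [hJ.mem_nhds ht, eventually_mem hγt hp, eventually_mem hγt hq] with τ h1 h2 h3
    exact deriv_readIn (hγ.contMDiffAt (hJ.mem_nhds h1)) h2 h3
  have h2 := (hasFDerivAt_fderiv (isOpen_transDom p q) (contDiffOn_trans p q)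
    (readIn_mem_transDom hp hq)).comp_hasDerivAt t (hasDerivAt_readIn hγt hp)
  rw [h1.deriv_eq]
  exact (h2.clm_apply (hasDerivAt_deriv_readIn hγt hp)).deriv.trans (add_comm _ _)

end Curves

/-- A curve satisfying a smooth ordinary differential equation is smooth. -/
theorem contDiffOn_of_hasDerivAt {Z : Type*} [NormedAddCommGroup Z] [NormedSpace ℝ Z]
    [CompleteSpace Z] {V : Z → Z} {Ω : Set Z} (hV : ContDiffOn ℝ ∞ V Ω) {J : Set ℝ}
    (hJ : IsOpen J) {α : ℝ → Z} (hα : ∀ t ∈ J, HasDerivAt α (V (α t)) t)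
    (hmem : ∀ t ∈ J, α t ∈ Ω) : ContDiffOn ℝ ∞ α J := by
  intro t ht
  obtain ⟨ε, hε, hεJ⟩ := Metric.nhds_basis_closedBall.mem_iff.mp (hJ.mem_nhds ht)
  rw [Real.closedBall_eq_Icc] at hεJ
  have h1 : ContDiffOn ℝ ∞ α (Icc (t - ε) (t + ε)) :=
    ODE.contDiffOn_enat_Icc_of_hasDerivWithinAt (n := ⊤) (f := fun _ => V) (u := Ω)
      (ContDiffOn.comp hV contDiffOn_snd fun z hz => hz.2)
      (fun s hs => (hα s (hεJ hs)).hasDerivWithinAt) (fun s hs => hmem s (hεJ hs))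
  exact (h1.contDiffAt (Icc_mem_nhds (by linarith) (by linarith))).contDiffWithinAt

namespace FinslerStructure

variable [IsManifold (𝓡 n) ∞ M] (𝓕 : FinslerStructure n M)

/-- The geodesic equation at time `t`, in the chart around `p`. -/
def SolvesAt (p : M) (γ : ℝ → M) (t : ℝ) : Prop :=
  deriv (readIn (n := n) p γ) t ≠ 0 ∧
    deriv (deriv (readIn (n := n) p γ)) t = -sprayVec (𝓕.loc p) (jet p γ t)

variable {𝓕} {γ : ℝ → M} {J : Set ℝ} {t : ℝ} {p q : M}

/-- The second derivative of the change of coordinates enters the acceleration and the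
transformation law of the spray in the same way, and cancels. -/
theorem SolvesAt.change (hJ : IsOpen J) (hγ : ContMDiffOn 𝓘(ℝ, ℝ) (𝓡 n) ∞ γ J) (ht : t ∈ J)
    (hp : γ t ∈ (chartAt (E n) p).source) (hq : γ t ∈ (chartAt (E n) q).source)
    (h : 𝓕.SolvesAt p γ t) : 𝓕.SolvesAt q γ t := by
  have hγt := hγ.contMDiffAt (hJ.mem_nhds ht)
  have hmem := readIn_mem_transDom hp hq
  refine ⟨?_, ?_⟩
  · rw [deriv_readIn hγt hp hq]
    exact fun h0 => h.1 (fderiv_trans_injective p q hmem (h0.trans (map_zero _).symm))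
  · have h1 := 𝓕.sprayVec_tangentLift p q (z := jet p γ t) ⟨hmem, h.1⟩
    rw [deriv_deriv_readIn hJ hγ ht hp hq, jet_eq_tangentLift hγt hp hq, h1, h.2, map_neg, neg_sub,
      neg_add_eq_sub]
    rfl

theorem IsGeodesicOn.solvesAt (h : 𝓕.IsGeodesicOn γ J) (hJ : IsOpen J) (ht : t ∈ J)
    (hp : γ t ∈ (chartAt (E n) p).source) : 𝓕.SolvesAt p γ t := by
  refine SolvesAt.change (p := γ t) hJ h.smooth ht (mem_chart_source _ _) hp ⟨h.regular t ht, ?_⟩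
  ext i
  exact eq_neg_of_add_eq_zero_left (h.equation t ht i)

theorem IsGeodesicOn.of_solvesAt (hJ : IsOpen J) (hγ : ContMDiffOn 𝓘(ℝ, ℝ) (𝓡 n) ∞ γ J)
    (h : ∀ t ∈ J, ∃ p, γ t ∈ (chartAt (E n) p).source ∧ 𝓕.SolvesAt p γ t) :
    𝓕.IsGeodesicOn γ J := by
  have key : ∀ t ∈ J, 𝓕.SolvesAt (γ t) γ t := fun t ht => by
    obtain ⟨p, hp, hs⟩ := h t ht
    exact hs.change hJ hγ ht hp (mem_chart_source _ _)
  refine ⟨hγ, fun t ht => (key t ht).1, fun t ht i => ?_⟩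
  exact add_eq_zero_iff_eq_neg.mpr (congrArg (fun w : E n => w i) (key t ht).2)

theorem IsGeodesicOn.contMDiffAt (h : 𝓕.IsGeodesicOn γ J) (hJ : IsOpen J) (ht : t ∈ J) :
    ContMDiffAt 𝓘(ℝ, ℝ) (𝓡 n) ∞ γ t := h.smooth.contMDiffAt (hJ.mem_nhds ht)

theorem IsGeodesicOn.mono {J' : Set ℝ} (h : 𝓕.IsGeodesicOn γ J) (hJ' : J' ⊆ J) :
    𝓕.IsGeodesicOn γ J' :=
  ⟨h.smooth.mono hJ', fun t ht => h.regular t (hJ' ht), fun t ht => h.equation t (hJ' ht)⟩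

theorem IsGeodesicOn.jet_mem (h : 𝓕.IsGeodesicOn γ J) (hJ : IsOpen J) (ht : t ∈ J)
    (hp : γ t ∈ (chartAt (E n) p).source) : jet p γ t ∈ slit (chartAt (E n) p).target :=
  ⟨(chartAt (E n) p).map_source hp, (h.solvesAt hJ ht hp).1⟩

theorem IsGeodesicOn.hasDerivAt_jet (h : 𝓕.IsGeodesicOn γ J) (hJ : IsOpen J) (ht : t ∈ J)
    (hp : γ t ∈ (chartAt (E n) p).source) :
    HasDerivAt (jet p γ) ((jet p γ t).2, -sprayVec (𝓕.loc p) (jet p γ t)) t := by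
  have hγt := h.contMDiffAt hJ ht
  rw [← (h.solvesAt hJ ht hp).2]
  exact (hasDerivAt_readIn hγt hp).prodMk (hasDerivAt_deriv_readIn hγt hp)

theorem IsGeodesicOn.ricciAlong_eq (h : 𝓕.IsGeodesicOn γ J) (hJ : IsOpen J) (ht : t ∈ J)
    (hp : γ t ∈ (chartAt (E n) p).source) :
    𝓕.ricciAlong γ t = ricScalar (𝓕.loc p) (jet p γ t).1 (jet p γ t).2 := by
  have h1 := (𝓕.isCoordFinsler (γ t)).sum_sum_ricci (h.jet_mem hJ ht (mem_chart_source _ _))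
  have h2 := 𝓕.ricScalar_tangentLift p (γ t) (z := jet p γ t)
    ⟨readIn_mem_transDom hp (mem_chart_source _ _), (h.solvesAt hJ ht hp).1⟩
  rw [← jet_eq_tangentLift (h.contMDiffAt hJ ht) hp (mem_chart_source _ _)] at h2
  rw [← h2, ← h1]
  rfl

theorem IsGeodesicOn.speed_eq (h : 𝓕.IsGeodesicOn γ J) (hJ : IsOpen J) (ht : t ∈ J)
    (hp : γ t ∈ (chartAt (E n) p).source) :
    𝓕.loc (γ t) (coordCurve (n := n) γ t t) (velocity (n := n) γ t) =
      𝓕.loc p (jet p γ t).1 (jet p γ t).2 := by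
  rw [← 𝓕.loc_tangentLift p (γ t) (z := jet p γ t)
    (readIn_mem_transDom hp (mem_chart_source _ _)),
    ← jet_eq_tangentLift (h.contMDiffAt hJ ht) hp (mem_chart_source _ _)]
  rfl

/-- A function along a geodesic which is locally a first integral is constant. -/
theorem IsGeodesicOn.eq_of_firstIntegral (h : 𝓕.IsGeodesicOn γ J) (hJ : IsOpen J)
    (hJ' : J.OrdConnected) {f : ℝ → ℝ} {u : M → E n → E n → ℝ}
    (hu : ∀ p, SmoothOn (chartAt (E n) p).target (u p))
    (hfu : ∀ t ∈ J, ∀ p, γ t ∈ (chartAt (E n) p).source →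
      f t = u p (jet p γ t).1 (jet p γ t).2)
    (hint : ∀ p, ∀ z ∈ slit (chartAt (E n) p).target,
      fderiv ℝ (Function.uncurry (u p)) z (z.2, -sprayVec (𝓕.loc p) z) = 0)
    {s t : ℝ} (hs : s ∈ J) (ht : t ∈ J) : f s = f t := by
  have key : ∀ t ∈ J, HasDerivAt f 0 t := by
    intro t ht
    have hp := mem_chart_source (E n) (γ t)
    have hz := h.jet_mem hJ ht hp
    have h1 := ((hu (γ t)).hasFDerivAt (chartAt (E n) (γ t)).open_target hz).comp_hasDerivAt t
      (h.hasDerivAt_jet hJ ht hp)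
    rw [hint _ _ hz] at h1
    refine h1.congr_of_eventuallyEq ?_
    filter_upwards [hJ.mem_nhds ht, eventually_mem (h.contMDiffAt hJ ht) hp] with τ h1 h2 using
      hfu τ h1 _ h2
  exact hJ.is_const_of_deriv_eq_zero (isPreconnected_iff_ordConnected.mpr hJ')
    (fun t ht => (key t ht).differentiableAt.differentiableWithinAt)
    (fun t ht => (key t ht).deriv) hs ht

theorem IsGeodesicOn.speed_const (h : 𝓕.IsGeodesicOn γ J) (hJ : IsOpen J) (hJ' : J.OrdConnected)
    {s t : ℝ} (hs : s ∈ J) (ht : t ∈ J) :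
    𝓕.loc (γ s) (coordCurve (n := n) γ s s) (velocity (n := n) γ s) =
      𝓕.loc (γ t) (coordCurve (n := n) γ t t) (velocity (n := n) γ t) := by
  have h1 := h.eq_of_firstIntegral hJ hJ' (f := fun t => (𝓕.loc (γ t)
    (coordCurve (n := n) γ t t) (velocity (n := n) γ t)) ^ 2) (u := fun p => sqr (𝓕.loc p))
    (fun p => (𝓕.isCoordFinsler p).smooth_sqr)
    (fun t ht p hp => by rw [h.speed_eq hJ ht hp, sqr])
    (fun p z hz => (𝓕.isCoordFinsler p).fderiv_energy_spray hz) hs ht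
  exact (sq_eq_sq₀ (𝓕.nonneg _) (𝓕.nonneg _)).mp h1

/-- The Ricci scalar is a first integral of the geodesic flow. -/
def RicciFirstIntegral (𝓕 : FinslerStructure n M) : Prop :=
  ∀ p, ∀ z ∈ slit (chartAt (E n) p).target,
    fderiv ℝ (Function.uncurry (ricScalar (𝓕.loc p))) z (z.2, -sprayVec (𝓕.loc p) z) = 0

theorem ricciFirstIntegral (h : 𝓕.BerwaldHorParallel ∨ 𝓕.ChernHorParallel) :
    𝓕.RicciFirstIntegral := by
  intro p z hz
  have hF := 𝓕.isCoordFinsler p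
  rcases h with h | h
  · exact hF.fderiv_ricScalar_spray hz (hF.berwald_contract hz) (h p _ hz.1 _ hz.2)
  · exact hF.fderiv_ricScalar_spray hz (hF.chern_contract hz) (h p _ hz.1 _ hz.2)

theorem IsGeodesicOn.ricciAlong_const (h : 𝓕.IsGeodesicOn γ J) (hR : 𝓕.RicciFirstIntegral)
    (hJ : IsOpen J) (hJ' : J.OrdConnected) {s t : ℝ} (hs : s ∈ J) (ht : t ∈ J) :
    𝓕.ricciAlong γ s = 𝓕.ricciAlong γ t :=
  h.eq_of_firstIntegral hJ hJ' (u := fun p => ricScalar (𝓕.loc p))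
    (fun p => (𝓕.isCoordFinsler p).smooth_ricScalar)
    (fun _ ht _ hp => h.ricciAlong_eq hJ ht hp) hR hs ht

/-! ### Affine changes of the parameter -/

theorem deriv_comp_affine {W : Type*} [NormedAddCommGroup W] [NormedSpace ℝ W] (f : ℝ → W)
    (a b : ℝ) : deriv (fun t => f (a * t + b)) = fun t => a • deriv f (a * t + b) := by
  funext t
  have h1 := deriv_comp_mul_left a (fun s => f (s + b)) t
  rw [h1, deriv_comp_add_const]

theorem jet_comp_affine (a b : ℝ) :
    jet (n := n) p (fun t => γ (a * t + b)) t =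
      ((jet p γ (a * t + b)).1, a • (jet p γ (a * t + b)).2) :=
  Prod.ext rfl (congrFun (deriv_comp_affine (readIn p γ) a b) t)

/-- Quadratic scaling of the spray is a separate hypothesis because F is only positively
homogeneous: it is automatic for a > 0, while a = -1 becomes available once the spray is that of a
Riemannian metric. -/
theorem IsGeodesicOn.comp_affine (h : 𝓕.IsGeodesicOn γ J) (hJ : IsOpen J) {a : ℝ} (ha : a ≠ 0)
    (b : ℝ) (hscale : ∀ p, ∀ z ∈ slit (chartAt (E n) p).target,
      sprayVec (𝓕.loc p) (z.1, a • z.2) = a ^ 2 • sprayVec (𝓕.loc p) z) :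
    𝓕.IsGeodesicOn (fun t => γ (a * t + b)) {t | a * t + b ∈ J} := by
  have haff : ContDiff ℝ ∞ (fun t : ℝ => a * t + b) := by fun_prop
  refine IsGeodesicOn.of_solvesAt (hJ.preimage haff.continuous)
    (h.smooth.comp haff.contMDiff.contMDiffOn fun t ht => ht) fun t ht =>
    ⟨γ (a * t + b), mem_chart_source _ _, ?_⟩
  have hp := mem_chart_source (E n) (γ (a * t + b))
  have h1 := h.solvesAt hJ ht hp
  have h2 : readIn (n := n) (γ (a * t + b)) (fun t => γ (a * t + b)) =
    fun t' => readIn (γ (a * t + b)) γ (a * t' + b) := rfl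
  refine ⟨?_, ?_⟩
  · rw [h2, deriv_comp_affine]
    exact smul_ne_zero ha h1.1
  · rw [jet_comp_affine, hscale _ _ (h.jet_mem hJ ht hp), h2, deriv_comp_affine,
      deriv_fun_const_smul_field, congrFun (deriv_comp_affine (deriv (readIn (γ (a * t + b)) γ)) a b) t]
    beta_reduce
    rw [h1.2]
    simp only [smul_neg, smul_smul, pow_two]

theorem IsGeodesicOn.comp_affine_of_pos (h : 𝓕.IsGeodesicOn γ J) (hJ : IsOpen J) {a : ℝ}
    (ha : 0 < a) (b : ℝ) : 𝓕.IsGeodesicOn (fun t => γ (a * t + b)) {t | a * t + b ∈ J} :=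
  h.comp_affine hJ ha.ne' b fun p _ hz => (𝓕.isCoordFinsler p).sprayVec_smul hz ha

/-- Solutions of the geodesic equation in a chart are geodesics. -/
theorem isGeodesicOn_of_hasDerivAt (p : M) (hJ : IsOpen J) {α : ℝ → E n × E n}
    (hmem : ∀ t ∈ J, α t ∈ slit (chartAt (E n) p).target)
    (hα : ∀ t ∈ J, HasDerivAt α ((α t).2, -sprayVec (𝓕.loc p) (α t)) t) :
    𝓕.IsGeodesicOn (fun t => (chartAt (E n) p).symm (α t).1) J ∧
      ∀ t ∈ J, jet p (fun t => (chartAt (E n) p).symm (α t).1) t = α t := by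
  have hV : ContDiffOn ℝ ∞ (fun z : E n × E n => (z.2, -sprayVec (𝓕.loc p) z))
      (slit (chartAt (E n) p).target) :=
    contDiffOn_snd.prodMk (𝓕.isCoordFinsler p).contDiffOn_sprayVec.neg
  have h1 : ContDiffOn ℝ ∞ α J := contDiffOn_of_hasDerivAt hV hJ hα hmem
  have h2 : ContDiffOn ℝ ∞ (fun t => (α t).1) J := contDiff_fst.comp_contDiffOn h1
  have hread : ∀ t ∈ J, readIn p (fun t => (chartAt (E n) p).symm (α t).1) t = (α t).1 :=
    fun t ht => (chartAt (E n) p).right_inv (hmem t ht).1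
  have hread' : ∀ t ∈ J, readIn p (fun t => (chartAt (E n) p).symm (α t).1) =ᶠ[𝓝 t]
      fun t => (α t).1 := fun t ht => by
    filter_upwards [hJ.mem_nhds ht] with τ hτ using hread τ hτ
  have hd1 : ∀ t ∈ J, HasDerivAt (fun t => (α t).1) (α t).2 t := fun t ht =>
    (hasFDerivAt_fst (𝕜 := ℝ) (p := α t)).comp_hasDerivAt t (hα t ht)
  have hd2 : ∀ t ∈ J, HasDerivAt (fun t => (α t).2) (-sprayVec (𝓕.loc p) (α t)) t := fun t ht =>
    (hasFDerivAt_snd (𝕜 := ℝ) (p := α t)).comp_hasDerivAt t (hα t ht)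
  have hder : ∀ t ∈ J, deriv (readIn p (fun t => (chartAt (E n) p).symm (α t).1)) t = (α t).2 :=
    fun t ht => by rw [(hread' t ht).deriv_eq, (hd1 t ht).deriv]
  have hjet : ∀ t ∈ J, jet p (fun t => (chartAt (E n) p).symm (α t).1) t = α t := fun t ht =>
    Prod.ext (hread t ht) (hder t ht)
  refine ⟨IsGeodesicOn.of_solvesAt hJ ?_ fun t ht => ⟨p, ?_, ?_, ?_⟩, hjet⟩
  · exact (contMDiffOn_chart_symm (I := 𝓡 n) (x := p)).comp h2.contMDiffOn
      fun t ht => (hmem t ht).1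
  · exact (chartAt (E n) p).map_target (hmem t ht).1
  · rw [hder t ht]
    exact (hmem t ht).2
  · have : deriv (readIn p (fun t => (chartAt (E n) p).symm (α t).1)) =ᶠ[𝓝 t]
        fun t => (α t).2 := by
      filter_upwards [hJ.mem_nhds ht] with τ hτ using hder τ hτ
    rw [this.deriv_eq, (hd2 t ht).deriv, hjet t ht]

end FinslerStructure

end

section

variable {n : ℕ}


/-! ### Projective parameters of constant negative curvature -/

theorem abs_le_abs_of_linear_ne_zero {m r : ℝ} (h : ∀ c ∈ Ioo (-1 : ℝ) 1, m * c + r ≠ 0) :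
    |m| ≤ |r| := by
  by_contra! hlt
  have hm : m ≠ 0 := by
    rintro rfl
    exact absurd hlt (by simp)
  refine h (-r / m) (abs_lt.mp ?_) (by field_simp; ring)
  rw [abs_div, abs_neg, div_lt_one (abs_pos.mpr hm)]
  exact hlt

/-- A linear function without zeros on (-1, 1) is, up to sign, a nonnegative combination of 1 + c
and 1 - c, so its quotient by 1 + c does not increase. -/
theorem linear_mul_le {m r a b : ℝ} (h : ∀ c ∈ Ioo (-1 : ℝ) 1, m * c + r ≠ 0) (hab : a ≤ b)
    (ha : a ∈ Ioo (-1 : ℝ) 1) (hb : b ∈ Ioo (-1 : ℝ) 1) :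
    |m * b + r| * (1 + a) ≤ |m * a + r| * (1 + b) := by
  have hmr := abs_le_abs_of_linear_ne_zero h
  have hr : r ≠ 0 := by simpa using h 0 (by norm_num)
  wlog hpos : 0 < r generalizing m r with H
  · have := H (m := -m) (r := -r) (fun c hc h0 => h c hc (by linarith)) (by simpa using hmr)
      (neg_ne_zero.mpr hr) (by have := lt_of_le_of_ne (not_lt.mp hpos) hr; linarith)
    rwa [show -m * b + -r = -(m * b + r) by ring, show -m * a + -r = -(m * a + r) by ring,
      abs_neg, abs_neg] at this
  rw [abs_of_pos hpos, abs_le] at hmr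
  have hnn : ∀ c ∈ Ioo (-1 : ℝ) 1, 0 ≤ m * c + r := fun c hc => by
    rcases le_total 0 m with hm | hm
    · nlinarith [hc.1]
    · nlinarith [hc.2]
  rw [abs_of_nonneg (hnn a ha), abs_of_nonneg (hnn b hb)]
  nlinarith [mul_nonneg (sub_nonneg.mpr hmr.2) (sub_nonneg.mpr hab)]

theorem log_linear_le {m r a b : ℝ} (h : ∀ c ∈ Ioo (-1 : ℝ) 1, m * c + r ≠ 0) (hab : a ≤ b)
    (ha : a ∈ Ioo (-1 : ℝ) 1) (hb : b ∈ Ioo (-1 : ℝ) 1) :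
    Real.log (m * b + r) - Real.log (m * a + r) ≤ Real.log (1 + b) - Real.log (1 + a) := by
  have h1 : (0 : ℝ) < 1 + a := by linarith [ha.1]
  have h2 : (0 : ℝ) < 1 + b := by linarith [hb.1]
  have h3 := Real.log_le_log (mul_pos (abs_pos.mpr (h b hb)) h1) (linear_mul_le h hab ha hb)
  rw [Real.log_mul (abs_pos.mpr (h b hb)).ne' h1.ne', Real.log_mul (abs_pos.mpr (h a ha)).ne' h2.ne',
    Real.log_abs, Real.log_abs] at h3
  linarith

theorem le_log_linear {m r a b : ℝ} (h : ∀ c ∈ Ioo (-1 : ℝ) 1, m * c + r ≠ 0) (hab : a ≤ b)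
    (ha : a ∈ Ioo (-1 : ℝ) 1) (hb : b ∈ Ioo (-1 : ℝ) 1) :
    Real.log (1 - b) - Real.log (1 - a) ≤ Real.log (m * b + r) - Real.log (m * a + r) := by
  have := log_linear_le (m := -m) (r := r) (a := -b) (b := -a)
    (fun c hc => by simpa using h (-c) ⟨by linarith [hc.2], by linarith [hc.1]⟩)
    (by linarith) ⟨by linarith [hb.2], by linarith [hb.1]⟩ ⟨by linarith [ha.2], by linarith [ha.1]⟩
  rw [neg_mul_neg, neg_mul_neg, ← sub_eq_add_neg, ← sub_eq_add_neg] at this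
  linarith

theorem poincare_eq {a b : ℝ} (ha : a ∈ Ioo (-1 : ℝ) 1) (hb : b ∈ Ioo (-1 : ℝ) 1) :
    poincare a b =
      |(Real.log (1 + b) - Real.log (1 + a)) - (Real.log (1 - b) - Real.log (1 - a))| := by
  have h1 : 1 + a ≠ 0 := by linarith [ha.1]
  have h2 : 1 + b ≠ 0 := by linarith [hb.1]
  have h3 : 1 - a ≠ 0 := by linarith [ha.2]
  have h4 : 1 - b ≠ 0 := by linarith [hb.2]
  rw [poincare, Real.log_div (mul_ne_zero h3 h2) (mul_ne_zero h4 h1), Real.log_mul h3 h2,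
    Real.log_mul h4 h1]
  congr 1
  ring

theorem poincare_comm {a b : ℝ} (ha : a ∈ Ioo (-1 : ℝ) 1) (hb : b ∈ Ioo (-1 : ℝ) 1) :
    poincare a b = poincare b a := by
  rw [poincare_eq ha hb, poincare_eq hb ha, ← abs_neg]
  congr 1
  ring

theorem poincare_nonneg (a b : ℝ) : 0 ≤ poincare a b := abs_nonneg _

theorem poincare_self {a : ℝ} (ha : a ∈ Ioo (-1 : ℝ) 1) : poincare a a = 0 := by
  rw [poincare_eq ha ha]
  simp

/-- The increments of the logarithms of both linear functions lie between those of log(1 - c) and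
log(1 + c), and the difference of these two extremes is the Poincaré distance. -/
theorem le_poincare_of_linear {m r m' r' a b : ℝ} (h : ∀ c ∈ Ioo (-1 : ℝ) 1, m * c + r ≠ 0)
    (h' : ∀ c ∈ Ioo (-1 : ℝ) 1, m' * c + r' ≠ 0)
    (ha : a ∈ Ioo (-1 : ℝ) 1) (hb : b ∈ Ioo (-1 : ℝ) 1) :
    |(Real.log (m * b + r) - Real.log (m * a + r)) -
      (Real.log (m' * b + r') - Real.log (m' * a + r'))| ≤ poincare a b := by
  wlog hab : a ≤ b generalizing a b with H
  · have := H hb ha (le_of_not_ge hab)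
    rw [poincare_comm ha hb]
    rw [← abs_neg]
    refine le_trans (le_of_eq ?_) this
    congr 1
    ring
  rw [poincare_eq ha hb]
  have h1 := log_linear_le h hab ha hb
  have h2 := log_linear_le h' hab ha hb
  have h3 := le_log_linear h hab ha hb
  have h4 := le_log_linear h' hab ha hb
  refine le_trans ?_ (le_abs_self _)
  rw [abs_le]
  constructor <;> linarith

/-- A Schwarz lemma. For {p, s} = -2k² the functions w = |p'|^(-1/2) and p w both solve x'' = k² x,
so for c = ±k the expressions (c x + x') exp(-cs) are constant for x = w and x = p w. Eliminating
shows that p' w exp(-cs) is a linear function of p. The two linear functions obtained have no zeros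
on (-1, 1), since p is onto, and their quotient is exp(2ks); `le_poincare_of_linear` compares the
logarithms. -/
theorem two_mul_abs_sub_le_poincare {J : Set ℝ} (hJ : IsOpen J) (hJ' : J.OrdConnected) {p : ℝ → ℝ}
    (hp : ContDiffOn ℝ ∞ p J) (hne : ∀ s ∈ J, deriv p s ≠ 0) {k : ℝ}
    (hS : ∀ s ∈ J, schwarzian p s = -2 * k ^ 2) (himage : p '' J = Ioo (-1) 1) {s t : ℝ}
    (hs : s ∈ J) (ht : t ∈ J) : 2 * k * |s - t| ≤ poincare (p s) (p t) := by
  have hd1 := hp.deriv_of_isOpen (m := ∞) hJ (by simp)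
  have hd2 := hd1.deriv_of_isOpen (m := ∞) hJ (by simp)
  have D : ∀ {f : ℝ → ℝ}, ContDiffOn ℝ ∞ f J → ∀ s ∈ J, HasDerivAt f (deriv f s) s :=
    fun {f} hf s hs => ((hf.contDiffAt (hJ.mem_nhds hs)).differentiableAt (by simp)).hasDerivAt
  -- `Real.log` is the logarithm of the absolute value, so w = |p'|^(-1/2) for either sign of p',
  -- and q = p''/p' satisfies w' = -q w/2 and a Riccati equation.
  set w : ℝ → ℝ := fun s => Real.exp (-(1 / 2) * Real.log (deriv p s)) with hw
  set q : ℝ → ℝ := fun s => deriv (deriv p) s / deriv p s with hq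
  have hwpos : ∀ s, 0 < w s := fun s => Real.exp_pos _
  have Dw : ∀ s ∈ J, HasDerivAt w (w s * (-(1 / 2) * q s)) s := fun s hs =>
    (((D hd1 s hs).log (hne s hs)).const_mul (-(1 / 2))).exp
  have Dq : ∀ s ∈ J, HasDerivAt q (q s ^ 2 / 2 - 2 * k ^ 2) s := fun s hs => by
    have h1 := (D hd2 s hs).div (D hd1 s hs) (hne s hs)
    have h2 := hS s hs
    simp only [schwarzian, iteratedDeriv_succ, iteratedDeriv_zero] at h2
    refine h1.congr_deriv ?_
    have h3 : deriv (deriv (deriv p)) s / deriv p s = 3 / 2 * q s ^ 2 - 2 * k ^ 2 := by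
      rw [hq]; linarith
    have h4 : deriv (deriv (deriv p)) s = (3 / 2 * q s ^ 2 - 2 * k ^ 2) * deriv p s := by
      rw [← h3, div_mul_cancel₀ _ (hne s hs)]
    have h5 : deriv (deriv p) s = q s * deriv p s := by
      rw [hq, div_mul_cancel₀ _ (hne s hs)]
    rw [h4, h5]
    have := hne s hs
    field_simp
    ring
  have Dp2 : ∀ s ∈ J, HasDerivAt (deriv p) (q s * deriv p s) s := fun s hs => by
    have := D hd1 s hs
    rwa [show deriv (deriv p) s = q s * deriv p s by
      rw [hq, div_mul_cancel₀ _ (hne s hs)]] at this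
  have De : ∀ (c s : ℝ), HasDerivAt (fun s => Real.exp (c * s)) (Real.exp (c * s) * c) s :=
    fun c s => by simpa using ((hasDerivAt_id s).const_mul c).exp
  -- the two families of first integrals
  have hα : ∀ c : ℝ, c ^ 2 = k ^ 2 → ∀ s ∈ J,
      HasDerivAt (fun s => w s * (c - q s / 2) * Real.exp (-c * s)) 0 s := by
    intro c hc s hs
    have h1 := ((Dw s hs).mul (((Dq s hs).div_const 2).const_sub c)).mul (De (-c) s)
    refine h1.congr_deriv ?_
    rw [← hc]
    try simp only [Pi.mul_apply]
    ring
  have hγ : ∀ c : ℝ, c ^ 2 = k ^ 2 → ∀ s ∈ J, HasDerivAt (fun s =>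
      p s * (w s * (c - q s / 2) * Real.exp (-c * s)) + deriv p s * w s * Real.exp (-c * s)) 0 s := by
    intro c hc s hs
    have h1 := ((D hp s hs).mul (hα c hc s hs)).add
      (((Dp2 s hs).mul (Dw s hs)).mul (De (-c) s))
    refine h1.congr_deriv ?_
    try simp only [Pi.mul_apply]
    ring
  have hconst : ∀ {f : ℝ → ℝ}, (∀ s ∈ J, HasDerivAt f 0 s) → ∀ r ∈ J, f r = f s := fun hf r hr =>
    hJ.is_const_of_deriv_eq_zero (isPreconnected_iff_ordConnected.mpr hJ')
      (fun t ht => (hf t ht).differentiableAt.differentiableWithinAt)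
      (fun t ht => (hf t ht).deriv) hr hs
  -- `-p' w exp (-c s)` is a linear function of `p`
  have hlin : ∀ c : ℝ, c ^ 2 = k ^ 2 → ∃ m r : ℝ, ∀ s ∈ J,
      m * p s + r = deriv p s * w s * Real.exp (-c * s) := by
    intro c hc
    refine ⟨-(w s * (c - q s / 2) * Real.exp (-c * s)), p s * (w s * (c - q s / 2) *
      Real.exp (-c * s)) + deriv p s * w s * Real.exp (-c * s), fun r hr => ?_⟩
    have h1 := hconst (hα c hc) r hr
    have h2 := hconst (hγ c hc) r hr
    rw [← h2, ← h1]
    ring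
  have hnz : ∀ (c : ℝ) (r : ℝ), r ∈ J → deriv p r * w r * Real.exp (-c * r) ≠ 0 := fun c r hr =>
    mul_ne_zero (mul_ne_zero (hne r hr) (hwpos r).ne') (Real.exp_pos _).ne'
  obtain ⟨m, e, h1⟩ := hlin k rfl
  obtain ⟨m', r', h2⟩ := hlin (-k) (by ring)
  -- Surjectivity onto (-1, 1) enters here: absence of zeros along the curve becomes absence of
  -- zeros on the whole interval.
  have hn1 : ∀ c ∈ Ioo (-1 : ℝ) 1, m * c + e ≠ 0 := fun c hc => by
    obtain ⟨s, hs, rfl⟩ := himage.symm ▸ hc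
    rw [h1 s hs]; exact hnz k s hs
  have hn2 : ∀ c ∈ Ioo (-1 : ℝ) 1, m' * c + r' ≠ 0 := fun c hc => by
    obtain ⟨s, hs, rfl⟩ := himage.symm ▸ hc
    rw [h2 s hs]; exact hnz (-k) s hs
  have hps : p s ∈ Ioo (-1 : ℝ) 1 := himage ▸ mem_image_of_mem p hs
  have hpt : p t ∈ Ioo (-1 : ℝ) 1 := himage ▸ mem_image_of_mem p ht
  have h3 := le_poincare_of_linear hn1 hn2 hps hpt
  have hlog : ∀ r ∈ J, Real.log (m' * p r + r') = Real.log (m * p r + e) + 2 * k * r := fun u hu => by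
    have : m' * p u + r' = (m * p u + e) * Real.exp (2 * k * u) := by
      rw [h1 u hu, h2 u hu, mul_assoc _ (Real.exp (-k * u)), ← Real.exp_add]
      congr 2
      ring
    rw [this, Real.log_mul (by rw [h1 u hu]; exact hnz k u hu) (Real.exp_pos _).ne', Real.log_exp]
  rw [hlog s hs, hlog t ht] at h3
  refine le_trans ?_ h3
  rw [show Real.log (m * p t + e) - Real.log (m * p s + e) -
    (Real.log (m * p t + e) + 2 * k * t - (Real.log (m * p s + e) + 2 * k * s)) =
    2 * k * (s - t) by ring, abs_mul]
  exact mul_le_mul_of_nonneg_right (le_abs_self _) (abs_nonneg _)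

theorem schwarzian_eq {p p₁ p₂ : ℝ → ℝ} {s p₃ : ℝ} (h1 : ∀ s, HasDerivAt p (p₁ s) s)
    (h2 : ∀ s, HasDerivAt p₁ (p₂ s) s) (h3 : HasDerivAt p₂ p₃ s) :
    schwarzian p s = p₃ / p₁ s - 3 / 2 * (p₂ s / p₁ s) ^ 2 := by
  have e1 : deriv p = p₁ := funext fun s => (h1 s).deriv
  have e2 : deriv p₁ = p₂ := funext fun s => (h2 s).deriv
  simp only [schwarzian, iteratedDeriv_succ, iteratedDeriv_zero, e1, e2, h3.deriv]

theorem hasDerivAt_exp_mul (k s : ℝ) :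
    HasDerivAt (fun s => Real.exp (k * s)) (k * Real.exp (k * s)) s := by
  simpa [mul_comm] using ((hasDerivAt_id s).const_mul k).exp

theorem schwarzian_exp {A k : ℝ} (hA : A ≠ 0) (hk : k ≠ 0) (B s : ℝ) :
    schwarzian (fun s => A * Real.exp (2 * k * s) + B) s = -2 * k ^ 2 := by
  rw [schwarzian_eq (p₁ := fun s => A * (2 * k * Real.exp (2 * k * s)))
    (p₂ := fun s => A * (2 * k * (2 * k * Real.exp (2 * k * s))))
    (fun s => ((hasDerivAt_exp_mul (2 * k) s).const_mul A).add_const B)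
    (fun s => ((hasDerivAt_exp_mul (2 * k) s).const_mul (2 * k)).const_mul A)
    (((hasDerivAt_exp_mul (2 * k) s).const_mul (2 * k)).const_mul (2 * k) |>.const_mul A)]
  have := (Real.exp_pos (2 * k * s)).ne'
  field_simp
  ring

/-- The projective parameter `tanh (k s)`. -/
def tanhParam (k s : ℝ) : ℝ := 1 - 2 / (Real.exp (2 * k * s) + 1)

theorem one_sub_tanhParam (k s : ℝ) : 1 - tanhParam k s = 2 / (Real.exp (2 * k * s) + 1) := by
  rw [tanhParam]; ring

theorem one_add_tanhParam (k s : ℝ) :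
    1 + tanhParam k s = 2 / (Real.exp (2 * k * s) + 1) * Real.exp (2 * k * s) := by
  have := Real.exp_pos (2 * k * s)
  rw [tanhParam]; field_simp; ring

theorem tanhParam_mem (k s : ℝ) : tanhParam k s ∈ Ioo (-1 : ℝ) 1 := by
  have h := Real.exp_pos (2 * k * s)
  have h1 : 0 < 1 - tanhParam k s := by rw [one_sub_tanhParam]; positivity
  have h2 : 0 < 1 + tanhParam k s := by rw [one_add_tanhParam]; positivity
  exact ⟨by linarith, by linarith⟩

theorem hasDerivAt_tanhParam (k s : ℝ) :
    HasDerivAt (tanhParam k) (k * (1 - tanhParam k s ^ 2)) s := by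
  have h := Real.exp_pos (2 * k * s)
  have h1 := (((hasDerivAt_exp_mul (2 * k) s).add_const 1).inv (by positivity)).const_mul 2
    |>.const_sub 1
  refine h1.congr_deriv ?_
  rw [show 1 - tanhParam k s ^ 2 = (1 - tanhParam k s) * (1 + tanhParam k s) by ring,
    one_sub_tanhParam, one_add_tanhParam]
  field_simp

theorem contDiff_tanhParam (k : ℝ) : ContDiff ℝ ∞ (tanhParam k) := by
  refine contDiff_const.sub (contDiff_const.div ?_ fun s => (by positivity))
  fun_prop

theorem deriv_tanhParam_ne {k : ℝ} (hk : k ≠ 0) (s : ℝ) : deriv (tanhParam k) s ≠ 0 := by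
  rw [(hasDerivAt_tanhParam k s).deriv]
  have := tanhParam_mem k s
  exact mul_ne_zero hk (by nlinarith [this.1, this.2])

theorem schwarzian_tanhParam {k : ℝ} (hk : k ≠ 0) (s : ℝ) :
    schwarzian (tanhParam k) s = -2 * k ^ 2 := by
  have D := hasDerivAt_tanhParam k
  have hne := deriv_tanhParam_ne hk s
  rw [(D s).deriv] at hne
  have D2 : ∀ s, HasDerivAt (fun s => k * (1 - tanhParam k s ^ 2))
      (-2 * k * tanhParam k s * (k * (1 - tanhParam k s ^ 2))) s := fun s => by
    refine ((((D s).pow 2).const_sub 1).const_mul k).congr_deriv ?_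
    simp; ring
  have D3 := ((D s).const_mul (-2 * k)).mul (D2 s)
  rw [schwarzian_eq D D2 D3]
  have : 1 - tanhParam k s ^ 2 ≠ 0 := right_ne_zero_of_mul hne
  field_simp
  ring

/-- Here log((1 + p)/(1 - p)) = 2ks: this is the equality case of the Schwarz lemma, available only
for a geodesic defined on the whole line. -/
theorem poincare_tanhParam {k : ℝ} (hk : 0 < k) (s t : ℝ) :
    poincare (tanhParam k s) (tanhParam k t) = 2 * k * |s - t| := by
  have key : ∀ s, Real.log (1 + tanhParam k s) = Real.log (1 - tanhParam k s) + 2 * k * s :=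
    fun s => by
      rw [one_add_tanhParam, one_sub_tanhParam,
        Real.log_mul (by positivity) (Real.exp_pos _).ne', Real.log_exp]
  rw [poincare_eq (tanhParam_mem k s) (tanhParam_mem k t), key, key, abs_sub_comm s t,
    ← abs_of_pos (show 0 < 2 * k by positivity), ← abs_mul, abs_of_pos (show 0 < 2 * k by positivity)]
  congr 1
  ring

theorem image_tanhParam {k : ℝ} (hk : k ≠ 0) : tanhParam k '' univ = Ioo (-1) 1 := by
  refine Subset.antisymm (by rintro _ ⟨s, -, rfl⟩; exact tanhParam_mem k s) fun c hc => ?_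
  have h1 : 0 < 1 + c := by linarith [hc.1]
  have h2 : 0 < 1 - c := by linarith [hc.2]
  refine ⟨Real.log ((1 + c) / (1 - c)) / (2 * k), mem_univ _, ?_⟩
  rw [tanhParam, mul_div_cancel₀ _ (by simpa using hk), Real.exp_log (div_pos h1 h2)]
  field_simp
  ring

/-- On a bounded interval there is a projective parameter with values `(-1, 1)`. -/
theorem exists_projective_param {k : ℝ} (hk : 0 < k) {s t : ℝ} (hst : s < t) :
    ∃ A B : ℝ, A ≠ 0 ∧ (fun r => A * Real.exp (2 * k * r) + B) '' Ioo s t = Ioo (-1) 1 := by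
  have hexp : ∀ {a b : ℝ}, a < b → Real.exp (2 * k * a) < Real.exp (2 * k * b) := fun h =>
    Real.exp_lt_exp.mpr (by nlinarith)
  have h0 := hexp hst
  have hA : 0 < 2 / (Real.exp (2 * k * t) - Real.exp (2 * k * s)) :=
    div_pos two_pos (sub_pos.mpr h0)
  set A := 2 / (Real.exp (2 * k * t) - Real.exp (2 * k * s)) with hAdef
  have hA2 : A * (Real.exp (2 * k * t) - Real.exp (2 * k * s)) = 2 :=
    div_mul_cancel₀ _ (sub_pos.mpr h0).ne'
  -- A and B are fixed by the requirement that the endpoints s and t go to -1 and 1.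
  refine ⟨A, -1 - A * Real.exp (2 * k * s), hA.ne', Subset.antisymm ?_ fun c hc => ?_⟩
  · rintro _ ⟨r, hr, rfl⟩
    have h1 := mul_lt_mul_of_pos_left (hexp hr.1) hA
    have h2 := mul_lt_mul_of_pos_left (hexp hr.2) hA
    simp only [mem_Ioo]
    constructor <;> linarith
  · have hcont : ContinuousOn (fun r => A * Real.exp (2 * k * r) + (-1 - A * Real.exp (2 * k * s)))
        (Icc s t) := by fun_prop
    have := intermediate_value_Ioo hst.le hcont
    refine this ⟨?_, ?_⟩
    · linarith [hc.1]
    · linarith [hc.2]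

end

/-! ### Geodesics of unit Ricci length and their comparison with projective maps -/

section

variable {n : ℕ}


variable {M : Type*} [TopologicalSpace M] [ChartedSpace (E n) M]


/-- Euler's identity twice gives g_y(y, y) = F²(y), and g_y is positive definite. -/
theorem IsCoordFinsler.sqr_pos {U : Set (E n)} {L : E n → E n → ℝ} {z : E n × E n}
    (h : IsCoordFinsler U L) (hz : z ∈ slit U) : 0 < sqr L z.1 z.2 := by
  have h1 : ∀ i, ∑ j, metric L i j z.1 z.2 * z.2 i * z.2 j =
      (1 / 2) * (z.2 i * dy i (sqr L) z.1 z.2) := by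
    intro i
    have e1 := (h.homog_sqr.dy h.isOpen i h.smooth_sqr).euler h.isOpen (h.smooth_sqr.dy h.isOpen i) hz
    rw [← (h.smooth_sqr.dy h.isOpen i).sum_dy h.isOpen hz] at e1
    rw [Nat.cast_one, one_mul] at e1
    rw [← e1, Finset.mul_sum, Finset.mul_sum]
    exact Finset.sum_congr rfl fun j _ => by rw [metric]; ring
  have e2 := h.homog_sqr.euler h.isOpen h.smooth_sqr hz
  rw [← h.smooth_sqr.sum_dy h.isOpen hz] at e2
  have h2 := h.convex _ hz.1 _ hz.2 _ hz.2
  simp only [h1, ← Finset.mul_sum, e2] at h2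
  push_cast at h2
  linarith

namespace FinslerStructure

variable [IsManifold (𝓡 n) ∞ M] {𝓕 : FinslerStructure n M} {γ : ℝ → M} {J : Set ℝ} {t : ℝ} {p q : M}

theorem loc_pos (p : M) {z : E n × E n} (hz : z ∈ slit (chartAt (E n) p).target) :
    0 < 𝓕.loc p z.1 z.2 := by
  have h1 := (𝓕.isCoordFinsler p).sqr_pos hz
  have h2 : 0 ≤ 𝓕.loc p z.1 z.2 := 𝓕.nonneg _
  exact h2.lt_of_ne fun h0 => by simp [sqr, ← h0] at h1

variable (𝓕) in
/-- The squared norm of a tangent vector with respect to `-4/(n-1) Ric`. -/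
def ricSq (p : M) (z : E n × E n) : ℝ := -(4 / ((n : ℝ) - 1)) * ricScalar (𝓕.loc p) z.1 z.2

theorem coef_pos (hn : 2 ≤ n) : (0 : ℝ) < 4 / ((n : ℝ) - 1) := by
  have : (2 : ℝ) ≤ n := by exact_mod_cast hn
  exact div_pos (by norm_num) (by linarith)

theorem ricSq_pos (hn : 2 ≤ n) (hneg : 𝓕.RicciNegDef) (p : M) {z : E n × E n}
    (hz : z ∈ slit (chartAt (E n) p).target) : 0 < 𝓕.ricSq p z := by
  have h1 := hneg p _ hz.1 _ hz.2 _ hz.2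
  rw [(𝓕.isCoordFinsler p).sum_sum_ricci hz] at h1
  exact mul_pos_of_neg_of_neg (neg_neg_of_pos (coef_pos hn)) h1

theorem ricSq_smul (p : M) {z : E n × E n} (hz : z ∈ slit (chartAt (E n) p).target) {c : ℝ}
    (hc : 0 < c) : 𝓕.ricSq p (z.1, c • z.2) = c ^ 2 * 𝓕.ricSq p z := by
  rw [ricSq, (𝓕.isCoordFinsler p).homog_ricScalar _ hz.1 _ hz.2 c hc, ricSq]
  ring

theorem contDiffOn_ricSq (p : M) : ContDiffOn ℝ ∞ (𝓕.ricSq p) (slit (chartAt (E n) p).target) :=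
  contDiffOn_const.mul (𝓕.isCoordFinsler p).smooth_ricScalar

theorem IsGeodesicOn.ricSq_eq (h : 𝓕.IsGeodesicOn γ J) (hJ : IsOpen J) (ht : t ∈ J)
    (hp : γ t ∈ (chartAt (E n) p).source) :
    𝓕.ricSq p (jet p γ t) = -(4 / ((n : ℝ) - 1)) * 𝓕.ricciAlong γ t := by
  rw [h.ricciAlong_eq hJ ht hp, ricSq]

theorem IsGeodesicOn.ricciAlong_comp_affine (h : 𝓕.IsGeodesicOn γ J) (hJ : IsOpen J) {a b : ℝ}
    (h' : 𝓕.IsGeodesicOn (fun t => γ (a * t + b)) {t | a * t + b ∈ J})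
    (hscale : ∀ p, ∀ z ∈ slit (chartAt (E n) p).target,
      ricScalar (𝓕.loc p) z.1 (a • z.2) = a ^ 2 * ricScalar (𝓕.loc p) z.1 z.2)
    (ht : a * t + b ∈ J) :
    𝓕.ricciAlong (fun t => γ (a * t + b)) t = a ^ 2 * 𝓕.ricciAlong γ (a * t + b) := by
  have hJ' : IsOpen {t | a * t + b ∈ J} := hJ.preimage (by fun_prop)
  have hp := mem_chart_source (E n) (γ (a * t + b))
  rw [h'.ricciAlong_eq (p := γ (a * t + b)) hJ' ht hp, h.ricciAlong_eq hJ ht hp, jet_comp_affine,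
    hscale _ _ (h.jet_mem hJ ht hp)]

theorem IsGeodesicOn.ricciAlong_comp_affine_of_pos (h : 𝓕.IsGeodesicOn γ J) (hJ : IsOpen J)
    {a : ℝ} (ha : 0 < a) (b : ℝ) (ht : a * t + b ∈ J) :
    𝓕.ricciAlong (fun t => γ (a * t + b)) t = a ^ 2 * 𝓕.ricciAlong γ (a * t + b) :=
  h.ricciAlong_comp_affine hJ (h.comp_affine_of_pos hJ ha b)
    (fun p _ hz => (𝓕.isCoordFinsler p).homog_ricScalar _ hz.1 _ hz.2 a ha) ht

theorem IsGeodesicOn.speed_comp_affine_of_pos (h : 𝓕.IsGeodesicOn γ J) (hJ : IsOpen J)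
    {a : ℝ} (ha : 0 < a) (b : ℝ) (ht : a * t + b ∈ J) :
    𝓕.loc (γ (a * t + b)) (coordCurve (n := n) (fun t => γ (a * t + b)) t t)
      (velocity (n := n) (fun t => γ (a * t + b)) t) =
    a * 𝓕.loc (γ (a * t + b)) (coordCurve (n := n) γ (a * t + b) (a * t + b))
      (velocity (n := n) γ (a * t + b)) := by
  have hJ' : IsOpen {t | a * t + b ∈ J} := hJ.preimage (by fun_prop)
  have hp := mem_chart_source (E n) (γ (a * t + b))
  have hz := h.jet_mem hJ ht hp
  rw [(h.comp_affine_of_pos hJ ha b).speed_eq (p := γ (a * t + b)) hJ' ht hp, h.speed_eq hJ ht hp,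
    jet_comp_affine, (𝓕.isCoordFinsler _).homog _ hz.1 _ hz.2 a ha, pow_one]

variable (𝓕) in
/-- A geodesic parametrized by the length of `-4/(n-1) Ric`, on an open interval of times. -/
structure IsUnitGeod (σ : ℝ → M) (J : Set ℝ) : Prop where
  isOpen : IsOpen J
  ordConnected : J.OrdConnected
  geod : 𝓕.IsGeodesicOn σ J
  unit : ∀ t ∈ J, -(4 / ((n : ℝ) - 1)) * 𝓕.ricciAlong σ t = 1

variable {σ : ℝ → M}

theorem IsUnitGeod.ricSq_jet (h : 𝓕.IsUnitGeod σ J) (ht : t ∈ J)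
    (hp : σ t ∈ (chartAt (E n) p).source) : 𝓕.ricSq p (jet p σ t) = 1 := by
  rw [h.geod.ricSq_eq h.isOpen ht hp, h.unit t ht]

theorem IsUnitGeod.mono {J' : Set ℝ} (h : 𝓕.IsUnitGeod σ J) (hJ' : IsOpen J')
    (hJ'' : J'.OrdConnected) (hsub : J' ⊆ J) : 𝓕.IsUnitGeod σ J' :=
  ⟨hJ', hJ'', h.geod.mono hsub, fun t ht => h.unit t (hsub ht)⟩

theorem ordConnected_preimage_affine (hJ : J.OrdConnected) {a : ℝ} (ha : 0 < a) (b : ℝ) :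
    {t | a * t + b ∈ J}.OrdConnected := by
  refine ⟨fun x hx y hy z hz => hJ.out hx hy ⟨?_, ?_⟩⟩
  · have := mul_le_mul_of_nonneg_left hz.1 ha.le
    linarith
  · have := mul_le_mul_of_nonneg_left hz.2 ha.le
    linarith

theorem IsUnitGeod.shift (h : 𝓕.IsUnitGeod σ J) (b : ℝ) :
    𝓕.IsUnitGeod (fun t => σ (t + b)) {t | t + b ∈ J} := by
  have h1 := h.geod.comp_affine_of_pos h.isOpen one_pos b
  have h2 := ordConnected_preimage_affine h.ordConnected one_pos b
  have h3 := fun t ht => h.geod.ricciAlong_comp_affine_of_pos (t := t) h.isOpen one_pos b ht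
  simp only [one_mul, one_pow] at h1 h2 h3
  exact ⟨h.isOpen.preimage (by fun_prop), h2, h1, fun t ht => by rw [h3 t ht, h.unit _ ht]⟩

/-- Geodesics of negative Ricci curvature can be given a unit parametrization. -/
theorem IsGeodesicOn.isUnitGeod (h : 𝓕.IsGeodesicOn γ J) (hR : 𝓕.RicciFirstIntegral)
    (hJ : IsOpen J) (hJ' : J.OrdConnected) {r : ℝ} (hr : r ∈ J) {c : ℝ} (hc : 0 < c)
    (hcr : -(4 / ((n : ℝ) - 1)) * 𝓕.ricciAlong γ r = c ^ 2) :
    𝓕.IsUnitGeod (fun t => γ (c⁻¹ * t)) {t | c⁻¹ * t ∈ J} := by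
  have hc' : 0 < c⁻¹ := inv_pos.mpr hc
  have h1 := h.comp_affine_of_pos hJ hc' 0
  have h2 := ordConnected_preimage_affine hJ' hc' 0
  have h3 := fun t ht => h.ricciAlong_comp_affine_of_pos (t := t) hJ hc' 0 ht
  simp only [add_zero] at h1 h2 h3
  refine ⟨hJ.preimage (by fun_prop), h2, h1, fun t ht => ?_⟩
  rw [h3 t ht, h.ricciAlong_const hR hJ hJ' ht hr, mul_left_comm, hcr]
  field_simp

theorem schwarzian_comp_mul (p : ℝ → ℝ) {v : ℝ} (hv : v ≠ 0) (s : ℝ) :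
    schwarzian (fun s => p (v * s)) s = v ^ 2 * schwarzian p (v * s) := by
  have e : ∀ f : ℝ → ℝ, deriv (fun s => f (v * s)) = fun s => v * deriv f (v * s) := fun f => by
    simpa using deriv_comp_affine f v 0
  have e2 : ∀ f : ℝ → ℝ, deriv (fun s => v * f (v * s)) = fun s => v * (v * deriv f (v * s)) :=
    fun f => by
      funext s
      rw [deriv_const_mul_field, e]
  have e3 : ∀ f : ℝ → ℝ, deriv (fun s => v * (v * f (v * s))) =
      fun s => v * (v * (v * deriv f (v * s))) := fun f => by
    funext s
    rw [deriv_const_mul_field, e2]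
  simp only [schwarzian, iteratedDeriv_succ, iteratedDeriv_zero, e, e2, e3]
  -- At a critical point both sides are 0 by the convention on division by zero.
  by_cases h0 : deriv p (v * s) = 0
  · simp [h0]
  · field_simp

variable (𝓕) in
/-- `x` and `y` are joined by a geodesic segment of projective length `ℓ`. -/
def Link (x y : M) (ℓ : ℝ) : Prop :=
  ∃ (a b : ℝ) (f : ℝ → M), a ∈ Ioo (-1 : ℝ) 1 ∧ b ∈ Ioo (-1 : ℝ) 1 ∧ 𝓕.IsProjectiveMap f ∧
    f a = x ∧ f b = y ∧ ℓ = poincare a b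

variable (𝓕) in
/-- `x` and `y` are joined by a segment of a unit geodesic of length `ℓ`. -/
def Step (x y : M) (ℓ : ℝ) : Prop :=
  ∃ (σ : ℝ → M) (J : Set ℝ) (s t : ℝ), 𝓕.IsUnitGeod σ J ∧ s ∈ J ∧ t ∈ J ∧ σ s = x ∧ σ t = y ∧
    ℓ = |s - t|

theorem Link.symm {x y : M} {ℓ : ℝ} (h : 𝓕.Link x y ℓ) : 𝓕.Link y x ℓ := by
  obtain ⟨a, b, f, ha, hb, hf, hx, hy, rfl⟩ := h
  exact ⟨b, a, f, hb, ha, hf, hy, hx, poincare_comm ha hb⟩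

/-- Let c be the constant Ricci speed of the underlying geodesic. Then the Schwarzian is 2/(n-1) Ric
= -2(c/2)², and the Schwarz lemma with k = c/2 bounds c|s - t|, the length of the segment after
rescaling to unit Ricci speed. -/
theorem IsProjectiveMap.exists_unitGeod (hn : 2 ≤ n) (hneg : 𝓕.RicciNegDef)
    (hR : 𝓕.RicciFirstIntegral) {f : ℝ → M} (hf : 𝓕.IsProjectiveMap f) {a b : ℝ}
    (ha : a ∈ Ioo (-1 : ℝ) 1) (hb : b ∈ Ioo (-1 : ℝ) 1) :
    ∃ ℓ, 𝓕.Step (f a) (f b) ℓ ∧ ℓ ≤ poincare a b := by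
  obtain ⟨J, γ, p, hJ, hJ', hγ, -, hp, himage, hfp⟩ := hf
  obtain ⟨s, hs, rfl⟩ := himage.symm ▸ ha
  obtain ⟨t, ht, rfl⟩ := himage.symm ▸ hb
  have hpos := ricSq_pos hn hneg (γ s) (hγ.jet_mem hJ hs (mem_chart_source _ _))
  rw [hγ.ricSq_eq hJ hs (mem_chart_source _ _)] at hpos
  have hn1 : (0 : ℝ) < (n : ℝ) - 1 := by
    have : (2 : ℝ) ≤ n := by exact_mod_cast hn
    linarith
  set c := √(-(4 / ((n : ℝ) - 1)) * 𝓕.ricciAlong γ s) with hcdef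
  have hc : 0 < c := Real.sqrt_pos.mpr hpos
  have hc2 : -(4 / ((n : ℝ) - 1)) * 𝓕.ricciAlong γ s = c ^ 2 := (Real.sq_sqrt hpos.le).symm
  have hS : ∀ r ∈ J, schwarzian p r = -2 * (c / 2) ^ 2 := by
    intro r hr
    rw [hp.equation r hr, hγ.ricciAlong_const hR hJ hJ' hr hs, div_pow, ← hc2]
    field_simp
    ring
  have key := two_mul_abs_sub_le_poincare hJ hJ' hp.smooth hp.deriv_ne hS himage hs ht
  have hmem : ∀ r ∈ J, c * r ∈ {t | c⁻¹ * t ∈ J} := fun r hr => by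
    simpa only [mem_ofPred_eq, inv_mul_cancel_left₀ hc.ne'] using hr
  refine ⟨|c * s - c * t|, ⟨_, _, c * s, c * t, hγ.isUnitGeod hR hJ hJ' hs hc hc2, hmem s hs,
    hmem t ht, ?_, ?_, rfl⟩, ?_⟩
  · rw [hfp s hs, inv_mul_cancel_left₀ hc.ne']
  · rw [hfp t ht, inv_mul_cancel_left₀ hc.ne']
  · rw [← mul_sub, abs_mul, abs_of_pos hc]
    linarith

/-- Projective parameters of unit geodesics give projective maps. -/
theorem IsUnitGeod.exists_projectiveMap (hn : 2 ≤ n) (h : 𝓕.IsUnitGeod σ J) {p : ℝ → ℝ}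
    (hp : ContDiff ℝ ∞ p) (hne : ∀ s ∈ J, deriv p s ≠ 0)
    (hS : ∀ s ∈ J, schwarzian p s = -2 * (1 / 2) ^ 2) (himage : p '' J = Ioo (-1) 1) :
    ∃ f, 𝓕.IsProjectiveMap f ∧ ∀ s ∈ J, f (p s) = σ s := by
  -- The Schwarz lemma also yields injectivity, so that σ ∘ p⁻¹ is defined.
  have hinj : InjOn p J := fun s hs t ht hst => by
    have h1 := two_mul_abs_sub_le_poincare h.isOpen h.ordConnected hp.contDiffOn hne hS himage hs ht
    rw [hst, poincare_self (himage ▸ mem_image_of_mem p ht)] at h1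
    exact sub_eq_zero.mp (abs_eq_zero.mp (le_antisymm (by linarith) (abs_nonneg _)))
  obtain ⟨r, hr, -⟩ := himage.symm ▸ (show (0 : ℝ) ∈ Ioo (-1 : ℝ) 1 by norm_num)
  -- The definition of a projective map asks for F-arc length, whereas σ has unit Ricci speed; v is
  -- the constant F-speed of σ, and time is rescaled by v⁻¹.
  set v := 𝓕.loc (σ r) (coordCurve (n := n) σ r r) (velocity (n := n) σ r) with hv
  have hvpos : 0 < v := loc_pos (z := jet (σ r) σ r) (σ r)
    (h.geod.jet_mem h.isOpen hr (mem_chart_source _ _))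
  have hv' : 0 < v⁻¹ := inv_pos.mpr hvpos
  have hmul : ∀ s, v⁻¹ * (v * s) = s := fun s => inv_mul_cancel_left₀ hvpos.ne' s
  have hn1 : (0 : ℝ) < (n : ℝ) - 1 := by
    have : (2 : ℝ) ≤ n := by exact_mod_cast hn
    linarith
  have h1 := h.geod.comp_affine_of_pos h.isOpen hv' 0
  have h2 := ordConnected_preimage_affine h.ordConnected hv' 0
  have h3 := fun t ht => h.geod.ricciAlong_comp_affine_of_pos (t := t) h.isOpen hv' 0 ht
  have h4 := fun t ht => h.geod.speed_comp_affine_of_pos (t := t) h.isOpen hv' 0 ht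
  simp only [add_zero] at h1 h2 h3 h4
  have hpinv : ∀ s ∈ J, σ (Function.invFunOn p J (p s)) = σ s := fun s hs => by
    rw [hinj.leftInvOn_invFunOn hs]
  refine ⟨fun u => σ (Function.invFunOn p J u), ⟨{s | v⁻¹ * s ∈ J}, fun s => σ (v⁻¹ * s),
    fun s => p (v⁻¹ * s), h.isOpen.preimage (by fun_prop), h2, h1, fun t ht => ?_,
    ⟨(hp.comp (by fun_prop)).contDiffOn, fun s hs => ?_, fun s hs => ?_⟩, ?_,
    fun s hs => hpinv _ hs⟩, hpinv⟩
  · rw [h4 t ht, h.geod.speed_const h.isOpen h.ordConnected ht hr, ← hv, inv_mul_cancel₀ hvpos.ne']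
  · have := congrFun (deriv_comp_affine p v⁻¹ 0) s
    simp only [add_zero] at this
    rw [this]
    exact smul_ne_zero hv'.ne' (hne _ hs)
  · have := h.unit _ hs
    rw [schwarzian_comp_mul p hv'.ne', hS _ hs, h3 s hs]
    -- Unit Ricci speed means -4/(n-1) Ric = 1; this is why the relevant constant is k = 1/2.
    have h5 : 2 / ((n : ℝ) - 1) * 𝓕.ricciAlong σ (v⁻¹ * s) = -(1 / 2) := by
      have h6 : 4 / ((n : ℝ) - 1) = 2 * (2 / ((n : ℝ) - 1)) := by ring
      rw [h6] at this
      linarith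
    rw [mul_left_comm (2 / ((n : ℝ) - 1)), h5]
    ring
  · rw [← himage]
    ext u
    constructor
    · rintro ⟨s, hs, rfl⟩
      exact ⟨_, hs, rfl⟩
    · rintro ⟨s, hs, rfl⟩
      exact ⟨v * s, by simpa only [mem_ofPred_eq, hmul] using hs, by simp only [hmul]⟩

/-- Without completeness only some finite length can be had. An exponential parameter maps a
slightly larger bounded time interval onto (-1, 1). -/
theorem IsUnitGeod.exists_link (hn : 2 ≤ n) (h : 𝓕.IsUnitGeod σ J) {s t : ℝ}
    (hs : s ∈ J) (ht : t ∈ J) : ∃ ℓ, 𝓕.Link (σ s) (σ t) ℓ := by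
  wlog hst : s ≤ t generalizing s t with H
  · obtain ⟨ℓ, hℓ⟩ := H ht hs (le_of_not_ge hst)
    exact ⟨ℓ, hℓ.symm⟩
  obtain ⟨ε, hε, hεs⟩ := Metric.isOpen_iff.mp h.isOpen s hs
  obtain ⟨δ, hδ, hδt⟩ := Metric.isOpen_iff.mp h.isOpen t ht
  have hs' : s - ε / 2 ∈ J := hεs (by rw [Metric.mem_ball, Real.dist_eq, abs_lt]; constructor <;> linarith)
  have ht' : t + δ / 2 ∈ J := hδt (by rw [Metric.mem_ball, Real.dist_eq, abs_lt]; constructor <;> linarith)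
  have hsub : Ioo (s - ε / 2) (t + δ / 2) ⊆ J := Ioo_subset_Icc_self.trans (h.ordConnected.out hs' ht')
  have h1 := h.mono isOpen_Ioo ordConnected_Ioo hsub
  obtain ⟨A, B, hA, himage⟩ := exists_projective_param (k := 1 / 2) (by norm_num)
    (show s - ε / 2 < t + δ / 2 by linarith)
  have hsm : s ∈ Ioo (s - ε / 2) (t + δ / 2) := ⟨by linarith, by linarith⟩
  have htm : t ∈ Ioo (s - ε / 2) (t + δ / 2) := ⟨by linarith, by linarith⟩
  obtain ⟨f, hf, hfp⟩ := h1.exists_projectiveMap hn (p := fun r => A * Real.exp (2 * (1 / 2) * r) + B)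
    (by fun_prop) (fun r _ => by
      rw [(((hasDerivAt_exp_mul (2 * (1 / 2)) r).const_mul A).add_const B).deriv]
      have := Real.exp_pos (2 * (1 / 2) * r)
      positivity) (fun r _ => schwarzian_exp hA (by norm_num) B r) himage
  exact ⟨_, _, _, f, himage ▸ mem_image_of_mem _ hsm, himage ▸ mem_image_of_mem _ htm, hf, hfp s hsm,
    hfp t htm, rfl⟩

/-- On the whole line the parameter tanh(s/2) is projective and makes the length exact. -/
theorem IsUnitGeod.link (hn : 2 ≤ n) (h : 𝓕.IsUnitGeod σ univ) (s t : ℝ) :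
    𝓕.Link (σ s) (σ t) |s - t| := by
  have hk : (0 : ℝ) < 1 / 2 := by norm_num
  obtain ⟨f, hf, hfp⟩ := h.exists_projectiveMap hn (contDiff_tanhParam (1 / 2))
    (fun s _ => deriv_tanhParam_ne hk.ne' s) (fun s _ => schwarzian_tanhParam hk.ne' s)
    (image_tanhParam hk.ne')
  exact ⟨_, _, f, tanhParam_mem _ s, tanhParam_mem _ t, hf, hfp s (mem_univ s), hfp t (mem_univ t), by
    rw [poincare_tanhParam hk]; ring⟩

/-! ### Chains -/

end FinslerStructure

/-- `Chain R x y ℓ`: there is a chain of `R`-steps from `x` to `y`, of total length `ℓ`. -/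
inductive Chain {X : Type*} (R : X → X → ℝ → Prop) : X → X → ℝ → Prop
  | single {x y : X} {ℓ : ℝ} : R x y ℓ → Chain R x y ℓ
  | cons {x y z : X} {ℓ ℓ' : ℝ} : R x y ℓ → Chain R y z ℓ' → Chain R x z (ℓ + ℓ')

namespace Chain

variable {X : Type*} {R R' : X → X → ℝ → Prop} {x y z : X} {ℓ ℓ' : ℝ}

theorem trans (h : Chain R x y ℓ) (h' : Chain R y z ℓ') : Chain R x z (ℓ + ℓ') := by
  induction h with
  | single h => exact cons h h'
  | cons h _ ih => rw [add_assoc]; exact cons h (ih h')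

theorem symm (hR : ∀ {x y ℓ}, R x y ℓ → R y x ℓ) (h : Chain R x y ℓ) : Chain R y x ℓ := by
  induction h with
  | single h => exact single (hR h)
  | cons h _ ih => rw [add_comm]; exact ih.trans (single (hR h))

theorem exists_le (hR : ∀ x y ℓ, R x y ℓ → ∃ ℓ', R' x y ℓ' ∧ ℓ' ≤ ℓ) (h : Chain R x y ℓ) :
    ∃ ℓ', Chain R' x y ℓ' ∧ ℓ' ≤ ℓ := by
  induction h with
  | single h =>
    obtain ⟨ℓ', h1, h2⟩ := hR _ _ _ h
    exact ⟨ℓ', single h1, h2⟩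
  | cons h _ ih =>
    obtain ⟨ℓ', h1, h2⟩ := hR _ _ _ h
    obtain ⟨ℓ'', h3, h4⟩ := ih
    exact ⟨ℓ' + ℓ'', cons h1 h3, add_le_add h2 h4⟩

/-- A chain has at least one step, hence k + 1 steps through k + 2 points. -/
theorem of_fin : ∀ {k : ℕ} (z : Fin (k + 2) → X) (ℓ : Fin (k + 1) → ℝ),
    (∀ i, R (z i.castSucc) (z i.succ) (ℓ i)) → Chain R (z 0) (z (Fin.last _)) (∑ i, ℓ i)
  | 0, z, ℓ, h => by simpa using! single (h 0)
  | k + 1, z, ℓ, h => by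
    rw [Fin.sum_univ_succ]
    refine cons (h 0) ?_
    have := of_fin (fun i => z i.succ) (fun i => ℓ i.succ) (fun i => h i.succ)
    exact this

theorem exists_fin (h : Chain R x y ℓ) : ∃ (k : ℕ) (z : Fin (k + 2) → X) (ℓ' : Fin (k + 1) → ℝ),
    z 0 = x ∧ z (Fin.last _) = y ∧ (∀ i, R (z i.castSucc) (z i.succ) (ℓ' i)) ∧ ℓ = ∑ i, ℓ' i := by
  induction h with
  | @single x y ℓ h =>
    refine ⟨0, ![x, y], ![ℓ], rfl, rfl, fun i => ?_, by simp⟩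
    fin_cases i
    exact h
  | @cons x y w ℓ _ h _ ih =>
    obtain ⟨k, z, ℓ', h0, hl, hi, rfl⟩ := ih
    refine ⟨k + 1, Fin.cons x z, Fin.cons ℓ ℓ', rfl, hl, fun i => ?_, ?_⟩
    · refine Fin.cases ?_ (fun i => ?_) i
      · simpa [h0] using! h
      · exact hi i
    · rw [Fin.sum_univ_succ (n := k + 1)]
      simp

end Chain

/-! ### Formal properties of the chain pseudo-distance -/

namespace FinslerStructure

variable [IsManifold (𝓡 n) ∞ M] {𝓕 : FinslerStructure n M}

theorem mem_chainLengths {x y : M} {ℓ : ℝ} :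
    ℓ ∈ 𝓕.chainLengths x y ↔ Chain 𝓕.Link x y ℓ := by
  constructor
  · rintro ⟨k, z, a, b, f, hk, rfl, rfl, h, rfl⟩
    obtain ⟨k, rfl⟩ := Nat.exists_eq_succ_of_ne_zero hk.ne'
    exact Chain.of_fin z _ fun i => ⟨a i, b i, f i, (h i).1, (h i).2.1, (h i).2.2.1, (h i).2.2.2.1,
      (h i).2.2.2.2, rfl⟩
  · intro h
    obtain ⟨k, z, ℓ', h0, hl, hlink, rfl⟩ := h.exists_fin
    have h' : ∀ i : Fin (k + 1), ∃ (a b : ℝ) (f : ℝ → M), a ∈ Ioo (-1 : ℝ) 1 ∧ b ∈ Ioo (-1 : ℝ) 1 ∧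
      𝓕.IsProjectiveMap f ∧ f a = z i.castSucc ∧ f b = z i.succ ∧ ℓ' i = poincare a b := hlink
    choose a b f ha hb hf hx hy hℓ using h'
    exact ⟨k + 1, z, a, b, f, Nat.succ_pos _, h0, hl, fun i => ⟨ha i, hb i, hf i, hx i, hy i⟩,
      Finset.sum_congr rfl fun i _ => hℓ i⟩

theorem Link.nonneg {x y : M} {ℓ : ℝ} (h : 𝓕.Link x y ℓ) : 0 ≤ ℓ := by
  obtain ⟨a, b, f, -, -, -, -, -, rfl⟩ := h
  exact poincare_nonneg a b

theorem Step.nonneg {x y : M} {ℓ : ℝ} (h : 𝓕.Step x y ℓ) : 0 ≤ ℓ := by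
  obtain ⟨σ, J, s, t, -, -, -, -, -, rfl⟩ := h
  exact abs_nonneg _

theorem Link.exists_step (hn : 2 ≤ n) (hneg : 𝓕.RicciNegDef)
    (hR : 𝓕.RicciFirstIntegral) {x y : M} {ℓ : ℝ} (h : 𝓕.Link x y ℓ) :
    ∃ ℓ', 𝓕.Step x y ℓ' ∧ ℓ' ≤ ℓ := by
  obtain ⟨a, b, f, ha, hb, hf, rfl, rfl, rfl⟩ := h
  exact hf.exists_unitGeod hn hneg hR ha hb

theorem projDist_le {x y : M} {ℓ : ℝ} (h : Chain 𝓕.Link x y ℓ) :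
    𝓕.projDist x y ≤ ENNReal.ofReal ℓ :=
  iInf₂_le ℓ (mem_chainLengths.mpr h)

theorem exists_chain_of_projDist_lt {x y : M} {c : ℝ≥0∞} (h : 𝓕.projDist x y < c) :
    ∃ ℓ, Chain 𝓕.Link x y ℓ ∧ ENNReal.ofReal ℓ < c := by
  simp only [projDist, iInf_lt_iff] at h
  obtain ⟨ℓ, h1, h2⟩ := h
  exact ⟨ℓ, mem_chainLengths.mp h1, h2⟩

theorem projDist_comm (x y : M) : 𝓕.projDist x y = 𝓕.projDist y x := by
  have : 𝓕.chainLengths x y = 𝓕.chainLengths y x := by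
    ext ℓ
    rw [mem_chainLengths, mem_chainLengths]
    exact ⟨Chain.symm Link.symm, Chain.symm Link.symm⟩
  rw [projDist, projDist, this]

theorem chain_nonneg {x y : M} {ℓ : ℝ} (h : Chain 𝓕.Link x y ℓ) : 0 ≤ ℓ := by
  induction h with
  | single h => exact h.nonneg
  | cons h _ ih => exact add_nonneg h.nonneg ih

theorem projDist_triangle (x y z : M) :
    𝓕.projDist x z ≤ 𝓕.projDist x y + 𝓕.projDist y z := by
  refine ENNReal.le_of_forall_pos_le_add fun ε hε hfin => ?_
  have hε2 : (ε / 2 : ℝ≥0∞) ≠ 0 := by simpa using hε.ne'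
  have h1 := (ENNReal.add_lt_top.mp hfin).1
  have h2 := (ENNReal.add_lt_top.mp hfin).2
  obtain ⟨ℓ, hℓ, hlt⟩ := exists_chain_of_projDist_lt (ENNReal.lt_add_right h1.ne hε2)
  obtain ⟨ℓ', hℓ', hlt'⟩ := exists_chain_of_projDist_lt (ENNReal.lt_add_right h2.ne hε2)
  refine (projDist_le (hℓ.trans hℓ')).trans ?_
  rw [ENNReal.ofReal_add (chain_nonneg hℓ) (chain_nonneg hℓ')]
  refine (add_le_add hlt.le hlt'.le).trans (le_of_eq ?_)
  rw [add_add_add_comm, ENNReal.add_halves]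

end FinslerStructure

end

section

variable {n : ℕ}


variable {M : Type*} [TopologicalSpace M] [ChartedSpace (E n) M]


/-! ### Local flows of second order equations -/

-- Picard-Lindelöf gives trajectories that are Lipschitz in the initial value. On a ball where V is
-- bounded and Lipschitz, the mean value inequality in t bounds both the displacement and, in the
-- last estimate, the Lipschitz constant of Φ_t - id by a multiple of |t|.
open scoped NNReal in
theorem exists_local_flow {Z : Type*} [NormedAddCommGroup Z] [NormedSpace ℝ Z] [CompleteSpace Z]
    {V : Z → Z} {z₀ : Z} (hV : ContDiffAt ℝ 1 V z₀) {W : Set Z} (hW : W ∈ 𝓝 z₀) :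
    ∃ ρ > (0 : ℝ), ∃ ε > (0 : ℝ), ∃ C : ℝ, 0 ≤ C ∧ ∃ Φ : Z → ℝ → Z,
      (∀ z ∈ Metric.closedBall z₀ ρ, Φ z 0 = z ∧ ∀ t ∈ Ioo (-ε) ε,
        HasDerivAt (Φ z) (V (Φ z t)) t ∧ Φ z t ∈ W ∧ ‖Φ z t - z‖ ≤ C * |t|) ∧
      ∀ z ∈ Metric.closedBall z₀ ρ, ∀ z' ∈ Metric.closedBall z₀ ρ, ∀ t ∈ Ioo (-ε) ε,
        ‖(Φ z t - Φ z' t) - (z - z')‖ ≤ C * ‖z - z'‖ * |t| := by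
  obtain ⟨K, s, hs, hl⟩ := hV.exists_lipschitzOnWith
  have hbd : ∀ᶠ z in 𝓝 z₀, ‖V z‖ < ‖V z₀‖ + 1 :=
    hV.continuousAt.norm.eventually_lt continuousAt_const (lt_add_one _)
  obtain ⟨δ, hδ, hδs⟩ := Metric.mem_nhds_iff.mp (inter_mem (inter_mem hs hW) hbd)
  obtain ⟨ε₀, hε₀, a, r, L, K', hr, hpl⟩ := IsPicardLindelof.of_contDiffAt_one hV
  obtain ⟨Φ, hΦ, L', hL'⟩ :=
    (hpl 0).exists_forall_mem_closedBall_eq_hasDerivWithinAt_lipschitzOnWith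
  simp only [zero_sub, zero_add] at hΦ hL'
  have hD : ∀ z ∈ Metric.closedBall z₀ r, ∀ t ∈ Ioo (-ε₀) ε₀, HasDerivAt (Φ z) (V (Φ z t)) t :=
    fun z hz t ht => ((hΦ z hz).2 t (Ioo_subset_Icc_self ht)).hasDerivAt (Icc_mem_nhds ht.1 ht.2)
  have hz₀ : z₀ ∈ Metric.closedBall z₀ (r : ℝ) := Metric.mem_closedBall_self r.2
  have hcont : ContinuousAt (Φ z₀) 0 :=
    (hD z₀ hz₀ 0 ⟨neg_lt_zero.mpr hε₀, hε₀⟩).continuousAt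
  have hnear : ∀ᶠ t in 𝓝 (0 : ℝ), dist (Φ z₀ t) z₀ < δ / 2 := by
    have := hcont.dist (continuousAt_const (y := z₀))
    refine this.eventually_lt continuousAt_const ?_
    rw [(hΦ z₀ hz₀).1, dist_self]
    positivity
  obtain ⟨ε₁, hε₁, hball⟩ := Metric.eventually_nhds_iff.mp hnear
  set ε := min ε₀ ε₁ with hε
  -- The central trajectory stays within δ/2 of z₀ and the others deviate from it by at most δ/4, so
  -- all remain in the δ-ball; L' + 1 avoids a vanishing denominator.
  set ρ : ℝ := min r (δ / (4 * (L' + 1))) with hρ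
  have hρr : Metric.closedBall z₀ ρ ⊆ Metric.closedBall z₀ r :=
    Metric.closedBall_subset_closedBall (min_le_left _ _)
  have hIoo : ∀ t ∈ Ioo (-ε) ε, t ∈ Ioo (-ε₀) ε₀ := fun t ht =>
    ⟨by linarith [ht.1, min_le_left ε₀ ε₁], by linarith [ht.2, min_le_left ε₀ ε₁]⟩
  have hmem : ∀ z ∈ Metric.closedBall z₀ ρ, ∀ t ∈ Ioo (-ε) ε, Φ z t ∈ Metric.ball z₀ δ := by
    intro z hz t ht
    have h1 := (hL' t (Ioo_subset_Icc_self (hIoo t ht))).dist_le_mul _ (hρr hz) _ hz₀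
    have h2 : dist (Φ z₀ t) z₀ < δ / 2 := hball (by
      rw [Real.dist_eq, sub_zero, abs_lt]
      exact ⟨by linarith [ht.1, min_le_right ε₀ ε₁], by linarith [ht.2, min_le_right ε₀ ε₁]⟩)
    have h3 : (L' : ℝ) * dist z z₀ ≤ δ / 4 := by
      have h4 : dist z z₀ ≤ δ / (4 * (L' + 1)) := (Metric.mem_closedBall.mp hz).trans (min_le_right _ _)
      have h5 : (0 : ℝ) ≤ L' := L'.2
      have h6 : (0 : ℝ) < L' + 1 := by linarith
      calc (L' : ℝ) * dist z z₀ ≤ (L' + 1) * (δ / (4 * (L' + 1))) := by gcongr; linarith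
        _ = δ / 4 := by field_simp
    rw [Metric.mem_ball]
    linarith [dist_triangle (Φ z t) (Φ z₀ t) z₀]
  have hpos : 0 < ε := lt_min hε₀ hε₁
  have hsub : ∀ t ∈ Ioo (-ε) ε, uIcc 0 t ⊆ Ioo (-ε) ε := fun t ht =>
    ordConnected_Ioo.uIcc_subset ⟨neg_lt_zero.mpr hpos, hpos⟩ ht
  refine ⟨ρ, lt_min hr (by have := L'.2; positivity), ε, hpos, max (‖V z₀‖ + 1) (K * L'),
    le_max_of_le_left (by positivity), Φ,
    fun z hz => ⟨(hΦ z (hρr hz)).1, fun t ht => ⟨hD z (hρr hz) t (hIoo t ht),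
      (hδs (hmem z hz t ht)).1.2, ?_⟩⟩, fun z hz z' hz' t ht => ?_⟩
  · have h1 := (convex_uIcc 0 t).norm_image_sub_le_of_norm_hasDerivWithin_le
      (f := Φ z) (f' := fun t => V (Φ z t)) (C := max (‖V z₀‖ + 1) (K * L'))
      (fun τ hτ => (hD z (hρr hz) τ (hIoo τ (hsub t ht hτ))).hasDerivWithinAt)
      (fun τ hτ => le_max_of_le_left (hδs (hmem z hz τ (hsub t ht hτ))).2.le)
      left_mem_uIcc right_mem_uIcc
    rwa [(hΦ z (hρr hz)).1, sub_zero, Real.norm_eq_abs] at h1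
  · have h1 := (convex_uIcc 0 t).norm_image_sub_le_of_norm_hasDerivWithin_le
      (f := fun t => Φ z t - Φ z' t) (f' := fun t => V (Φ z t) - V (Φ z' t))
      (C := max (‖V z₀‖ + 1) (K * L') * ‖z - z'‖)
      (fun τ hτ => ((hD z (hρr hz) τ (hIoo τ (hsub t ht hτ))).sub
        (hD z' (hρr hz') τ (hIoo τ (hsub t ht hτ)))).hasDerivWithinAt)
      (fun τ hτ => ?_) left_mem_uIcc right_mem_uIcc
    · rwa [(hΦ z (hρr hz)).1, (hΦ z' (hρr hz')).1, sub_zero, Real.norm_eq_abs] at h1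
    · have h2 := hl.norm_sub_le (hδs (hmem z hz τ (hsub t ht hτ))).1.1
        (hδs (hmem z' hz' τ (hsub t ht hτ))).1.1
      have h3 := (hL' τ (Ioo_subset_Icc_self (hIoo τ (hsub t ht hτ)))).norm_sub_le (hρr hz) (hρr hz')
      refine h2.trans ((mul_le_mul_of_nonneg_left h3 K.2).trans ?_)
      rw [← mul_assoc]
      exact mul_le_mul_of_nonneg_right (le_max_right _ _) (norm_nonneg _)

theorem norm_sub_smul_le {V : Type*} [NormedAddCommGroup V] [NormedSpace ℝ V] {f g : ℝ → V}
    {ε C : ℝ} (hC : 0 ≤ C) {w : V} (hf : ∀ t ∈ Ioo (-ε) ε, HasDerivAt f (g t) t)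
    (hg : ∀ t ∈ Ioo (-ε) ε, ‖g t - w‖ ≤ C * |t|) {t : ℝ} (ht : t ∈ Ioo (-ε) ε) :
    ‖f t - f 0 - t • w‖ ≤ C * t ^ 2 := by
  have hpos : 0 < ε := by linarith [ht.1, ht.2]
  have hsub : uIcc 0 t ⊆ Ioo (-ε) ε :=
    ordConnected_Ioo.uIcc_subset ⟨neg_lt_zero.mpr hpos, hpos⟩ ht
  have h1 := (convex_uIcc 0 t).norm_image_sub_le_of_norm_hasDerivWithin_le
    (f := fun t => f t - t • w) (f' := fun t => g t - w) (C := C * |t|)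
    (fun τ hτ => by
      simpa using! ((hf τ (hsub hτ)).sub ((hasDerivAt_id τ).smul_const w)).hasDerivWithinAt)
    (fun τ hτ => (hg τ (hsub hτ)).trans (mul_le_mul_of_nonneg_left
      (by simpa using abs_sub_left_of_mem_uIcc hτ) hC)) left_mem_uIcc right_mem_uIcc
  simp only [zero_smul, sub_zero, Real.norm_eq_abs] at h1
  rw [mul_assoc, abs_mul_abs_self, ← pow_two] at h1
  rwa [sub_right_comm]

section SecondOrder

variable {V : Type*} [NormedAddCommGroup V] [NormedSpace ℝ V] [CompleteSpace V]

/-- The local flow of `x'' = -G(x, x')`. -/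
theorem exists_second_order_flow {G : V × V → V} {z₀ : V × V} (hG : ContDiffAt ℝ 1 G z₀)
    {W : Set (V × V)} (hW : W ∈ 𝓝 z₀) :
    ∃ ρ > (0 : ℝ), ∃ ε > (0 : ℝ), ∃ C : ℝ, 0 ≤ C ∧ ∃ Φ : V × V → ℝ → V × V,
      (∀ z ∈ Metric.closedBall z₀ ρ, Φ z 0 = z ∧ ∀ t ∈ Ioo (-ε) ε,
        HasDerivAt (Φ z) ((Φ z t).2, -G (Φ z t)) t ∧ Φ z t ∈ W ∧ ‖Φ z t - z‖ ≤ C * |t| ∧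
        ‖(Φ z t).1 - z.1 - t • z.2‖ ≤ C * t ^ 2) ∧
      ∀ z ∈ Metric.closedBall z₀ ρ, ∀ z' ∈ Metric.closedBall z₀ ρ, ∀ t ∈ Ioo (-ε) ε,
        ‖((Φ z t).1 - (Φ z' t).1) - (z.1 - z'.1) - t • (z.2 - z'.2)‖ ≤ C * ‖z - z'‖ * t ^ 2 := by
  obtain ⟨ρ, hρ, ε, hε, C, hC, Φ, h1, h2⟩ := exists_local_flow
    (V := fun z : V × V => (z.2, -G z)) (contDiffAt_snd.prodMk hG.neg) hW
  have hd : ∀ z ∈ Metric.closedBall z₀ ρ, ∀ t ∈ Ioo (-ε) ε,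
      HasDerivAt (fun t => (Φ z t).1) (Φ z t).2 t := fun z hz t ht =>
    (hasFDerivAt_fst (𝕜 := ℝ) (p := Φ z t)).comp_hasDerivAt t ((h1 z hz).2 t ht).1
  refine ⟨ρ, hρ, ε, hε, C, hC, Φ, fun z hz => ⟨(h1 z hz).1, fun t ht => ⟨((h1 z hz).2 t ht).1,
    ((h1 z hz).2 t ht).2.1, ((h1 z hz).2 t ht).2.2, ?_⟩⟩, fun z hz z' hz' t ht => ?_⟩
  · have := norm_sub_smul_le hC (w := z.2) (hd z hz) (fun t ht =>
      (norm_snd_le (Φ z t - z)).trans ((h1 z hz).2 t ht).2.2) ht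
    rwa [(h1 z hz).1] at this
  · have := norm_sub_smul_le (f := fun t => (Φ z t).1 - (Φ z' t).1)
      (mul_nonneg hC (norm_nonneg (z - z'))) (w := z.2 - z'.2)
      (fun t ht => (hd z hz t ht).sub (hd z' hz' t ht)) (fun t ht =>
      (norm_snd_le ((Φ z t - Φ z' t) - (z - z'))).trans (h2 z hz z' hz' t ht)) ht
    simpa only [(h1 z hz).1, (h1 z' hz').1] using this

/-- A map which is close to `t` times the identity covers a ball. -/
theorem surjOn_of_near_smul {f : V → V} {y₀ : V} {ρ C t : ℝ} (hρ : 0 ≤ ρ) (hC : 0 ≤ C) (ht : 0 < t)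
    (hCt : C * t ≤ 1 / 2)
    (hf : ∀ y ∈ Metric.closedBall y₀ ρ, ∀ y' ∈ Metric.closedBall y₀ ρ,
      ‖f y - f y' - t • (y - y')‖ ≤ C * ‖y - y'‖ * t ^ 2) :
    SurjOn f (Metric.closedBall y₀ ρ) (Metric.closedBall (f y₀) (t * ρ / 2)) := by
  -- After division by t the map differs from the identity by a map with Lipschitz constant Ct ≤
  -- 1/2, to which the quantitative surjectivity behind the inverse function theorem applies.
  have h1 : ApproximatesLinearOn (fun y => t⁻¹ • f y) (ContinuousLinearMap.id ℝ V)
      (Metric.closedBall y₀ ρ) ⟨C * t, by positivity⟩ := by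
    intro y hy y' hy'
    have h2 : t⁻¹ • f y - t⁻¹ • f y' - ContinuousLinearMap.id ℝ V (y - y') =
        t⁻¹ • (f y - f y' - t • (y - y')) := by
      simp only [smul_sub, smul_smul, inv_mul_cancel₀ ht.ne', one_smul, ContinuousLinearMap.id_apply]
    rw [h2, norm_smul, norm_inv, Real.norm_of_nonneg ht.le]
    calc t⁻¹ * ‖f y - f y' - t • (y - y')‖ ≤ t⁻¹ * (C * ‖y - y'‖ * t ^ 2) := by
          gcongr; exact hf y hy y' hy'
      _ = C * t * ‖y - y'‖ := by field_simp
  have h2 := h1.surjOn_closedBall_of_nonlinearRightInverse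
    ⟨id, 1, fun y => by simp, fun y => rfl⟩ hρ subset_rfl
  intro x hx
  obtain ⟨y, hy, hyx⟩ := h2 (show t⁻¹ • x ∈ _ by
    rw [mem_closedBall_iff_norm] at hx ⊢
    rw [← smul_sub, norm_smul, norm_inv, Real.norm_of_nonneg ht.le]
    simp only [NNReal.coe_one, inv_one]
    calc t⁻¹ * ‖x - f y₀‖ ≤ t⁻¹ * (t * ρ / 2) := by gcongr
      _ = (1 - 1 / 2) * ρ := by field_simp; norm_num
      _ ≤ (1 - C * t) * ρ := by gcongr)
  exact ⟨y, hy, smul_right_injective V (inv_ne_zero ht.ne') hyx⟩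

end SecondOrder

namespace FinslerStructure

variable [IsManifold (𝓡 n) ∞ M] {𝓕 : FinslerStructure n M}

theorem IsGeodesicOn.exists_unit (hn : 2 ≤ n) (hneg : 𝓕.RicciNegDef)
    (hR : 𝓕.RicciFirstIntegral) {γ : ℝ → M} {J : Set ℝ} (h : 𝓕.IsGeodesicOn γ J) (hJ : IsOpen J)
    (hJ' : J.OrdConnected) {r : ℝ} (hr : r ∈ J) :
    ∃ c > 0, 𝓕.IsUnitGeod (fun t => γ (c⁻¹ * t)) {t | c⁻¹ * t ∈ J} ∧
      c ^ 2 = -(4 / ((n : ℝ) - 1)) * 𝓕.ricciAlong γ r := by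
  have hpos := ricSq_pos hn hneg (γ r) (h.jet_mem hJ hr (mem_chart_source _ _))
  rw [h.ricSq_eq hJ hr (mem_chart_source _ _)] at hpos
  exact ⟨_, Real.sqrt_pos.mpr hpos, h.isUnitGeod hR hJ hJ' hr (Real.sqrt_pos.mpr hpos)
    (Real.sq_sqrt hpos.le).symm, Real.sq_sqrt hpos.le⟩

theorem IsGeodesicOn.exists_link (hn : 2 ≤ n) (hneg : 𝓕.RicciNegDef)
    (hR : 𝓕.RicciFirstIntegral) {γ : ℝ → M} {J : Set ℝ} (h : 𝓕.IsGeodesicOn γ J) (hJ : IsOpen J)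
    (hJ' : J.OrdConnected) {s t : ℝ} (hs : s ∈ J) (ht : t ∈ J) :
    ∃ ℓ, 𝓕.Link (γ s) (γ t) ℓ := by
  obtain ⟨c, hc, h1, -⟩ := h.exists_unit hn hneg hR hJ hJ' hs
  have hmul : ∀ r, c⁻¹ * (c * r) = r := inv_mul_cancel_left₀ hc.ne'
  have h2 := h1.exists_link hn (s := c * s) (t := c * t) (by simpa only [mem_ofPred_eq, hmul])
    (by simpa only [mem_ofPred_eq, hmul])
  simpa only [hmul] using h2

theorem contDiffAt_sprayVec (p : M) {z : E n × E n} (hz : z ∈ slit (chartAt (E n) p).target) :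
    ContDiffAt ℝ 1 (sprayVec (𝓕.loc p)) z :=
  ((𝓕.isCoordFinsler p).contDiffOn_sprayVec.contDiffAt
    ((isOpen_slit (chartAt (E n) p).open_target).mem_nhds hz)).of_le
      (by simp)

theorem exists_ne_zero (hn : 2 ≤ n) : ∃ e : E n, e ≠ 0 :=
  ⟨EuclideanSpace.single ⟨0, by omega⟩ 1, by simp⟩

/-- The points near `P` are joined to `P` by chains. -/
theorem eventually_exists_chain (hn : 2 ≤ n) (hneg : 𝓕.RicciNegDef)
    (hR : 𝓕.RicciFirstIntegral) (P : M) : ∀ᶠ Q in 𝓝 P, ∃ ℓ, Chain 𝓕.Link P Q ℓ := by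
  set x₀ : E n := chartAt (E n) P P with hx₀
  obtain ⟨e, he⟩ := exists_ne_zero hn
  have hz₀ : (x₀, e) ∈ slit (chartAt (E n) P).target := ⟨mem_chart_target _ _, he⟩
  have hW := (isOpen_slit (chartAt (E n) P).open_target).mem_nhds hz₀
  obtain ⟨ρ, hρ, ε, hε, C, hC, Φ, h1, h2⟩ := exists_second_order_flow
    (contDiffAt_sprayVec (𝓕 := 𝓕) P hz₀) hW
  have hgeod : ∀ z ∈ Metric.closedBall (x₀, e) ρ, 𝓕.IsGeodesicOn
      (fun t => (chartAt (E n) P).symm (Φ z t).1) (Ioo (-ε) ε) := fun z hz =>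
    (isGeodesicOn_of_hasDerivAt P isOpen_Ioo (fun t ht => ((h1 z hz).2 t ht).2.1)
      (fun t ht => ((h1 z hz).2 t ht).1)).1
  have h0 : (0 : ℝ) ∈ Ioo (-ε) ε := ⟨neg_lt_zero.mpr hε, hε⟩
  -- a small time
  obtain ⟨t, ht, htε, htC, htρ, hte⟩ : ∃ t > 0, t < ε ∧ C * t ≤ 1 / 2 ∧ C * t ≤ ρ / 8 ∧
      C * t ≤ ρ := by
    refine ⟨min (ε / 2) (min (1 / 2) (ρ / 8) / (C + 1)), by positivity, ?_, ?_⟩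
    · exact (min_le_left _ _).trans_lt (half_lt_self hε)
    · have : C * min (ε / 2) (min (1 / 2) (ρ / 8) / (C + 1)) ≤ min (1 / 2) (ρ / 8) := by
        calc C * min (ε / 2) (min (1 / 2) (ρ / 8) / (C + 1))
            ≤ (C + 1) * (min (1 / 2) (ρ / 8) / (C + 1)) := by
              gcongr
              · linarith
              · exact min_le_right _ _
          _ = _ := by field_simp
      exact ⟨this.trans (min_le_left _ _), this.trans (min_le_right _ _),
        this.trans ((min_le_right _ _).trans (by linarith))⟩
  have htm : t ∈ Ioo (-ε) ε := ⟨by linarith, htε⟩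
  have htm' : -t ∈ Ioo (-ε) ε := ⟨by linarith, by linarith⟩
  have hc₀ : (x₀, e) ∈ Metric.closedBall (x₀, e) ρ := Metric.mem_closedBall_self hρ.le
  -- A Finsler spray need not be smooth at y = 0, so the geodesics issuing from P with small
  -- velocities are avoided. Instead one moves backwards from P along the geodesic with velocity e ≠
  -- 0 to q, and then forwards from q with velocities near e: the endpoints fill a neighbourhood of
  -- P.
  set q : E n := (Φ (x₀, e) (-t)).1 with hq
  have hqx : ‖q - x₀‖ ≤ ρ := by
    have := ((h1 _ hc₀).2 _ htm').2.2.1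
    rw [abs_neg, abs_of_pos ht] at this
    exact (norm_fst_le (Φ (x₀, e) (-t) - (x₀, e))).trans (this.trans hte)
  have hqy : ∀ y ∈ Metric.closedBall e ρ, (q, y) ∈ Metric.closedBall (x₀, e) ρ := fun y hy => by
    rw [← closedBall_prod_same]
    exact ⟨mem_closedBall_iff_norm.mpr hqx, hy⟩
  have hsurj := surjOn_of_near_smul (f := fun y => (Φ (q, y) t).1) (y₀ := e) hρ.le hC ht htC
    (fun y hy y' hy' => by
      have := h2 _ (hqy y hy) _ (hqy y' hy') t htm
      simpa [Prod.norm_def] using this)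
  -- Going back and then forth with coordinate velocity e returns to P up to two errors of order t².
  -- Each is at most tρ/8, so a ball of radius tρ/4 about P remains inside the covered ball of
  -- radius tρ/2.
  have hnear : ‖x₀ - (Φ (q, e) t).1‖ ≤ t * ρ / 4 := by
    have h3 := ((h1 _ hc₀).2 _ htm').2.2.2
    have h4 := ((h1 _ (hqy e (Metric.mem_closedBall_self hρ.le))).2 _ htm).2.2.2
    have h5 : x₀ - (Φ (q, e) t).1 =
        -(q - x₀ - (-t) • e) - ((Φ (q, e) t).1 - q - t • e) := by
      rw [neg_smul]; abel
    rw [h5]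
    refine (norm_sub_le _ _).trans ?_
    rw [norm_neg]
    simp only [neg_sq] at h3
    have h6 : C * t ^ 2 ≤ t * ρ / 8 := by nlinarith
    linarith
  have hN : Metric.ball x₀ (t * ρ / 4) ∈ 𝓝 x₀ := Metric.ball_mem_nhds _ (by positivity)
  have hcont : ContinuousAt (chartAt (E n) P) P := (chartAt (E n) P).continuousAt (mem_chart_source _ _)
  filter_upwards [hcont.preimage_mem_nhds hN, (chartAt (E n) P).open_source.mem_nhds
    (mem_chart_source (E n) P)] with Q hQ hQs
  obtain ⟨y, hy, hyQ⟩ := hsurj (show chartAt (E n) P Q ∈ _ by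
    rw [mem_closedBall_iff_norm]
    have h3 : ‖chartAt (E n) P Q - x₀‖ < t * ρ / 4 := mem_ball_iff_norm.mp hQ
    have h4 := norm_add_le (chartAt (E n) P Q - x₀) (x₀ - (Φ (q, e) t).1)
    rw [sub_add_sub_cancel] at h4
    exact h4.trans (by linarith))
  obtain ⟨ℓ, hℓ⟩ := (hgeod _ hc₀).exists_link hn hneg hR isOpen_Ioo ordConnected_Ioo h0 htm'
  obtain ⟨ℓ', hℓ'⟩ := (hgeod _ (hqy y hy)).exists_link hn hneg hR isOpen_Ioo ordConnected_Ioo h0 htm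
  have e1 : (chartAt (E n) P).symm (Φ (x₀, e) 0).1 = P := by
    rw [(h1 _ hc₀).1]
    exact (chartAt (E n) P).left_inv (mem_chart_source _ _)
  have e2 : (chartAt (E n) P).symm (Φ (q, y) t).1 = Q := by
    simp only at hyQ
    rw [hyQ, (chartAt (E n) P).left_inv hQs]
  rw [e1] at hℓ
  rw [e2, (h1 _ (hqy y hy)).1] at hℓ'
  exact ⟨_, Chain.cons hℓ (Chain.single hℓ')⟩

/-- The set of points reached from P is open by concatenation, and so is its complement because
chains can be reversed. -/
theorem exists_chain [ConnectedSpace M] (hn : 2 ≤ n) (hneg : 𝓕.RicciNegDef)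
    (hR : 𝓕.RicciFirstIntegral) (P Q : M) : ∃ ℓ, Chain 𝓕.Link P Q ℓ := by
  have hev := eventually_exists_chain hn hneg hR
  have hopen : IsOpen {Q | ∃ ℓ, Chain 𝓕.Link P Q ℓ} := isOpen_iff_mem_nhds.mpr fun Q ⟨ℓ, hℓ⟩ => by
    filter_upwards [hev Q] with Q' ⟨ℓ', hℓ'⟩ using ⟨_, hℓ.trans hℓ'⟩
  have hclosed : IsClosed {Q | ∃ ℓ, Chain 𝓕.Link P Q ℓ} := by
    rw [← isOpen_compl_iff, isOpen_iff_mem_nhds]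
    intro Q hQ
    filter_upwards [hev Q] with Q' ⟨ℓ', hℓ'⟩ ⟨ℓ, hℓ⟩
    exact hQ ⟨_, hℓ.trans (hℓ'.symm Link.symm)⟩
  have hne : {Q | ∃ ℓ, Chain 𝓕.Link P Q ℓ}.Nonempty := ⟨P, (hev P).self_of_nhds⟩
  exact (IsClopen.eq_univ ⟨hclosed, hopen⟩ hne).ge (mem_univ Q)

theorem projDist_ne_top [ConnectedSpace M] (hn : 2 ≤ n) (hneg : 𝓕.RicciNegDef)
    (hR : 𝓕.RicciFirstIntegral) (P Q : M) : 𝓕.projDist P Q ≠ ⊤ := by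
  obtain ⟨ℓ, hℓ⟩ := exists_chain hn hneg hR P Q
  exact ((projDist_le hℓ).trans_lt ENNReal.ofReal_lt_top).ne

/-- A nonzero vector is the velocity of a geodesic. -/
theorem exists_isGeodesicOn (p : M) {z : E n × E n} (hz : z ∈ slit (chartAt (E n) p).target) :
    ∃ (γ : ℝ → M) (ε : ℝ), 0 < ε ∧ 𝓕.IsGeodesicOn γ (Ioo (-ε) ε) ∧
      γ 0 = (chartAt (E n) p).symm z.1 ∧ jet p γ 0 = z := by
  obtain ⟨ρ, hρ, ε, hε, C, hC, Φ, h1, -⟩ := exists_second_order_flow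
    (contDiffAt_sprayVec (𝓕 := 𝓕) p hz)
    ((isOpen_slit (chartAt (E n) p).open_target).mem_nhds hz)
  have hc := Metric.mem_closedBall_self (x := z) hρ.le
  obtain ⟨h2, h3⟩ := isGeodesicOn_of_hasDerivAt (𝓕 := 𝓕) p isOpen_Ioo
    (fun t ht => ((h1 z hc).2 t ht).2.1) (fun t ht => ((h1 z hc).2 t ht).1)
  refine ⟨_, ε, hε, h2, ?_, ?_⟩
  · rw [(h1 z hc).1]
  · rw [h3 0 ⟨neg_lt_zero.mpr hε, hε⟩, (h1 z hc).1]

/-- A chain of length ρ(a, a) = 0 still needs a projective map through P, which comes from a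
geodesic with arbitrary nonzero velocity. -/
theorem projDist_self (hn : 2 ≤ n) (hneg : 𝓕.RicciNegDef)
    (hR : 𝓕.RicciFirstIntegral) (P : M) : 𝓕.projDist P P = 0 := by
  obtain ⟨e, he⟩ := exists_ne_zero hn
  obtain ⟨γ, ε, hε, hγ, h0, -⟩ := exists_isGeodesicOn (𝓕 := 𝓕) P
    (z := (chartAt (E n) P P, e)) ⟨mem_chart_target _ _, he⟩
  have h0m : (0 : ℝ) ∈ Ioo (-ε) ε := ⟨neg_lt_zero.mpr hε, hε⟩
  obtain ⟨ℓ, a, b, f, ha, hb, hf, hfa, hfb, -⟩ :=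
    hγ.exists_link hn hneg hR isOpen_Ioo ordConnected_Ioo h0m h0m
  rw [h0, (chartAt (E n) P).left_inv (mem_chart_source _ _)] at hfa
  have := projDist_le (Chain.single (R := 𝓕.Link) ⟨a, a, f, ha, ha, hf, hfa, hfa, rfl⟩)
  rwa [poincare_self ha, ENNReal.ofReal_zero, nonpos_iff_eq_zero] at this

end FinslerStructure

end

section

variable {n : ℕ}


variable {M : Type*} [TopologicalSpace M] [ChartedSpace (E n) M]


/-! ### Curves of bounded coordinate speed, and positivity of the distance -/

/-- A first exit argument. While the curve is in the compact coordinate ball K, the mean value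
inequality bounds its displacement, and `hlt` then keeps it in the open ball; so there is no first
exit time. The Hausdorff property is what makes K closed in M. -/
theorem curve_stays [T2Space M] (p : M) {x₀ : E n} {r : ℝ}
    (hr : Metric.closedBall x₀ r ⊆ (chartAt (E n) p).target) {c : ℝ → M} {a b C : ℝ} (hC : 0 ≤ C)
    (hc : ContinuousOn c (Icc a b))
    (hv : ∀ τ ∈ Icc a b, c τ ∈ (chartAt (E n) p).source →
      readIn p c τ ∈ Metric.closedBall x₀ r → ∃ v, HasDerivAt (readIn (n := n) p c) v τ ∧ ‖v‖ ≤ C)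
    (ha : c a ∈ (chartAt (E n) p).source) (hlt : ‖readIn p c a - x₀‖ + C * (b - a) < r) :
    ∀ τ ∈ Icc a b, c τ ∈ (chartAt (E n) p).source ∧
      ‖readIn (n := n) p c τ - readIn p c a‖ ≤ C * (τ - a) := by
  set φ := chartAt (E n) p with hφ
  set K := φ.symm '' Metric.closedBall x₀ r with hK
  have hKclosed : IsClosed K :=
    ((isCompact_closedBall x₀ r).image_of_continuousOn (φ.continuousOn_symm.mono hr)).isClosed
  have hKmem : ∀ x ∈ K, x ∈ φ.source ∧ φ x ∈ Metric.closedBall x₀ r := by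
    rintro _ ⟨u, hu, rfl⟩
    exact ⟨φ.map_target (hr hu), by rwa [φ.right_inv (hr hu)]⟩
  set K' := φ.source ∩ φ ⁻¹' Metric.ball x₀ r with hK'
  have hK'open : IsOpen K' := φ.isOpen_inter_preimage Metric.isOpen_ball
  have hK'K : K' ⊆ K := fun x hx =>
    ⟨φ x, Metric.ball_subset_closedBall hx.2, φ.left_inv hx.1⟩
  -- the estimate up to a time before which the curve stays in `K`
  have key : ∀ τ ∈ Icc a b, (∀ s ∈ Icc a τ, c s ∈ K) →
      ‖readIn (n := n) p c τ - readIn p c a‖ ≤ C * (τ - a) := by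
    intro τ hτ hs
    have h1 : ∀ s ∈ Icc a τ, ∃ v, HasDerivAt (readIn (n := n) p c) v s ∧ ‖v‖ ≤ C := fun s h =>
      hv s ⟨h.1, h.2.trans hτ.2⟩ (hKmem _ (hs s h)).1 (hKmem _ (hs s h)).2
    choose! v hv1 hv2 using h1
    have := (convex_Icc a τ).norm_image_sub_le_of_norm_hasDerivWithin_le
      (fun s h => (hv1 s h).hasDerivWithinAt) hv2 (left_mem_Icc.mpr hτ.1) (right_mem_Icc.mpr hτ.1)
    rwa [Real.norm_of_nonneg (sub_nonneg.mpr hτ.1)] at this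
  have hmemK' : ∀ τ ∈ Icc a b, c τ ∈ φ.source → ‖readIn (n := n) p c τ - readIn p c a‖ ≤ C * (τ - a) →
      c τ ∈ K' := by
    intro τ hτ h1 h2
    refine ⟨h1, mem_ball_iff_norm.mpr ?_⟩
    have h3 := norm_add_le (readIn p c τ - readIn p c a) (readIn p c a - x₀)
    rw [sub_add_sub_cancel] at h3
    have h4 : C * (τ - a) ≤ C * (b - a) := by gcongr; exact hτ.2
    exact h3.trans_lt (by linarith)
  have hall : ∀ τ ∈ Icc a b, c τ ∈ K' := by
    by_contra! hne
    obtain ⟨τ₁, hτ₁, hτ₁'⟩ := hne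
    set T := Icc a b ∩ c ⁻¹' K'ᶜ with hT
    have hTclosed : IsClosed T := hc.preimage_isClosed_of_isClosed isClosed_Icc hK'open.isClosed_compl
    have hTcpt : IsCompact T := isCompact_Icc.of_isClosed_subset hTclosed inter_subset_left
    have hmin : sInf T ∈ T := hTcpt.sInf_mem ⟨τ₁, hτ₁, hτ₁'⟩
    set τ₀ := sInf T with hτ₀
    have hbelow : ∀ s ∈ Ico a τ₀, c s ∈ K := by
      intro s hs
      by_contra hsK
      exact absurd (csInf_le hTcpt.bddBelow
        (show s ∈ T from ⟨⟨hs.1, hs.2.le.trans hmin.1.2⟩, fun h => hsK (hK'K h)⟩)) (not_le.mpr hs.2)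
    have haK' : c a ∈ K' := hmemK' a (left_mem_Icc.mpr (hτ₁.1.trans hτ₁.2)) ha (by simp)
    have hane : a < τ₀ := lt_of_le_of_ne hmin.1.1 fun h => hmin.2 (h ▸ haK')
    -- At the exit time the curve is still in K, because K is closed; the estimate up to that time
    -- then puts it into the open set K', a contradiction.
    have hτ₀K : c τ₀ ∈ K := by
      have h1 : ContinuousWithinAt c (Ico a τ₀) τ₀ := (hc τ₀ hmin.1).mono
        fun s hs => ⟨hs.1, hs.2.le.trans hmin.1.2⟩
      have h2 := h1.mem_closure (by rw [closure_Ico hane.ne]; exact right_mem_Icc.mpr hane.le)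
        (t := K) hbelow
      rwa [hKclosed.closure_eq] at h2
    refine hmin.2 (hmemK' τ₀ hmin.1 (hKmem _ hτ₀K).1 (key τ₀ hmin.1 fun s hs => ?_))
    rcases hs.2.lt_or_eq with h | h
    · exact hbelow s ⟨hs.1, h⟩
    · exact h ▸ hτ₀K
  exact fun τ hτ => ⟨(hall τ hτ).1, key τ hτ fun s hs => hK'K (hall s ⟨hs.1, hs.2.trans hτ.2⟩)⟩

namespace FinslerStructure

variable [IsManifold (𝓡 n) ∞ M] {𝓕 : FinslerStructure n M}

/-- The Ricci norm is positive on the compact product of the ball and the unit sphere; with m a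
positive lower bound for its square there, C = m^(-1/2), and homogeneity of degree 2 does the rest.
-/
theorem exists_speed_bound (hn : 2 ≤ n) (hneg : 𝓕.RicciNegDef) (p : M) {x₀ : E n} {r : ℝ}
    (hr : Metric.closedBall x₀ r ⊆ (chartAt (E n) p).target) :
    ∃ C > 0, ∀ z : E n × E n, z.1 ∈ Metric.closedBall x₀ r → z.2 ≠ 0 →
      ‖z.2‖ ^ 2 ≤ C ^ 2 * 𝓕.ricSq p z := by
  have hcpt : IsCompact (Metric.closedBall x₀ r ×ˢ Metric.sphere (0 : E n) 1) :=
    (isCompact_closedBall _ _).prod (isCompact_sphere _ _)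
  have hsub : Metric.closedBall x₀ r ×ˢ Metric.sphere (0 : E n) 1 ⊆
      slit (chartAt (E n) p).target := fun z hz => ⟨hr hz.1, fun h0 => by
    have h0 : z.2 = 0 := h0
    simpa [h0] using hz.2⟩
  obtain ⟨m, hm, hmin⟩ := hcpt.exists_forall_le'
    ((contDiffOn_ricSq (𝓕 := 𝓕) p).continuousOn.mono hsub)
    (fun z hz => ricSq_pos hn hneg p (hsub hz))
  refine ⟨√m⁻¹, Real.sqrt_pos.mpr (inv_pos.mpr hm), fun z hz hz2 => ?_⟩
  have hpos : 0 < ‖z.2‖ := norm_pos_iff.mpr hz2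
  have h1 := hmin (z.1, ‖z.2‖⁻¹ • z.2) ⟨hz, by simp [norm_smul, hpos.ne']⟩
  rw [ricSq_smul p ⟨hr hz, hz2⟩ (inv_pos.mpr hpos)] at h1
  rw [Real.sq_sqrt (inv_pos.mpr hm).le]
  rw [inv_pow, ← div_eq_inv_mul, le_div_iff₀ (by positivity)] at h1
  rwa [← div_eq_inv_mul, le_div_iff₀ hm, mul_comm]

theorem IsUnitGeod.norm_jet_le {σ : ℝ → M} {J : Set ℝ} (h : 𝓕.IsUnitGeod σ J) {p : M} {x₀ : E n}
    {r C : ℝ} (hC : 0 < C) (hbd : ∀ z : E n × E n, z.1 ∈ Metric.closedBall x₀ r → z.2 ≠ 0 →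
      ‖z.2‖ ^ 2 ≤ C ^ 2 * 𝓕.ricSq p z) {t : ℝ} (ht : t ∈ J)
    (hp : σ t ∈ (chartAt (E n) p).source) (hball : readIn p σ t ∈ Metric.closedBall x₀ r) :
    ‖(jet (n := n) p σ t).2‖ ≤ C := by
  have h1 := hbd (jet p σ t) hball (h.geod.jet_mem h.isOpen ht hp).2
  rw [h.ricSq_jet ht hp, mul_one] at h1
  exact (sq_le_sq₀ (norm_nonneg _) hC.le).mp h1

/-- A unit geodesic or its reverse does not leave a coordinate ball too early. -/
theorem IsUnitGeod.stays [T2Space M] {σ : ℝ → M} {J : Set ℝ} (h : 𝓕.IsUnitGeod σ J) {p : M}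
    {x₀ : E n} {r C : ℝ} (hr : Metric.closedBall x₀ r ⊆ (chartAt (E n) p).target) (hC : 0 < C)
    (hbd : ∀ z : E n × E n, z.1 ∈ Metric.closedBall x₀ r → z.2 ≠ 0 →
      ‖z.2‖ ^ 2 ≤ C ^ 2 * 𝓕.ricSq p z) {s t : ℝ} (hs : s ∈ J) (ht : t ∈ J)
    (hp : σ s ∈ (chartAt (E n) p).source) (hlt : ‖readIn p σ s - x₀‖ + C * |s - t| < r) :
    ∀ τ ∈ uIcc s t, σ τ ∈ (chartAt (E n) p).source ∧
      ‖readIn (n := n) p σ τ - readIn p σ s‖ ≤ C * |s - τ| := by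
  have hJ : uIcc s t ⊆ J := h.ordConnected.uIcc_subset hs ht
  have hd : ∀ τ ∈ uIcc s t, σ τ ∈ (chartAt (E n) p).source →
      readIn p σ τ ∈ Metric.closedBall x₀ r →
      HasDerivAt (readIn (n := n) p σ) (jet p σ τ).2 τ ∧ ‖(jet p σ τ).2‖ ≤ C := fun τ hτ h1 h2 =>
    ⟨hasDerivAt_readIn (h.geod.contMDiffAt h.isOpen (hJ hτ)) h1, h.norm_jet_le hC hbd (hJ hτ) h1 h2⟩
  have hcont : ContinuousOn σ (uIcc s t) := h.geod.smooth.continuousOn.mono hJ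
  rcases le_total s t with hst | hst
  · rw [uIcc_of_le hst] at hd hcont ⊢
    rw [abs_sub_comm, abs_of_nonneg (sub_nonneg.mpr hst)] at hlt
    intro τ hτ
    rw [abs_sub_comm, abs_of_nonneg (sub_nonneg.mpr hτ.1)]
    exact curve_stays p hr hC.le hcont (fun τ hτ h1 h2 => ⟨_, hd τ hτ h1 h2⟩) hp hlt τ hτ
  · rw [uIcc_of_ge hst] at hd hcont ⊢
    rw [abs_of_nonneg (sub_nonneg.mpr hst)] at hlt
    intro τ hτ
    have hneg : ∀ u ∈ Icc (-s) (-t), -u ∈ Icc t s := fun u hu =>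
      ⟨by linarith [hu.2], by linarith [hu.1]⟩
    -- The reversed curve need not be a geodesic here, but only the bound on its coordinate speed is
    -- used.
    have h1 := curve_stays p hr hC.le (c := fun u => σ (-u)) (a := -s) (b := -t)
      (hcont.comp (by fun_prop) hneg) (fun u hu h1 h2 =>
        ⟨-(jet p σ (-u)).2, by
          simpa using! (hd (-u) (hneg u hu) h1 h2).1.scomp u (hasDerivAt_neg u),
          by rw [norm_neg]; exact (hd (-u) (hneg u hu) h1 h2).2⟩)
      (by simpa using hp) (by simpa [readIn, neg_add_eq_sub] using hlt) (-τ)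
      ⟨by linarith [hτ.2], by linarith [hτ.1]⟩
    rw [abs_of_nonneg (sub_nonneg.mpr hτ.2)]
    simpa [readIn, neg_add_eq_sub] using h1

theorem Step.stays [T2Space M] {p x y : M} {ℓ : ℝ} (h : 𝓕.Step x y ℓ)
    {x₀ : E n} {r C : ℝ} (hr : Metric.closedBall x₀ r ⊆ (chartAt (E n) p).target) (hC : 0 < C)
    (hbd : ∀ z : E n × E n, z.1 ∈ Metric.closedBall x₀ r → z.2 ≠ 0 →
      ‖z.2‖ ^ 2 ≤ C ^ 2 * 𝓕.ricSq p z)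
    (hp : x ∈ (chartAt (E n) p).source) (hlt : ‖chartAt (E n) p x - x₀‖ + C * ℓ < r) :
    y ∈ (chartAt (E n) p).source ∧
      ‖chartAt (E n) p y - chartAt (E n) p x‖ ≤ C * ℓ := by
  obtain ⟨σ, J, s, t, h, hs, ht, rfl, rfl, rfl⟩ := h
  exact h.stays hr hC hbd hs ht hp hlt t right_mem_uIcc

theorem chain_stays [T2Space M] {p x y : M} {ℓ : ℝ} (h : Chain 𝓕.Step x y ℓ)
    {x₀ : E n} {r C : ℝ} (hr : Metric.closedBall x₀ r ⊆ (chartAt (E n) p).target) (hC : 0 < C)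
    (hbd : ∀ z : E n × E n, z.1 ∈ Metric.closedBall x₀ r → z.2 ≠ 0 →
      ‖z.2‖ ^ 2 ≤ C ^ 2 * 𝓕.ricSq p z)
    (hp : x ∈ (chartAt (E n) p).source) (hlt : ‖chartAt (E n) p x - x₀‖ + C * ℓ < r) :
    y ∈ (chartAt (E n) p).source ∧
      ‖chartAt (E n) p y - chartAt (E n) p x‖ ≤ C * ℓ := by
  induction h with
  | single h => exact h.stays hr hC hbd hp hlt
  | @cons x y z ℓ ℓ' h h' ih =>
    have h0 : 0 ≤ ℓ' := by
      clear ih hlt hp h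
      induction h' with
      | single h => exact h.nonneg
      | cons h _ ih => exact add_nonneg h.nonneg ih
    have h0' := mul_nonneg hC.le h0
    rw [mul_add] at hlt
    obtain ⟨h1, h2⟩ := h.stays hr hC hbd hp (by linarith)
    have h3 := norm_add_le (chartAt (E n) p y - chartAt (E n) p x) (chartAt (E n) p x - x₀)
    rw [sub_add_sub_cancel] at h3
    obtain ⟨h4, h5⟩ := ih h1 (by linarith)
    refine ⟨h4, ?_⟩
    have h6 := norm_add_le (chartAt (E n) p z - chartAt (E n) p y)
      (chartAt (E n) p y - chartAt (E n) p x)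
    rw [sub_add_sub_cancel] at h6
    rw [mul_add]
    linarith

theorem exists_step_chain_of_projDist_lt (hn : 2 ≤ n) (hneg : 𝓕.RicciNegDef)
    (hR : 𝓕.RicciFirstIntegral) {x y : M} {c : ℝ}
    (h : 𝓕.projDist x y < ENNReal.ofReal c) : ∃ ℓ < c, Chain 𝓕.Step x y ℓ := by
  obtain ⟨ℓ, h1, h2⟩ := exists_chain_of_projDist_lt h
  obtain ⟨ℓ', h3, h4⟩ := h1.exists_le (R' := 𝓕.Step) fun x y ℓ h => h.exists_step hn hneg hR
  exact ⟨ℓ', h4.trans_lt (ENNReal.ofReal_lt_ofReal_iff'.mp h2).1, h3⟩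

theorem exists_coordBall (hn : 2 ≤ n) (hneg : 𝓕.RicciNegDef) (p : M) : ∃ r > 0, ∃ C > 0,
    Metric.closedBall (chartAt (E n) p p) r ⊆ (chartAt (E n) p).target ∧
    ∀ z : E n × E n, z.1 ∈ Metric.closedBall (chartAt (E n) p p) r → z.2 ≠ 0 →
      ‖z.2‖ ^ 2 ≤ C ^ 2 * 𝓕.ricSq p z := by
  obtain ⟨r, hr, hsub⟩ := Metric.nhds_basis_closedBall.mem_iff.mp
    ((chartAt (E n) p).open_target.mem_nhds (mem_chart_target (E n) p))
  obtain ⟨C, hC, hbd⟩ := exists_speed_bound hn hneg p hsub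
  exact ⟨r, hr, C, hC, hsub, hbd⟩

/-- A vanishing distance gives chains of length below every c > 0; each moves the chart coordinate
by at most Cc, so the coordinates of x and y agree. -/
theorem eq_of_projDist_eq_zero [T2Space M] (hn : 2 ≤ n) (hneg : 𝓕.RicciNegDef)
    (hR : 𝓕.RicciFirstIntegral) {x y : M} (h : 𝓕.projDist x y = 0) : x = y := by
  obtain ⟨r, hr, C, hC, hsub, hbd⟩ := exists_coordBall hn hneg x
  have key : ∀ c > 0, C * c < r → y ∈ (chartAt (E n) x).source ∧
      ‖chartAt (E n) x y - chartAt (E n) x x‖ ≤ C * c := by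
    intro c hc hcr
    obtain ⟨ℓ, hℓ, hch⟩ := exists_step_chain_of_projDist_lt hn hneg hR (x := x) (y := y) (c := c)
      (by rw [h]; exact ENNReal.ofReal_pos.mpr hc)
    have h1 : C * ℓ ≤ C * c := by gcongr
    obtain ⟨h2, h3⟩ := chain_stays hch hsub hC hbd (mem_chart_source _ _) (by
      rw [sub_self, norm_zero, zero_add]; exact h1.trans_lt hcr)
    exact ⟨h2, h3.trans h1⟩
  have hc₀ : 0 < r / (2 * C) := by positivity
  have hlt : C * (r / (2 * C)) < r := by
    have : C * (r / (2 * C)) = r / 2 := by field_simp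
    linarith
  have hy := (key _ hc₀ hlt).1
  have h0 : ‖chartAt (E n) x y - chartAt (E n) x x‖ ≤ 0 := by
    refine le_of_forall_pos_le_add fun ε hε => ?_
    rw [zero_add]
    have h1 := (key (min (r / (2 * C)) (ε / C)) (by positivity)
      (lt_of_le_of_lt (by gcongr; exact min_le_left _ _) hlt)).2
    refine h1.trans ?_
    calc C * min (r / (2 * C)) (ε / C) ≤ C * (ε / C) := by gcongr; exact min_le_right _ _
      _ = ε := by field_simp
  exact ((chartAt (E n) x).injOn hy (mem_chart_source _ _)
    (sub_eq_zero.mp (norm_le_zero_iff.mp h0))).symm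

theorem isDistance_projDist [T2Space M] [ConnectedSpace M] (hn : 2 ≤ n) (hneg : 𝓕.RicciNegDef)
    (hR : 𝓕.RicciFirstIntegral) : IsDistance 𝓕.projDist where
  finite := projDist_ne_top hn hneg hR
  eq_zero_iff x _ := ⟨eq_of_projDist_eq_zero hn hneg hR, fun h => h ▸ projDist_self hn hneg hR x⟩
  symm := projDist_comm
  triangle := projDist_triangle

end FinslerStructure

end

section

variable {n : ℕ}


/-! ### The spray of a Riemannian metric in coordinates -/

section MetricSpray

variable {V : Type*} [NormedAddCommGroup V] [NormedSpace ℝ V]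

/-- The linear form `ξ ↦ (D_y h)(y, ξ) - (1/2) (D_ξ h)(y, y)`. -/
def metricForce (h : V → V →L[ℝ] V →L[ℝ] ℝ) (z : V × V) : V →L[ℝ] ℝ :=
  fderiv ℝ h z.1 z.2 z.2 - (1 / 2 : ℝ) • ((fderiv ℝ h z.1).flip z.2).flip z.2

/-- The spray of the metric `h`. -/
def metricSpray (h : V → V →L[ℝ] V →L[ℝ] ℝ) (z : V × V) : V :=
  (h z.1).inverse (metricForce h z)

theorem metricForce_apply (h : V → V →L[ℝ] V →L[ℝ] ℝ) (z : V × V) (ξ : V) :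
    metricForce h z ξ = fderiv ℝ h z.1 z.2 z.2 ξ - (1 / 2) * fderiv ℝ h z.1 ξ z.2 z.2 := rfl

theorem metricForce_smul (h : V → V →L[ℝ] V →L[ℝ] ℝ) (x y : V) (c : ℝ) :
    metricForce h (x, c • y) = c ^ 2 • metricForce h (x, y) := by
  ext ξ
  simp only [metricForce_apply, map_smul, smul_apply, smul_eq_mul]
  ring

theorem metricSpray_smul (h : V → V →L[ℝ] V →L[ℝ] ℝ) (x y : V) (c : ℝ) :
    metricSpray h (x, c • y) = c ^ 2 • metricSpray h (x, y) := by
  rw [metricSpray, metricForce_smul, map_smul, metricSpray]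

variable [FiniteDimensional ℝ V]

/-- Definiteness gives injectivity, and V and its dual have the same dimension. -/
theorem isInvertible_of_posDef {b : V →L[ℝ] V →L[ℝ] ℝ} (hb : ∀ w, w ≠ 0 → 0 < b w w) :
    b.IsInvertible := by
  have hinj : Function.Injective b.toLinearMap := by
    rw [← LinearMap.ker_eq_bot, LinearMap.ker_eq_bot']
    intro w hw
    by_contra h0
    have h1 := hb w h0
    rw [show b w = 0 from hw] at h1
    exact lt_irrefl _ h1
  have hfin : Module.finrank ℝ V = Module.finrank ℝ (V →L[ℝ] ℝ) := by
    rw [← (LinearMap.toContinuousLinearMap (𝕜 := ℝ) (E := V) (F' := ℝ)).finrank_eq]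
    exact (Subspace.dual_finrank_eq (K := ℝ) (V := V)).symm
  have : FiniteDimensional ℝ (V →L[ℝ] ℝ) :=
    (LinearMap.toContinuousLinearMap (𝕜 := ℝ) (E := V) (F' := ℝ)).finiteDimensional
  exact ⟨(LinearEquiv.ofInjectiveOfFinrankEq b.toLinearMap hinj hfin).toContinuousLinearEquiv, by
    ext v w; rfl⟩

theorem metricSpray_spec {h : V → V →L[ℝ] V →L[ℝ] ℝ} {z : V × V}
    (hb : ∀ w, w ≠ 0 → 0 < h z.1 w w) : h z.1 (metricSpray h z) = metricForce h z := by
  obtain ⟨e, he⟩ := isInvertible_of_posDef hb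
  rw [metricSpray, ← he, ContinuousLinearMap.inverse_equiv]
  exact e.apply_symm_apply _

theorem eq_metricSpray {h : V → V →L[ℝ] V →L[ℝ] ℝ} {z : V × V}
    (hb : ∀ w, w ≠ 0 → 0 < h z.1 w w) {a : V} (ha : ∀ ξ, h z.1 a ξ = metricForce h z ξ) :
    a = metricSpray h z := by
  by_contra hne
  have h1 := hb _ (sub_ne_zero.mpr hne)
  have h2 : h z.1 (a - metricSpray h z) = 0 := by
    rw [map_sub, metricSpray_spec hb, ContinuousLinearMap.ext ha, sub_self]
  rw [h2] at h1
  exact lt_irrefl _ h1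

/-- There is no condition on the direction: the Riemannian spray is regular also at zero velocity,
which later makes geodesics with small initial velocities usable. -/
theorem contDiffAt_metricSpray {h : V → V →L[ℝ] V →L[ℝ] ℝ} {z : V × V}
    (hh : ContDiffAt ℝ ∞ h z.1) (hb : ∀ w, w ≠ 0 → 0 < h z.1 w w) :
    ContDiffAt ℝ 1 (metricSpray h) z := by
  have : CompleteSpace V := FiniteDimensional.complete ℝ V
  have h1 : ContDiffAt ℝ 1 (fun z : V × V => h z.1) z :=
    ContDiffAt.comp z (g := h) (f := Prod.fst) (hh.of_le (by simp))
      contDiffAt_fst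
  have h2 : ContDiffAt ℝ 1 (fderiv ℝ h) z.1 :=
    hh.fderiv_right (by simpa [one_add_one_eq_two] using ENat.LEInfty.out)
  have h3 : ContDiffAt ℝ 1 (fun z : V × V => fderiv ℝ h z.1) z :=
    ContDiffAt.comp z (g := fderiv ℝ h) (f := Prod.fst) h2 contDiffAt_fst
  have h4 : ContDiffAt ℝ 1 (fun z : V × V => (fderiv ℝ h z.1).flip) z :=
    (ContinuousLinearMap.flipₗᵢ ℝ V V (V →L[ℝ] ℝ)).contDiff.contDiffAt.comp z h3
  have h5 : ContDiffAt ℝ 1 (fun z : V × V => ((fderiv ℝ h z.1).flip z.2).flip) z :=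
    (ContinuousLinearMap.flipₗᵢ ℝ V V ℝ).contDiff.contDiffAt.comp z (h4.clm_apply contDiffAt_snd)
  have h6 : ContDiffAt ℝ 1 (metricForce h) z :=
    ((h3.clm_apply contDiffAt_snd).clm_apply contDiffAt_snd).sub
      ((h5.clm_apply contDiffAt_snd).const_smul (1 / 2 : ℝ))
  exact (((isInvertible_of_posDef hb).contDiffAt_map_inverse (n := 1)).comp z h1).clm_apply h6

/-- Solutions of the geodesic equation of a metric have constant speed. -/
theorem metric_speed_const {h : V → V →L[ℝ] V →L[ℝ] ℝ} {U : Set V} (hU : IsOpen U)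
    (hh : ContDiffOn ℝ ∞ h U) (hsymm : ∀ x ∈ U, ∀ a b, h x a b = h x b a)
    (hb : ∀ x ∈ U, ∀ w, w ≠ 0 → 0 < h x w w) {ε : ℝ} {g : ℝ → V × V}
    (hg : ∀ t ∈ Ioo (-ε) ε, HasDerivAt g ((g t).2, -metricSpray h (g t)) t)
    (hmem : ∀ t ∈ Ioo (-ε) ε, (g t).1 ∈ U) {t : ℝ} (ht : t ∈ Ioo (-ε) ε) :
    h (g t).1 (g t).2 (g t).2 = h (g 0).1 (g 0).2 (g 0).2 := by
  have key : ∀ t ∈ Ioo (-ε) ε, HasDerivAt (fun t => h (g t).1 (g t).2 (g t).2) 0 t := by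
    intro t ht
    have h1 : HasDerivAt (fun t => (g t).1) (g t).2 t :=
      (hasFDerivAt_fst (𝕜 := ℝ) (p := g t)).comp_hasDerivAt t (hg t ht)
    have h2 : HasDerivAt (fun t => (g t).2) (-metricSpray h (g t)) t :=
      (hasFDerivAt_snd (𝕜 := ℝ) (p := g t)).comp_hasDerivAt t (hg t ht)
    have h3 : HasFDerivAt h (fderiv ℝ h (g t).1) (g t).1 :=
      ((hh.contDiffAt (hU.mem_nhds (hmem t ht))).differentiableAt (by simp)).hasFDerivAt
    have h6 : HasDerivAt (fun t => h (g t).1) (fderiv ℝ h (g t).1 (g t).2) t :=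
      HasFDerivAt.comp_hasDerivAt (f := fun t => (g t).1) t h3 h1
    have h7 : HasDerivAt (fun t => h (g t).1 (g t).2)
        (fderiv ℝ h (g t).1 (g t).2 (g t).2 + h (g t).1 (-metricSpray h (g t))) t :=
      h6.clm_apply h2
    have h8 := h7.clm_apply h2
    refine h8.congr_deriv ?_
    -- The geodesic equation tested on the velocity: h(S, y) = (1/2) D_yh(y, y), with S the spray,
    -- cancels the variation of h along the curve.
    have h4 := congrArg (fun ℓ : V →L[ℝ] ℝ => ℓ (g t).2)
      (metricSpray_spec (h := h) (z := g t) (hb _ (hmem t ht)))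
    simp only [metricForce_apply] at h4
    have h5 := hsymm _ (hmem t ht) (g t).2 (metricSpray h (g t))
    simp only [add_apply, map_neg, neg_apply]
    linarith
  exact isOpen_Ioo.is_const_of_deriv_eq_zero isPreconnected_Ioo
    (fun t ht => (key t ht).differentiableAt.differentiableWithinAt)
    (fun t ht => (key t ht).deriv) ht ⟨by linarith [ht.1, ht.2], by linarith [ht.1, ht.2]⟩

end MetricSpray

end

section

variable {n : ℕ}


variable {M : Type*} [TopologicalSpace M] [ChartedSpace (E n) M]


theorem eventually_ne_of_continuousAt {X : Type*} [TopologicalSpace X] [T2Space X] {f g : ℝ → X}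
    {t : ℝ} (hf : ContinuousAt f t) (hg : ContinuousAt g t) (h : f t ≠ g t) :
    ∀ᶠ τ in 𝓝 t, f τ ≠ g τ :=
  (hf.prodMk hg).eventually (isClosed_diagonal.isOpen_compl.mem_nhds h)

namespace FinslerStructure

variable [IsManifold (𝓡 n) ∞ M] {𝓕 : FinslerStructure n M}

/-! ### The Riemannian metric `-4/(n-1) Ric` when the Ricci tensor is parallel -/

variable (𝓕) in
/-- The Ricci tensor is parallel for the Berwald or the Chern connection. -/
def RicciParallel : Prop := 𝓕.BerwaldParallel ∨ 𝓕.ChernParallel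

theorem RicciParallel.firstIntegral (h : 𝓕.RicciParallel) : 𝓕.RicciFirstIntegral :=
  ricciFirstIntegral (h.imp And.left And.left)

theorem RicciParallel.vert (h : 𝓕.RicciParallel) : 𝓕.VertParallel := h.elim And.right And.right

/-- A nonzero vector. -/
def someVec (n : ℕ) : E n := WithLp.toLp 2 fun _ => 1

theorem someVec_ne_zero (hn : 2 ≤ n) : someVec n ≠ 0 := fun h0 => by
  have := congrArg (fun v : E n => v ⟨0, by omega⟩) h0
  simp [someVec] at this

variable (𝓕) in
/-- The coordinate expression of `-4/(n-1) Ric`. -/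
def form (p : M) : E n → E n →L[ℝ] E n →L[ℝ] ℝ := ricForm (𝓕.loc p) (someVec n)

theorem contDiffOn_form (hn : 2 ≤ n) (p : M) :
    ContDiffOn ℝ ∞ (𝓕.form p) (chartAt (E n) p).target :=
  (𝓕.isCoordFinsler p).contDiffOn_ricForm (someVec_ne_zero hn)

theorem contDiffAt_form (hn : 2 ≤ n) (p : M) {x : E n} (hx : x ∈ (chartAt (E n) p).target) :
    ContDiffAt ℝ ∞ (𝓕.form p) x :=
  (contDiffOn_form hn p).contDiffAt ((chartAt (E n) p).open_target.mem_nhds hx)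

theorem form_symm (hn : 2 ≤ n) (p : M) {x : E n} (hx : x ∈ (chartAt (E n) p).target) (a b : E n) :
    𝓕.form p x a b = 𝓕.form p x b a :=
  (𝓕.isCoordFinsler p).ricForm_symm (someVec_ne_zero hn) hx a b

theorem form_self (hn : 2 ≤ n) (hpar : 𝓕.RicciParallel) (p : M) {z : E n × E n}
    (hz : z ∈ slit (chartAt (E n) p).target) : 𝓕.form p z.1 z.2 z.2 = 𝓕.ricSq p z :=
  (𝓕.isCoordFinsler p).ricForm_self hn (hpar.vert p) hz.1 (someVec_ne_zero hn) hz.2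

theorem form_pos (hn : 2 ≤ n) (hneg : 𝓕.RicciNegDef) (hpar : 𝓕.RicciParallel) (p : M) {x : E n}
    (hx : x ∈ (chartAt (E n) p).target) (w : E n) (hw : w ≠ 0) : 0 < 𝓕.form p x w w := by
  rw [form_self hn hpar p (z := (x, w)) ⟨hx, hw⟩]
  exact ricSq_pos hn hneg p ⟨hx, hw⟩

theorem form_sprayVec (hn : 2 ≤ n) (hpar : 𝓕.RicciParallel) (p : M) {z : E n × E n}
    (hz : z ∈ slit (chartAt (E n) p).target) (ξ : E n) :
    𝓕.form p z.1 (sprayVec (𝓕.loc p) z) ξ = metricForce (𝓕.form p) z ξ := by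
  have hF := 𝓕.isCoordFinsler p
  rw [metricForce_apply]
  rcases hpar with h | h
  · exact hF.ricForm_sprayVec hn (h.2 p) hz.1 (someVec_ne_zero hn) hz.2 (hF.berwald_contract hz)
      (hF.berwald_symm hz) (h.1 p _ hz.1 _ hz.2) ξ
  · exact hF.ricForm_sprayVec hn (h.2 p) hz.1 (someVec_ne_zero hn) hz.2 (hF.chern_contract hz)
      (hF.chern_symm hz) (h.1 p _ hz.1 _ hz.2) ξ

/-- The geodesics of F are thus those of the Riemannian metric -4/(n-1) Ric, although F itself need
not be Riemannian or reversible. -/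
theorem sprayVec_eq_metricSpray (hn : 2 ≤ n) (hneg : 𝓕.RicciNegDef) (hpar : 𝓕.RicciParallel) (p : M)
    {z : E n × E n} (hz : z ∈ slit (chartAt (E n) p).target) :
    sprayVec (𝓕.loc p) z = metricSpray (𝓕.form p) z :=
  eq_metricSpray (form_pos hn hneg hpar p hz.1) (form_sprayVec hn hpar p hz)

/-- A Riemannian spray is quadratic in y, so negative factors are allowed; this supplies the
hypothesis of `IsGeodesicOn.comp_affine` for time reversal. -/
theorem sprayVec_smul_of_ne (hn : 2 ≤ n) (hneg : 𝓕.RicciNegDef) (hpar : 𝓕.RicciParallel) {a : ℝ}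
    (ha : a ≠ 0) (p : M) (z : E n × E n) (hz : z ∈ slit (chartAt (E n) p).target) :
    sprayVec (𝓕.loc p) (z.1, a • z.2) = a ^ 2 • sprayVec (𝓕.loc p) z := by
  rw [sprayVec_eq_metricSpray hn hneg hpar p hz,
    sprayVec_eq_metricSpray hn hneg hpar p (z := (z.1, a • z.2)) ⟨hz.1, smul_ne_zero ha hz.2⟩,
    metricSpray_smul]

theorem ricScalar_smul_of_ne (hn : 2 ≤ n) (hpar : 𝓕.RicciParallel) {a : ℝ}
    (ha : a ≠ 0) (p : M) (z : E n × E n) (hz : z ∈ slit (chartAt (E n) p).target) :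
    ricScalar (𝓕.loc p) z.1 (a • z.2) = a ^ 2 * ricScalar (𝓕.loc p) z.1 z.2 := by
  have h1 := form_self hn hpar p hz
  have h2 := form_self hn hpar p (z := (z.1, a • z.2)) ⟨hz.1, smul_ne_zero ha hz.2⟩
  simp only [map_smul, smul_apply, smul_eq_mul, h1, ricSq] at h2
  have h3 := coef_pos hn
  have h4 : -(4 / ((n : ℝ) - 1)) ≠ 0 := (neg_neg_of_pos h3).ne
  refine mul_left_cancel₀ h4 ?_
  rw [← h2]
  ring

/-- The reverse of a unit geodesic is a unit geodesic. -/
theorem IsUnitGeod.reverse (hn : 2 ≤ n) (hneg : 𝓕.RicciNegDef) (hpar : 𝓕.RicciParallel) {σ : ℝ → M}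
    {J : Set ℝ} (h : 𝓕.IsUnitGeod σ J) : 𝓕.IsUnitGeod (fun t => σ (-1 * t + 0)) {t | -1 * t + 0 ∈ J} := by
  have hne : (-1 : ℝ) ≠ 0 := by norm_num
  have h1 := h.geod.comp_affine h.isOpen hne 0 (sprayVec_smul_of_ne hn hneg hpar hne)
  refine ⟨h.isOpen.preimage (by fun_prop), ⟨fun x hx y hy z hz => ?_⟩, h1, fun t ht => ?_⟩
  · refine h.ordConnected.out hy hx ⟨?_, ?_⟩
    · linarith [hz.2]
    · linarith [hz.1]
  · rw [h.geod.ricciAlong_comp_affine h.isOpen h1 (ricScalar_smul_of_ne hn hpar hne) ht]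
    have := h.unit _ ht
    linarith

/-! ### Uniqueness of geodesics -/

theorem IsGeodesicOn.eventuallyEq {γ₁ γ₂ : ℝ → M} {J : Set ℝ} (h₁ : 𝓕.IsGeodesicOn γ₁ J)
    (h₂ : 𝓕.IsGeodesicOn γ₂ J) (hJ : IsOpen J) {t : ℝ} (ht : t ∈ J) {p : M}
    (hp₁ : γ₁ t ∈ (chartAt (E n) p).source) (hp₂ : γ₂ t ∈ (chartAt (E n) p).source)
    (heq : jet (n := n) p γ₁ t = jet p γ₂ t) : γ₁ =ᶠ[𝓝 t] γ₂ := by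
  have hz := h₁.jet_mem hJ ht hp₁
  have hV : ContDiffAt ℝ 1 (fun z : E n × E n => (z.2, -sprayVec (𝓕.loc p) z)) (jet p γ₁ t) :=
    contDiffAt_snd.prodMk (contDiffAt_sprayVec p hz).neg
  obtain ⟨K, s, hs, hl⟩ := hV.exists_lipschitzOnWith
  have key : ∀ {γ : ℝ → M}, 𝓕.IsGeodesicOn γ J → γ t ∈ (chartAt (E n) p).source →
      jet (n := n) p γ₁ t = jet p γ t → ∀ᶠ τ in 𝓝 t,
        HasDerivAt (jet p γ) ((jet p γ τ).2, -sprayVec (𝓕.loc p) (jet p γ τ)) τ ∧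
          jet p γ τ ∈ s := by
    intro γ h hp heq
    have hc := (h.hasDerivAt_jet hJ ht hp).continuousAt
    filter_upwards [hJ.mem_nhds ht, eventually_mem (h.contMDiffAt hJ ht) hp,
      hc.preimage_mem_nhds (heq ▸ hs)] with τ h1 h2 h3
    exact ⟨h.hasDerivAt_jet hJ h1 h2, h3⟩
  have := ODE_solution_unique_of_eventually (v := fun _ z => (z.2, -sprayVec (𝓕.loc p) z))
    (s := fun _ => s) (Eventually.of_forall fun _ => hl) (key h₁ hp₁ rfl) (key h₂ hp₂ heq) heq
  filter_upwards [this, eventually_mem (h₁.contMDiffAt hJ ht) hp₁,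
    eventually_mem (h₂.contMDiffAt hJ ht) hp₂] with τ h1 h2 h3
  exact (chartAt (E n) p).injOn h2 h3 (congrArg Prod.fst h1)

theorem jet_congr {γ₁ γ₂ : ℝ → M} {t : ℝ} (h : γ₁ =ᶠ[𝓝 t] γ₂) (p : M) :
    jet (n := n) p γ₁ t = jet p γ₂ t := by
  have : readIn (n := n) p γ₁ =ᶠ[𝓝 t] readIn p γ₂ := by
    filter_upwards [h] with τ hτ using by rw [readIn, readIn, hτ]
  exact Prod.ext this.eq_of_nhds this.deriv_eq

/-- The set of times near which the curves agree is open. It is closed in J because at a limit time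
positions and velocities agree by continuity, so that local uniqueness applies. -/
theorem IsGeodesicOn.eqOn [T2Space M] {γ₁ γ₂ : ℝ → M} {J : Set ℝ} (h₁ : 𝓕.IsGeodesicOn γ₁ J)
    (h₂ : 𝓕.IsGeodesicOn γ₂ J) (hJ : IsOpen J) (hJ' : J.OrdConnected) {t₀ : ℝ} (ht₀ : t₀ ∈ J)
    (heq : γ₁ =ᶠ[𝓝 t₀] γ₂) : EqOn γ₁ γ₂ J := by
  have hopen : IsOpen {t | γ₁ =ᶠ[𝓝 t] γ₂} := isOpen_setOfPred_eventually_nhds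
  refine fun t ht => Filter.EventuallyEq.eq_of_nhds
    ((isPreconnected_iff_ordConnected.mpr hJ').subset_of_closure_inter_subset hopen
    ⟨t₀, ht₀, heq⟩ ?_ ht)
  rintro t ⟨htc, ht⟩
  have hfreq : ∃ᶠ τ in 𝓝 t, γ₁ =ᶠ[𝓝 τ] γ₂ := mem_closure_iff_frequently.mp htc
  have c₁ := (h₁.contMDiffAt hJ ht).continuousAt
  have c₂ := (h₂.contMDiffAt hJ ht).continuousAt
  have hval : γ₁ t = γ₂ t := by
    by_contra hne
    obtain ⟨τ, h1, h2⟩ := (hfreq.and_eventually (eventually_ne_of_continuousAt c₁ c₂ hne)).exists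
    exact h2 h1.eq_of_nhds
  have hp₁ := mem_chart_source (E n) (γ₁ t)
  have hp₂ : γ₂ t ∈ (chartAt (E n) (γ₁ t)).source := hval ▸ hp₁
  refine h₁.eventuallyEq h₂ hJ ht hp₁ hp₂ ?_
  by_contra hne
  obtain ⟨τ, h1, h2⟩ := (hfreq.and_eventually
    (eventually_ne_of_continuousAt (h₁.hasDerivAt_jet hJ ht hp₁).continuousAt
      (h₂.hasDerivAt_jet hJ ht hp₂).continuousAt hne)).exists
  exact h2 (jet_congr h1 _)

/-! ### Extension of unit geodesics to the whole line -/

/-- Every condition defining a unit geodesic is local in time, so geodesics can be glued. -/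
theorem IsUnitGeod.congr_of_eventuallyEq {γ : ℝ → M}
    (h : ∀ t, ∃ (σ : ℝ → M) (J : Set ℝ), 𝓕.IsUnitGeod σ J ∧ t ∈ J ∧ γ =ᶠ[𝓝 t] σ) :
    𝓕.IsUnitGeod γ univ := by
  have hcoord : ∀ {t : ℝ} {σ : ℝ → M}, γ =ᶠ[𝓝 t] σ →
      coordCurve (n := n) γ t =ᶠ[𝓝 t] coordCurve σ t := fun {t σ} h => by
    filter_upwards [h] with τ hτ
    rw [coordCurve, coordCurve, hτ, h.eq_of_nhds]
  have hvel : ∀ {t : ℝ} {σ : ℝ → M}, γ =ᶠ[𝓝 t] σ →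
      velocity (n := n) γ t = velocity σ t := fun {t σ} h => (hcoord h).deriv_eq
  refine ⟨isOpen_univ, ordConnected_univ, ⟨fun t _ => ?_, fun t _ => ?_, fun t _ i => ?_⟩,
    fun t _ => ?_⟩
  · obtain ⟨σ, J, hσ, ht, he⟩ := h t
    exact ((hσ.geod.contMDiffAt hσ.isOpen ht).congr_of_eventuallyEq he).contMDiffWithinAt
  · obtain ⟨σ, J, hσ, ht, he⟩ := h t
    rw [hvel he]
    exact hσ.geod.regular t ht
  · obtain ⟨σ, J, hσ, ht, he⟩ := h t
    rw [hvel he, (hcoord he).deriv.deriv_eq, (hcoord he).eq_of_nhds, he.eq_of_nhds]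
    exact hσ.geod.equation t ht i
  · obtain ⟨σ, J, hσ, ht, he⟩ := h t
    refine Eq.trans ?_ (hσ.unit t ht)
    rw [ricciAlong, ricciAlong, hvel he, (hcoord he).eq_of_nhds, he.eq_of_nhds]

theorem exists_forward_unitGeod (hpar : 𝓕.RicciParallel) (hc : 𝓕.IsComplete) {x : M} {v : E n}
    (hv : v ≠ 0) (hunit : 𝓕.ricSq x (chartAt (E n) x x, v) = 1) :
    ∃ (γ : ℝ → M) (a : ℝ), a < 0 ∧ 𝓕.IsUnitGeod γ (Ioi a) ∧ γ 0 = x ∧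
      jet x γ 0 = (chartAt (E n) x x, v) := by
  obtain ⟨γ, a, ha, hγ, hx, hvel⟩ := hc x v hv
  have hjet : jet x γ 0 = (chartAt (E n) x x, v) := by
    refine Prod.ext ?_ ?_
    · change chartAt (E n) x (γ 0) = _
      rw [hx]
    · rw [← hvel, velocity]
      subst hx
      rfl
  refine ⟨γ, a, ha, ⟨isOpen_Ioi, ordConnected_Ioi, hγ, fun t ht => ?_⟩, hx, hjet⟩
  rw [hγ.ricciAlong_const hpar.firstIntegral isOpen_Ioi ordConnected_Ioi ht (mem_Ioi.mpr ha),
    ← hγ.ricSq_eq (p := x) isOpen_Ioi (mem_Ioi.mpr ha) (by rw [hx]; exact mem_chart_source _ _), hjet,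
    hunit]

/-- Only forward completeness is assumed. The past is the reversal of the forward geodesic with
velocity -v; the two pieces have the same position and velocity at 0, hence agree where both are
defined. -/
theorem exists_unitGeod_univ [T2Space M] (hn : 2 ≤ n) (hneg : 𝓕.RicciNegDef)
    (hpar : 𝓕.RicciParallel) (hc : 𝓕.IsComplete) {x : M} {v : E n}
    (hv : v ≠ 0) (hunit : 𝓕.ricSq x (chartAt (E n) x x, v) = 1) :
    ∃ γ : ℝ → M, 𝓕.IsUnitGeod γ univ ∧ γ 0 = x ∧ jet x γ 0 = (chartAt (E n) x x, v) := by
  obtain ⟨γ₁, a₁, ha₁, h₁, hx₁, hj₁⟩ := exists_forward_unitGeod hpar hc hv hunit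
  have hz : (chartAt (E n) x x, v) ∈ slit (chartAt (E n) x).target := ⟨mem_chart_target _ _, hv⟩
  have hz' : (chartAt (E n) x x, -v) ∈ slit (chartAt (E n) x).target :=
    ⟨mem_chart_target _ _, neg_ne_zero.mpr hv⟩
  have hunit' : 𝓕.ricSq x (chartAt (E n) x x, -v) = 1 := by
    rw [← hunit, ← form_self hn hpar x hz, ← form_self hn hpar x hz']
    simp
  obtain ⟨γ₂, a₂, ha₂, h₂, hx₂, hj₂⟩ := exists_forward_unitGeod hpar hc (neg_ne_zero.mpr hv) hunit'
  have h₃ := h₂.reverse hn hneg hpar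
  set γ₃ : ℝ → M := fun t => γ₂ (-1 * t + 0) with hγ₃
  have hJ₃ : {t : ℝ | -1 * t + 0 ∈ Ioi a₂} = Iio (-a₂) := by
    ext t
    simp only [mem_ofPred_eq, mem_Ioi, mem_Iio]
    constructor <;> intro h <;> linarith
  rw [hJ₃] at h₃
  have hj₃ : jet x γ₃ 0 = (chartAt (E n) x x, v) := by
    rw [hγ₃, jet_comp_affine, mul_zero, add_zero, hj₂]
    simp
  have hx₃ : γ₃ 0 = x := by rw [hγ₃]; simpa using hx₂
  have h0 : (0 : ℝ) ∈ Ioo a₁ (-a₂) := ⟨ha₁, by linarith⟩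
  have hg₁ := h₁.geod.mono (J' := Ioo a₁ (-a₂)) fun t ht => ht.1
  have hg₃ := h₃.geod.mono (J' := Ioo a₁ (-a₂)) fun t ht => ht.2
  have heq : EqOn γ₁ γ₃ (Ioo a₁ (-a₂)) := hg₁.eqOn hg₃ isOpen_Ioo ordConnected_Ioo h0
    (hg₁.eventuallyEq hg₃ isOpen_Ioo h0 (p := x) (by rw [hx₁]; exact mem_chart_source _ _)
      (by rw [hx₃]; exact mem_chart_source _ _) (hj₁.trans hj₃.symm))
  set γ : ℝ → M := fun t => if 0 ≤ t then γ₁ t else γ₃ t with hγ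
  have e₁ : EqOn γ γ₁ (Ioi a₁) := fun t ht => by
    by_cases h : 0 ≤ t
    · simp only [hγ, if_pos h]
    · simp only [hγ, if_neg h]
      exact (heq ⟨ht, by linarith⟩).symm
  have e₃ : EqOn γ γ₃ (Iio (-a₂)) := fun t ht => by
    by_cases h : 0 ≤ t
    · simp only [hγ, if_pos h]
      exact heq ⟨by linarith, ht⟩
    · simp only [hγ, if_neg h]
  have ev₁ : ∀ t ∈ Ioi a₁, γ =ᶠ[𝓝 t] γ₁ := fun t ht => e₁.eventuallyEq_of_mem (isOpen_Ioi.mem_nhds ht)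
  refine ⟨γ, IsUnitGeod.congr_of_eventuallyEq fun t => ?_, ?_, ?_⟩
  · rcases lt_or_ge a₁ t with ht | ht
    · exact ⟨γ₁, _, h₁, ht, ev₁ t ht⟩
    · have ht' : t ∈ Iio (-a₂) := mem_Iio.mpr (by linarith)
      exact ⟨γ₃, _, h₃, ht', e₃.eventuallyEq_of_mem (isOpen_Iio.mem_nhds ht')⟩
  · rw [e₁ (mem_Ioi.mpr ha₁), hx₁]
  · rw [jet_congr (ev₁ 0 (mem_Ioi.mpr ha₁)), hj₁]

/-- In the complete case every unit geodesic extends to the whole line. -/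
theorem IsUnitGeod.exists_extension [T2Space M] (hn : 2 ≤ n) (hneg : 𝓕.RicciNegDef)
    (hpar : 𝓕.RicciParallel) (hc : 𝓕.IsComplete) {σ : ℝ → M} {J : Set ℝ} (h : 𝓕.IsUnitGeod σ J)
    {t₀ : ℝ} (ht₀ : t₀ ∈ J) : ∃ γ : ℝ → M, 𝓕.IsUnitGeod γ univ ∧ EqOn γ σ J := by
  have hp := mem_chart_source (E n) (σ t₀)
  obtain ⟨γ, hγ, h0, hj⟩ := exists_unitGeod_univ hn hneg hpar hc (x := σ t₀)
    (v := (jet (σ t₀) σ t₀).2) (h.geod.jet_mem h.isOpen ht₀ hp).2 (h.ricSq_jet ht₀ hp)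
  have hγ' := hγ.shift (-t₀)
  simp only [mem_univ, ofPred_true] at hγ'
  refine ⟨_, hγ', ?_⟩
  have hγJ := hγ'.geod.mono (subset_univ J)
  refine hγJ.eqOn h.geod h.isOpen h.ordConnected ht₀ (hγJ.eventuallyEq h.geod h.isOpen ht₀
    (p := σ t₀) (by simp [h0]) hp ?_)
  have := jet_comp_affine (n := n) (p := σ t₀) (γ := γ) (t := t₀) 1 (-t₀)
  simp only [one_mul, one_smul, add_neg_cancel] at this
  rw [this, hj]
  rfl

/-- Extended to the whole line, the geodesic admits the parameter tanh(s/2). Together with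
`Link.exists_step` this identifies d_M with the infimum of the Riemannian lengths of broken
geodesics. -/
theorem Step.link [T2Space M] (hn : 2 ≤ n) (hneg : 𝓕.RicciNegDef)
    (hpar : 𝓕.RicciParallel) (hc : 𝓕.IsComplete) {x y : M} {ℓ : ℝ} (h : 𝓕.Step x y ℓ) :
    𝓕.Link x y ℓ := by
  obtain ⟨σ, J, s, t, h, hs, ht, rfl, rfl, rfl⟩ := h
  obtain ⟨γ, hγ, heq⟩ := h.exists_extension hn hneg hpar hc hs
  have := hγ.link hn s t
  rwa [heq hs, heq ht] at this

end FinslerStructure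

end

section

variable {n : ℕ}


variable {M : Type*} [TopologicalSpace M] [ChartedSpace (E n) M]


/-! ### Calibration by a geodesic -/

section Calibration

variable {V : Type*} [NormedAddCommGroup V] [InnerProductSpace ℝ V]

open scoped InnerProductSpace

/-- First order Taylor bounds, locally uniform. -/
theorem exists_taylor_bound {W : Type*} [NormedAddCommGroup W] [NormedSpace ℝ W] {h : V → W}
    {U : Set V} (hU : IsOpen U) (hh : ContDiffOn ℝ ∞ h U) {x₀ : V} (hx₀ : x₀ ∈ U) :
    ∃ r > 0, ∃ B ≥ 0, ∀ x ∈ Metric.closedBall x₀ r, ∀ c ∈ Metric.closedBall x₀ r,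
      ‖h c - h x‖ ≤ B * ‖c - x‖ ∧ ‖h c - h x - fderiv ℝ h x (c - x)‖ ≤ B * ‖c - x‖ ^ 2 := by
  have hat := hh.contDiffAt (hU.mem_nhds hx₀)
  obtain ⟨K, s, hs, hl⟩ := (hat.of_le (m := 1) (by simp)).exists_lipschitzOnWith
  have h2 : ContDiffAt ℝ 1 (fderiv ℝ h) x₀ :=
    hat.fderiv_right (by simpa [one_add_one_eq_two] using ENat.LEInfty.out)
  obtain ⟨K', s', hs', hl'⟩ := h2.exists_lipschitzOnWith
  obtain ⟨r, hr, hsub⟩ := Metric.nhds_basis_closedBall.mem_iff.mp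
    (inter_mem (inter_mem hs hs') (hU.mem_nhds hx₀))
  refine ⟨r, hr, max K K', le_max_of_le_left K.2, fun x hx c hc => ⟨?_, ?_⟩⟩
  · exact (hl.norm_sub_le (hsub hc).1.1 (hsub hx).1.1).trans (by gcongr; exact le_max_left _ _)
  · have hseg : segment ℝ x c ⊆ Metric.closedBall x₀ r := (convex_closedBall x₀ r).segment_subset hx hc
    have := (convex_segment x c).norm_image_sub_le_of_norm_hasFDerivWithin_le' (𝕜 := ℝ)
      (f := h) (f' := fderiv ℝ h) (φ := fderiv ℝ h x) (C := K' * ‖c - x‖)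
      (fun z hz => ((hh.contDiffAt (hU.mem_nhds (hsub (hseg hz)).2)).differentiableAt
        (by simp)).hasFDerivAt.hasFDerivWithinAt)
      (fun z hz => ?_) (left_mem_segment ℝ x c) (right_mem_segment ℝ x c)
    · refine this.trans ?_
      rw [mul_assoc, ← pow_two]
      gcongr
      exact le_max_right _ _
    · refine (hl'.norm_sub_le (hsub (hseg hz)).1.2 (hsub hx).1.2).trans ?_
      gcongr
      rw [← dist_eq_norm, ← dist_eq_norm, dist_comm z x, dist_comm c x]
      have := dist_add_dist_of_mem_segment hz
      linarith [dist_nonneg (x := z) (y := c)]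

/-- Here ξ is the displacement from the geodesic, y its velocity and y + w the velocity of the
competing curve. Expand h_c(y + w, y + w): replacing h_c by its Taylor polynomial at x costs BC²‖ξ‖²
in the y-terms and 2BC‖ξ‖‖w‖ in the mixed term. The inner product costs ‖ξ‖‖w‖ more since 2At ≤ 1,
and all mixed terms are absorbed by h_c(w, w) ≥ ‖w‖²/C². The summand 1 in A leaves the reserve ‖ξ‖².
-/
theorem calibration_inequality {bx bc Dξ : V →L[ℝ] V →L[ℝ] ℝ} {ξ y w : V} {B C A t : ℝ} (hC : 0 < C)
    (hB : 0 ≤ B) (h1 : ‖bc - bx‖ ≤ B * ‖ξ‖) (h2 : ‖bc - bx - Dξ‖ ≤ B * ‖ξ‖ ^ 2)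
    (hsymm : ∀ a b, bc a b = bc b a) (hbc : ‖w‖ ^ 2 ≤ C ^ 2 * bc w w) (hy : ‖y‖ ≤ C)
    (hA : A = 1 + B * C ^ 2 + (2 * B * C + 1) ^ 2 * C ^ 2 / 4) (ht : 0 ≤ t) (hAt : 2 * A * t ≤ 1) :
    Dξ y y + 2 * bx y w - A * ‖ξ‖ ^ 2 - 2 * A * t * ⟪ξ, w⟫_ℝ ≤
      bc (y + w) (y + w) - bx y y - ‖ξ‖ ^ 2 := by
  have e1 : bc (y + w) (y + w) = bc y y + 2 * bc y w + bc w w := by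
    simp only [map_add, add_apply, hsymm w y]
    ring
  have e2 : -(B * ‖ξ‖ ^ 2 * C ^ 2) ≤ bc y y - bx y y - Dξ y y := by
    have h3 : ‖(bc - bx - Dξ) y y‖ ≤ B * ‖ξ‖ ^ 2 * C ^ 2 := by
      refine ((bc - bx - Dξ).le_opNorm₂ y y).trans ?_
      rw [mul_assoc, pow_two C]
      gcongr
    exact (abs_le.mp h3).1
  have e3 : -(B * ‖ξ‖ * C * ‖w‖) ≤ bc y w - bx y w := by
    have h3 : ‖(bc - bx) y w‖ ≤ B * ‖ξ‖ * C * ‖w‖ := by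
      refine ((bc - bx).le_opNorm₂ y w).trans ?_
      gcongr
    exact (abs_le.mp h3).1
  have hA0 : 0 ≤ A := by rw [hA]; positivity
  have e4 : -(‖ξ‖ * ‖w‖) ≤ 2 * A * t * ⟪ξ, w⟫_ℝ := by
    have h3 := abs_real_inner_le_norm ξ w
    have h4 : |2 * A * t * ⟪ξ, w⟫_ℝ| ≤ 1 * (‖ξ‖ * ‖w‖) := by
      rw [abs_mul, abs_of_nonneg (by positivity : 0 ≤ 2 * A * t)]
      gcongr
    rw [one_mul] at h4
    exact (abs_le.mp h4).1
  have e5 : ‖w‖ ^ 2 / C ^ 2 ≤ bc w w := by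
    rw [div_le_iff₀ (by positivity), mul_comm]
    exact hbc
  -- Completing the square in ‖w‖; the remaining multiple of ‖ξ‖² is the last summand of A.
  have e6 : 0 ≤ (‖w‖ / C - (2 * B * C + 1) * C * ‖ξ‖ / 2) ^ 2 := sq_nonneg _
  have e7 : (‖w‖ / C - (2 * B * C + 1) * C * ‖ξ‖ / 2) ^ 2 = ‖w‖ ^ 2 / C ^ 2 -
      (2 * B * C + 1) * ‖ξ‖ * ‖w‖ + (2 * B * C + 1) ^ 2 * C ^ 2 / 4 * ‖ξ‖ ^ 2 := by
    field_simp
    ring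
  have e8 : A * ‖ξ‖ ^ 2 = ‖ξ‖ ^ 2 + B * ‖ξ‖ ^ 2 * C ^ 2 +
      (2 * B * C + 1) ^ 2 * C ^ 2 / 4 * ‖ξ‖ ^ 2 := by rw [hA]; ring
  rw [e7] at e6
  rw [e1, e8]
  linarith

/-- The calibrating function of the curve with position and velocity `g`. -/
def calib (h : V → V →L[ℝ] V →L[ℝ] ℝ) (A : ℝ) (g : ℝ → V × V) (t : ℝ) (x : V) : ℝ :=
  2 * h (g t).1 (g t).2 (x - (g t).1) - A * t * ‖x - (g t).1‖ ^ 2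

theorem calib_self (h : V → V →L[ℝ] V →L[ℝ] ℝ) (A : ℝ) (g : ℝ → V × V) (t : ℝ) :
    calib h A g t (g t).1 = 0 := by simp [calib]

/-- By the geodesic equation, differentiating h(g', ·) along the geodesic leaves (1/2) D_ξh(g', g')
on the displacement ξ, which is the first order term in the calibration inequality. -/
theorem hasDerivAt_calib [FiniteDimensional ℝ V] {h : V → V →L[ℝ] V →L[ℝ] ℝ} {A t : ℝ}
    {g : ℝ → V × V} {c : ℝ → V} {v : V}
    (hh : ContDiffAt ℝ ∞ h (g t).1)
    (hb : ∀ w, w ≠ 0 → 0 < h (g t).1 w w)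
    (hg : HasDerivAt g ((g t).2, -metricSpray h (g t)) t) (hc : HasDerivAt c v t) :
    HasDerivAt (fun s => calib h A g s (c s))
      (fderiv ℝ h (g t).1 (c t - (g t).1) (g t).2 (g t).2 + 2 * h (g t).1 (g t).2 (v - (g t).2) -
        A * ‖c t - (g t).1‖ ^ 2 - 2 * A * t * ⟪c t - (g t).1, v - (g t).2⟫_ℝ) t := by
  have h1 : HasDerivAt (fun t => (g t).1) (g t).2 t :=
    (hasFDerivAt_fst (𝕜 := ℝ) (p := g t)).comp_hasDerivAt t hg
  have h2 : HasDerivAt (fun t => (g t).2) (-metricSpray h (g t)) t :=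
    (hasFDerivAt_snd (𝕜 := ℝ) (p := g t)).comp_hasDerivAt t hg
  have h3 : HasFDerivAt h (fderiv ℝ h (g t).1) (g t).1 := (hh.differentiableAt (by simp)).hasFDerivAt
  have h4 : HasDerivAt (fun t => h (g t).1) (fderiv ℝ h (g t).1 (g t).2) t :=
    HasFDerivAt.comp_hasDerivAt (f := fun t => (g t).1) t h3 h1
  have h5 : HasDerivAt (fun t => h (g t).1 (g t).2)
      (fderiv ℝ h (g t).1 (g t).2 (g t).2 + h (g t).1 (-metricSpray h (g t))) t := h4.clm_apply h2
  have h6 : HasDerivAt (fun t => c t - (g t).1) (v - (g t).2) t := hc.sub h1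
  have h7 := h5.clm_apply h6
  have h8 : HasDerivAt (fun t => A * t) A t := by simpa using (hasDerivAt_id t).const_mul A
  have h9 := h8.mul h6.norm_sq
  refine ((h7.const_mul 2).sub h9).congr_deriv ?_
  have h10 := congrArg (fun ℓ : V →L[ℝ] ℝ => ℓ (c t - (g t).1)) (metricSpray_spec (h := h) (z := g t) hb)
  simp only [metricForce_apply] at h10
  simp only [add_apply, map_neg, neg_apply, h10]
  ring

theorem image_sub_le_of_hasDerivAt_le {f f' : ℝ → ℝ} {a b κ : ℝ} (hab : a ≤ b)
    (hd : ∀ τ ∈ Icc a b, HasDerivAt f (f' τ) τ) (hle : ∀ τ ∈ Icc a b, f' τ ≤ κ) :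
    f b - f a ≤ κ * (b - a) :=
  (convex_Icc a b).image_sub_le_mul_sub_of_deriv_le
    (fun τ hτ => (hd τ hτ).continuousAt.continuousWithinAt)
    (fun τ hτ => (hd τ (interior_subset hτ)).differentiableAt.differentiableWithinAt)
    (fun τ hτ => by rw [(hd τ (interior_subset hτ)).deriv]; exact hle τ (interior_subset hτ))
    a (left_mem_Icc.mpr hab) b (right_mem_Icc.mpr hab) hab

end Calibration

namespace FinslerStructure

variable [IsManifold (𝓡 n) ∞ M] {𝓕 : FinslerStructure n M}

open scoped InnerProductSpace

variable (𝓕) in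
/-- A coordinate ball with the constants needed for calibration arguments. -/
structure CalibBall (p : M) (r C A : ℝ) : Prop where
  r_pos : 0 < r
  C_pos : 0 < C
  A_pos : 0 < A
  subset : Metric.closedBall (chartAt (E n) p p) r ⊆ (chartAt (E n) p).target
  speed : ∀ z : E n × E n, z.1 ∈ Metric.closedBall (chartAt (E n) p p) r → z.2 ≠ 0 →
      ‖z.2‖ ^ 2 ≤ C ^ 2 * 𝓕.ricSq p z
  ineq : ∀ x ∈ Metric.closedBall (chartAt (E n) p p) r,
    ∀ c ∈ Metric.closedBall (chartAt (E n) p p) r, ∀ y v : E n, y ≠ 0 → 𝓕.ricSq p (x, y) = 1 →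
    ∀ t : ℝ, 0 ≤ t → 2 * A * t ≤ 1 →
      fderiv ℝ (𝓕.form p) x (c - x) y y + 2 * 𝓕.form p x y (v - y) - A * ‖c - x‖ ^ 2 -
        2 * A * t * ⟪c - x, v - y⟫_ℝ ≤ 𝓕.form p c v v - 1 - ‖c - x‖ ^ 2

theorem exists_calibBall (hn : 2 ≤ n) (hneg : 𝓕.RicciNegDef) (hpar : 𝓕.RicciParallel) (p : M) :
    ∃ r C A, 𝓕.CalibBall p r C A := by
  obtain ⟨r₁, hr₁, C, hC, hsub, hspeed⟩ := exists_coordBall hn hneg p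
  obtain ⟨r₂, hr₂, B, hB, htaylor⟩ := exists_taylor_bound (chartAt (E n) p).open_target
    (contDiffOn_form (𝓕 := 𝓕) hn p) (mem_chart_target (E n) p)
  have hle₁ : Metric.closedBall (chartAt (E n) p p) (min r₁ r₂) ⊆
      Metric.closedBall (chartAt (E n) p p) r₁ := Metric.closedBall_subset_closedBall (min_le_left _ _)
  have hle₂ : Metric.closedBall (chartAt (E n) p p) (min r₁ r₂) ⊆
      Metric.closedBall (chartAt (E n) p p) r₂ := Metric.closedBall_subset_closedBall (min_le_right _ _)
  refine ⟨min r₁ r₂, C, 1 + B * C ^ 2 + (2 * B * C + 1) ^ 2 * C ^ 2 / 4, lt_min hr₁ hr₂, hC,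
    by positivity, hle₁.trans hsub, fun z hz => hspeed z (hle₁ hz),
    fun x hx c hc y v hy hxy t ht hAt => ?_⟩
  have hyC : ‖y‖ ≤ C := by
    have := hspeed (x, y) (hle₁ hx) hy
    rw [hxy, mul_one] at this
    exact (sq_le_sq₀ (norm_nonneg _) hC.le).mp this
  have hbc : ‖v - y‖ ^ 2 ≤ C ^ 2 * 𝓕.form p c (v - y) (v - y) := by
    by_cases h0 : v - y = 0
    · simp [h0]
    · have := hspeed (c, v - y) (hle₁ hc) h0
      rwa [← form_self hn hpar p (z := (c, v - y)) ⟨hsub (hle₁ hc), h0⟩] at this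
  have hxy' : 𝓕.form p x y y = 1 := by
    rw [← hxy, ← form_self hn hpar p (z := (x, y)) ⟨hsub (hle₁ hx), hy⟩]
  have := calibration_inequality (w := v - y) hC hB (htaylor x (hle₂ hx) c (hle₂ hc)).1
    (htaylor x (hle₂ hx) c (hle₂ hc)).2 (form_symm hn p (hsub (hle₁ hc))) hbc hyC rfl ht hAt
  rwa [hxy', add_sub_cancel] at this

variable {p : M} {r C A : ℝ}

theorem stepChain_nonneg {x y : M} {ℓ : ℝ} (h : Chain 𝓕.Step x y ℓ) : 0 ≤ ℓ := by
  induction h with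
  | single h => exact h.nonneg
  | cons h _ ih => exact add_nonneg h.nonneg ih

variable (𝓕) in
/-- The calibrating function of a unit geodesic. -/
def calibAt (p : M) (A : ℝ) (γ : ℝ → M) (t : ℝ) (x : M) : ℝ :=
  calib (𝓕.form p) A (jet p γ) t (chartAt (E n) p x)

theorem calibAt_self (γ : ℝ → M) (t : ℝ) : 𝓕.calibAt p A γ t (γ t) = 0 :=
  calib_self (𝓕.form p) A (jet p γ) t

variable (𝓕) in
/-- A geodesic which calibrates up to time `T`. -/
structure Calibrates (p : M) (r C A : ℝ) (γ : ℝ → M) (T : ℝ) : Prop where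
  ball : 𝓕.CalibBall p r C A
  unit : 𝓕.IsUnitGeod γ univ
  time : 2 * A * T ≤ 1
  nonneg : 0 ≤ T
  source : γ 0 ∈ (chartAt (E n) p).source
  near : ‖chartAt (E n) p (γ 0) - chartAt (E n) p p‖ + C * T < r

namespace Calibrates

variable {γ : ℝ → M} {T : ℝ}

theorem stays [T2Space M] (h : 𝓕.Calibrates p r C A γ T) {t : ℝ} (ht : t ∈ Icc 0 T) :
    γ t ∈ (chartAt (E n) p).source ∧
      readIn p γ t ∈ Metric.closedBall (chartAt (E n) p p) r := by
  have h1 := h.unit.stays h.ball.subset h.ball.C_pos h.ball.speed (mem_univ 0) (mem_univ T) h.source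
    (by rw [zero_sub, abs_neg, abs_of_nonneg h.nonneg]; exact h.near) t
    (by rw [uIcc_of_le h.nonneg]; exact ht)
  refine ⟨h1.1, mem_closedBall_iff_norm.mpr ?_⟩
  have h2 := norm_add_le (readIn p γ t - readIn p γ 0) (readIn p γ 0 - chartAt (E n) p p)
  rw [sub_add_sub_cancel] at h2
  have h3 := h1.2
  rw [zero_sub, abs_neg, abs_of_nonneg ht.1] at h3
  have h4 : C * t ≤ C * T := mul_le_mul_of_nonneg_left ht.2 h.ball.C_pos.le
  have h5 := h.near
  change ‖readIn p γ 0 - _‖ + _ < r at h5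
  linarith

/-- The bound is at most 0 for a curve of unit speed and at most -1 for a constant curve. The last
term forces a unit speed curve along which the calibrating function is constant to coincide with γ.
-/
theorem hasDerivAt [T2Space M] (hn : 2 ≤ n) (hneg : 𝓕.RicciNegDef) (hpar : 𝓕.RicciParallel)
    (h : 𝓕.Calibrates p r C A γ T) {t : ℝ} (ht : t ∈ Icc 0 T) {c : ℝ → E n} {v : E n}
    (hc : HasDerivAt c v t) (hcm : c t ∈ Metric.closedBall (chartAt (E n) p p) r) :
    ∃ D, HasDerivAt (fun s => calib (𝓕.form p) A (jet p γ) s (c s)) D t ∧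
      D ≤ 𝓕.form p (c t) v v - 1 - ‖c t - readIn p γ t‖ ^ 2 := by
  obtain ⟨h1, h2⟩ := h.stays ht
  have hz := h.unit.geod.jet_mem h.unit.isOpen (mem_univ t) h1
  have hg := h.unit.geod.hasDerivAt_jet h.unit.isOpen (mem_univ t) h1
  rw [sprayVec_eq_metricSpray hn hneg hpar p hz] at hg
  exact ⟨_, hasDerivAt_calib (contDiffAt_form hn p hz.1)
    (form_pos hn hneg hpar p hz.1) hg hc, h.ball.ineq _ h2 _ hcm _ _ hz.2
    (h.unit.ricSq_jet (mem_univ t) h1) t ht.1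
    ((mul_le_mul_of_nonneg_left ht.2 (by linarith [h.ball.A_pos])).trans h.time)⟩

/-- The calibrating function decreases along geodesic segments. -/
theorem step [T2Space M] (hn : 2 ≤ n) (hneg : 𝓕.RicciNegDef) (hpar : 𝓕.RicciParallel)
    (h : 𝓕.Calibrates p r C A γ T) {x y : M} {ℓ t₀ : ℝ} (hs : 𝓕.Step x y ℓ) (ht₀ : 0 ≤ t₀)
    (hT : t₀ + ℓ ≤ T) (hx : x ∈ (chartAt (E n) p).source)
    (hlt : ‖chartAt (E n) p x - chartAt (E n) p p‖ + C * ℓ < r) :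
    𝓕.calibAt p A γ (t₀ + ℓ) y ≤ 𝓕.calibAt p A γ t₀ x := by
  obtain ⟨σ, J, s, t, hσ, hsJ, htJ, rfl, rfl, rfl⟩ := hs
  have hstay := hσ.stays h.ball.subset h.ball.C_pos h.ball.speed hsJ htJ hx hlt
  -- A step may run against the sense of its geodesic; the sign a = ±1 is harmless since the form is
  -- quadratic in the velocity.
  obtain ⟨a, ha, hat⟩ : ∃ a : ℝ, a ^ 2 = 1 ∧ t = s + a * |s - t| := by
    rcases le_total s t with hst | hst
    · exact ⟨1, by norm_num, by rw [abs_sub_comm, abs_of_nonneg (sub_nonneg.mpr hst)]; ring⟩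
    · exact ⟨-1, by norm_num, by rw [abs_of_nonneg (sub_nonneg.mpr hst)]; ring⟩
  have haff : ∀ τ ∈ Icc t₀ (t₀ + |s - t|), s + a * (τ - t₀) ∈ uIcc s t := by
    intro τ hτ
    rcases sq_eq_one_iff.mp ha with rfl | rfl
    · have : s ≤ t := by rw [hat]; linarith [abs_nonneg (s - t)]
      rw [uIcc_of_le this]
      exact ⟨by linarith [hτ.1], by linarith [hτ.2]⟩
    · have : t ≤ s := by rw [hat]; linarith [abs_nonneg (s - t)]
      rw [uIcc_of_ge this]
      exact ⟨by linarith [hτ.2], by linarith [hτ.1]⟩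
  set c : ℝ → E n := fun τ => readIn p σ (s + a * (τ - t₀)) with hcdef
  have hball : ∀ τ ∈ Icc t₀ (t₀ + |s - t|), c τ ∈ Metric.closedBall (chartAt (E n) p p) r := by
    intro τ hτ
    rw [mem_closedBall_iff_norm]
    have h1 := (hstay _ (haff τ hτ)).2
    have h2 : |s - (s + a * (τ - t₀))| ≤ |s - t| := by rw [abs_sub_comm, abs_sub_comm s t]; exact abs_sub_left_of_mem_uIcc (haff τ hτ)
    have h3 := norm_add_le (c τ - readIn p σ s) (readIn p σ s - chartAt (E n) p p)
    rw [sub_add_sub_cancel] at h3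
    have h4 := mul_le_mul_of_nonneg_left h2 h.ball.C_pos.le
    change ‖readIn p σ s - _‖ + _ < r at hlt
    linarith
  have hder : ∀ τ ∈ Icc t₀ (t₀ + |s - t|),
      HasDerivAt c (a • (jet p σ (s + a * (τ - t₀))).2) τ := by
    intro τ hτ
    have h1 := hasDerivAt_readIn (hσ.geod.contMDiffAt hσ.isOpen
      (hσ.ordConnected.uIcc_subset hsJ htJ (haff τ hτ))) (hstay _ (haff τ hτ)).1
    have h2 : HasDerivAt (fun τ => s + a * (τ - t₀)) a τ := by
      simpa using (((hasDerivAt_id τ).sub_const t₀).const_mul a).const_add s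
    exact h1.scomp τ h2
  have hform : ∀ τ ∈ Icc t₀ (t₀ + |s - t|), 𝓕.form p (c τ) (a • (jet p σ (s + a * (τ - t₀))).2)
      (a • (jet p σ (s + a * (τ - t₀))).2) = 1 := by
    intro τ hτ
    have hJ := hσ.ordConnected.uIcc_subset hsJ htJ (haff τ hτ)
    have h1 := hσ.geod.jet_mem hσ.isOpen hJ (hstay _ (haff τ hτ)).1
    have h2 := form_self hn hpar p h1
    rw [hσ.ricSq_jet hJ (hstay _ (haff τ hτ)).1] at h2
    simp only [map_smul, smul_apply, smul_eq_mul]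
    rw [← mul_assoc, ← pow_two, ha, one_mul]
    exact h2
  have key : ∀ τ ∈ Icc t₀ (t₀ + |s - t|), ∃ D,
      HasDerivAt (fun s => calib (𝓕.form p) A (jet p γ) s (c s)) D τ ∧ D ≤ 0 := by
    intro τ hτ
    obtain ⟨D, h1, h2⟩ := h.hasDerivAt hn hneg hpar ⟨ht₀.trans hτ.1, hτ.2.trans hT⟩
      (hder τ hτ) (hball τ hτ)
    rw [hform τ hτ] at h2
    exact ⟨D, h1, h2.trans (by linarith [sq_nonneg ‖c τ - readIn p γ τ‖])⟩
  choose! D hD hD0 using key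
  have h1 := image_sub_le_of_hasDerivAt_le (le_add_of_nonneg_right (abs_nonneg (s - t))) hD hD0
  have e1 : c t₀ = chartAt (E n) p (σ s) := by simp [hcdef, readIn]
  have e2 : c (t₀ + |s - t|) = chartAt (E n) p (σ t) := by
    simp only [hcdef, add_sub_cancel_left]
    rw [← hat, readIn]
  rw [zero_mul, e1, e2] at h1
  exact sub_nonpos.mp h1

theorem chain [T2Space M] (hn : 2 ≤ n) (hneg : 𝓕.RicciNegDef) (hpar : 𝓕.RicciParallel)
    (h : 𝓕.Calibrates p r C A γ T) {x y : M} {ℓ t₀ : ℝ} (hs : Chain 𝓕.Step x y ℓ) (ht₀ : 0 ≤ t₀)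
    (hT : t₀ + ℓ ≤ T) (hx : x ∈ (chartAt (E n) p).source)
    (hlt : ‖chartAt (E n) p x - chartAt (E n) p p‖ + C * ℓ < r) :
    𝓕.calibAt p A γ (t₀ + ℓ) y ≤ 𝓕.calibAt p A γ t₀ x := by
  induction hs generalizing t₀ with
  | single hs => exact h.step hn hneg hpar hs ht₀ hT hx hlt
  | @cons x y z ℓ ℓ' hs hs' ih =>
    have h0 : 0 ≤ ℓ' := stepChain_nonneg hs'
    have h0' := mul_nonneg h.ball.C_pos.le h0
    rw [mul_add] at hlt
    have h1 := h.step hn hneg hpar hs ht₀ (by linarith) hx (by linarith)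
    obtain ⟨h2, h3⟩ := hs.stays h.ball.subset h.ball.C_pos h.ball.speed hx (by linarith)
    have h4 := norm_add_le (chartAt (E n) p y - chartAt (E n) p x)
      (chartAt (E n) p x - chartAt (E n) p p)
    rw [sub_add_sub_cancel] at h4
    have h5 := ih (t₀ := t₀ + ℓ) (by linarith [hs.nonneg]) (by linarith) h2 (by linarith)
    rw [← add_assoc]
    exact h5.trans h1

/-- A short geodesic is shortest. -/
theorem le_chain [T2Space M] (hn : 2 ≤ n) (hneg : 𝓕.RicciNegDef) (hpar : 𝓕.RicciParallel)
    (h : 𝓕.Calibrates p r C A γ T) {ℓ : ℝ} (hℓ : 0 ≤ ℓ) (hs : Chain 𝓕.Step (γ 0) (γ T) ℓ) :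
    T ≤ ℓ := by
  by_contra! hlt
  have h1 := h.chain hn hneg hpar hs le_rfl (by linarith) h.source
    ((add_le_add_right (mul_le_mul_of_nonneg_left hlt.le h.ball.C_pos.le) _).trans_lt h.near)
  rw [calibAt_self, zero_add] at h1
  have hT : T ∈ Icc 0 T := ⟨h.nonneg, le_rfl⟩
  have key : ∀ τ ∈ Icc ℓ T, ∃ D, HasDerivAt
      (fun s => calib (𝓕.form p) A (jet p γ) s (chartAt (E n) p (γ T))) D τ ∧ D ≤ -1 := by
    intro τ hτ
    obtain ⟨D, h2, h3⟩ := h.hasDerivAt hn hneg hpar ⟨hℓ.trans hτ.1, hτ.2⟩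
      (hasDerivAt_const τ (chartAt (E n) p (γ T))) (h.stays hT).2
    refine ⟨D, h2, h3.trans ?_⟩
    rw [map_zero]
    linarith [sq_nonneg ‖chartAt (E n) p (γ T) - readIn p γ τ‖]
  choose! D hD hD0 using key
  have h2 := image_sub_le_of_hasDerivAt_le hlt.le hD hD0
  have h3 : calib (𝓕.form p) A (jet p γ) T (chartAt (E n) p (γ T)) = 0 := calibAt_self γ T
  have h4 : calib (𝓕.form p) A (jet p γ) ℓ (chartAt (E n) p (γ T)) ≤ 0 := h1
  linarith

/-- A shortest curve which starts with a geodesic segment is a geodesic. -/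
theorem eqOn [T2Space M] (hn : 2 ≤ n) (hneg : 𝓕.RicciNegDef) (hpar : 𝓕.RicciParallel)
    (h : 𝓕.Calibrates p r C A γ T) {η : ℝ → M} (hη : 𝓕.IsUnitGeod η univ) (h0 : η 0 = γ 0) {s₀ : ℝ}
    (hs₀T : s₀ ≤ T) (hs : ∀ τ ∈ Icc 0 s₀, Chain 𝓕.Step (η τ) (γ T) (T - τ)) :
    EqOn η γ (Ioo 0 s₀) := by
  have hnear := h.near
  have hstay : ∀ τ ∈ Icc 0 T, η τ ∈ (chartAt (E n) p).source ∧
      ‖readIn (n := n) p η τ - readIn p η 0‖ ≤ C * τ := by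
    intro τ hτ
    have h1 := hη.stays h.ball.subset h.ball.C_pos h.ball.speed (mem_univ 0) (mem_univ T)
      (h0 ▸ h.source) (by
        rw [zero_sub, abs_neg, abs_of_nonneg h.nonneg, readIn, h0]; exact hnear) τ
      (by rw [uIcc_of_le h.nonneg]; exact hτ)
    rwa [zero_sub, abs_neg, abs_of_nonneg hτ.1] at h1
  have hdist : ∀ τ ∈ Icc 0 T, ‖readIn p η τ - chartAt (E n) p p‖ + C * (T - τ) < r := by
    intro τ hτ
    have h1 := (hstay τ hτ).2
    have h2 := norm_add_le (readIn p η τ - readIn p η 0) (readIn p η 0 - chartAt (E n) p p)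
    rw [sub_add_sub_cancel] at h2
    rw [← h0] at hnear
    change ‖readIn p η 0 - _‖ + _ < r at hnear
    linarith
  -- A squeeze: the value is at most 0 because it has decreased from 0 along η, and at least 0
  -- because it can still decrease to 0 along the rest of the chain, which reaches γ(T) at time T
  -- exactly.
  have hzero : ∀ τ ∈ Icc 0 s₀, 𝓕.calibAt p A γ τ (η τ) = 0 := by
    intro τ hτ
    have hτT : τ ∈ Icc 0 T := ⟨hτ.1, hτ.2.trans hs₀T⟩
    have h1 := h.step hn hneg hpar (x := η 0) (y := η τ) (t₀ := 0) (ℓ := τ)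
      ⟨η, univ, 0, τ, hη, mem_univ _, mem_univ _, rfl, rfl, by
        rw [zero_sub, abs_neg, abs_of_nonneg hτ.1]⟩ le_rfl (by linarith [hτT.2]) (h0 ▸ h.source) (by
        rw [h0]
        exact (add_le_add_right (mul_le_mul_of_nonneg_left hτT.2 h.ball.C_pos.le) _).trans_lt hnear)
    have h2 := h.chain hn hneg hpar (hs τ hτ) hτ.1 (by linarith) (hstay τ hτT).1 (hdist τ hτT)
    rw [zero_add, h0, calibAt_self] at h1
    rw [add_sub_cancel, calibAt_self] at h2
    exact le_antisymm h1 h2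
  intro τ hτ
  have hτT : τ ∈ Icc 0 T := ⟨hτ.1.le, hτ.2.le.trans hs₀T⟩
  have hball : readIn p η τ ∈ Metric.closedBall (chartAt (E n) p p) r := by
    rw [mem_closedBall_iff_norm]
    have := hdist τ hτT
    have h1 := mul_nonneg h.ball.C_pos.le (sub_nonneg.mpr hτT.2)
    linarith
  obtain ⟨D, hD, hD'⟩ := h.hasDerivAt hn hneg hpar hτT
    (hasDerivAt_readIn (hη.geod.contMDiffAt isOpen_univ (mem_univ τ)) (hstay τ hτT).1) hball
  have hD0 : D = 0 := by
    have h1 : (fun s => calib (𝓕.form p) A (jet p γ) s (readIn p η s)) =ᶠ[𝓝 τ] fun _ => 0 := by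
      filter_upwards [Icc_mem_nhds hτ.1 hτ.2] with s hs using hzero s hs
    exact hD.unique ((hasDerivAt_const τ (0 : ℝ)).congr_of_eventuallyEq h1)
  have hz := hη.geod.jet_mem isOpen_univ (mem_univ τ) (hstay τ hτT).1
  have h1 : 𝓕.form p (readIn p η τ) (deriv (readIn p η) τ) (deriv (readIn p η) τ) = 1 :=
    (form_self hn hpar p hz).trans (hη.ricSq_jet (mem_univ τ) (hstay τ hτT).1)
  -- The derivative is 0, so the reserve term ‖η - γ‖² in its upper bound must vanish.
  rw [hD0, h1, sub_self, zero_sub, le_neg, neg_zero] at hD'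
  have h2 := norm_eq_zero.mp (pow_eq_zero_iff two_ne_zero |>.mp (le_antisymm hD' (sq_nonneg _)))
  exact (chartAt (E n) p).injOn (hstay τ hτT).1 (h.stays hτT).1 (sub_eq_zero.mp h2)

end Calibrates

end FinslerStructure

end

section

variable {n : ℕ}


variable {M : Type*} [TopologicalSpace M] [ChartedSpace (E n) M]

namespace FinslerStructure

variable [IsManifold (𝓡 n) ∞ M] {𝓕 : FinslerStructure n M}

/-! ### Short geodesics -/

theorem exists_forall_norm_form_le (hn : 2 ≤ n) (p : M) : ∃ B > 0,
    ∀ᶠ x in 𝓝 (chartAt (E n) p p), ‖𝓕.form p x‖ ≤ B := by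
  have h1 := (contDiffAt_form (𝓕 := 𝓕) hn p (mem_chart_target _ p)).continuousAt.norm
  refine ⟨‖𝓕.form p (chartAt (E n) p p)‖ + 1, by positivity, ?_⟩
  filter_upwards [h1.eventually (gt_mem_nhds (lt_add_one _))] with x hx using hx.le

/-- Nearby points are joined by short unit geodesics. -/
theorem exists_short_geodesic [T2Space M] (hn : 2 ≤ n) (hneg : 𝓕.RicciNegDef)
    (hpar : 𝓕.RicciParallel) (hc : 𝓕.IsComplete) (p : M) : ∃ r > 0, ∃ K > 0,
    ∀ P ∈ (chartAt (E n) p).source, ∀ Q ∈ (chartAt (E n) p).source,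
      chartAt (E n) p P ∈ Metric.closedBall (chartAt (E n) p p) r →
      chartAt (E n) p Q ∈ Metric.closedBall (chartAt (E n) p p) r → P ≠ Q →
      ∃ (σ : ℝ → M) (l : ℝ), 𝓕.IsUnitGeod σ univ ∧ σ 0 = P ∧ σ l = Q ∧ 0 < l ∧
        l ≤ K * ‖chartAt (E n) p Q - chartAt (E n) p P‖ := by
  set x₀ : E n := chartAt (E n) p p with hx₀
  have hx₀t : x₀ ∈ (chartAt (E n) p).target := mem_chart_target _ _
  obtain ⟨B, hB, hform⟩ := exists_forall_norm_form_le (𝓕 := 𝓕) hn p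
  obtain ⟨r₁, hr₁, hr₁B⟩ := Metric.nhds_basis_closedBall.mem_iff.mp hform
  have hW : {z : E n × E n | z.1 ∈ (chartAt (E n) p).target} ∈ 𝓝 (x₀, (0 : E n)) :=
    continuousAt_fst.preimage_mem_nhds ((chartAt (E n) p).open_target.mem_nhds hx₀t)
  obtain ⟨ρ, hρ, ε, hε, C, hC, Φ, h1, h2⟩ := exists_second_order_flow (z₀ := (x₀, (0 : E n)))
    (contDiffAt_metricSpray (contDiffAt_form (𝓕 := 𝓕) hn p hx₀t) (form_pos hn hneg hpar p hx₀t)) hW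
  have h0 : (0 : ℝ) ∈ Ioo (-ε) ε := ⟨neg_lt_zero.mpr hε, hε⟩
  obtain ⟨t, ht, htε, htC⟩ : ∃ t > 0, t < ε ∧ C * t ≤ 1 / 2 := by
    refine ⟨min (ε / 2) (1 / 2 / (C + 1)), by positivity,
      (min_le_left _ _).trans_lt (half_lt_self hε), ?_⟩
    calc C * min (ε / 2) (1 / 2 / (C + 1)) ≤ (C + 1) * (1 / 2 / (C + 1)) := by
          gcongr
          · linarith
          · exact min_le_right _ _
      _ = _ := by field_simp
  have htm : t ∈ Ioo (-ε) ε := ⟨by linarith, htε⟩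
  have hspeed : ∀ z ∈ Metric.closedBall (x₀, (0 : E n)) ρ, ∀ τ ∈ Ioo (-ε) ε,
      𝓕.form p (Φ z τ).1 (Φ z τ).2 (Φ z τ).2 = 𝓕.form p z.1 z.2 z.2 := by
    intro z hz τ hτ
    have := metric_speed_const (chartAt (E n) p).open_target (contDiffOn_form (𝓕 := 𝓕) hn p)
      (fun x hx => form_symm hn p hx) (fun x hx => form_pos hn hneg hpar p hx)
      (fun τ hτ => ((h1 z hz).2 τ hτ).1) (fun τ hτ => ((h1 z hz).2 τ hτ).2.1) hτ
    rwa [(h1 z hz).1] at this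
  -- By conservation of speed, zero initial velocity gives a constant curve; this is the centre of
  -- the surjectivity argument.
  have hconst : ∀ x, (x, (0 : E n)) ∈ Metric.closedBall (x₀, (0 : E n)) ρ →
      (Φ (x, 0) t).1 = x := by
    intro x hx
    have hv : ∀ τ ∈ Ioo (-ε) ε, (Φ (x, 0) τ).2 = 0 := by
      intro τ hτ
      by_contra hne
      have h3 := form_pos hn hneg hpar p ((h1 _ hx).2 τ hτ).2.1 _ hne
      rw [hspeed _ hx τ hτ, map_zero] at h3
      exact lt_irrefl _ h3
    have h3 := norm_sub_smul_le le_rfl (w := (0 : E n)) (f := fun τ => (Φ (x, 0) τ).1)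
      (g := fun τ => (Φ (x, 0) τ).2) (fun τ hτ =>
        (hasFDerivAt_fst (𝕜 := ℝ) (p := Φ (x, 0) τ)).comp_hasDerivAt τ ((h1 _ hx).2 τ hτ).1)
      (fun τ hτ => by rw [hv τ hτ]; simp) htm
    rw [zero_mul, smul_zero, sub_zero, norm_le_zero_iff, (h1 _ hx).1, sub_eq_zero] at h3
    exact h3
  -- The velocities used have norm at most 2‖xQ - xP‖/t. Their metric speed is at most √B times
  -- that, and the flow time is t, whence K = 2√B. The bound tρ/4 keeps these velocities in the
  -- domain of the flow.
  refine ⟨min (min ρ r₁) (t * ρ / 4), by positivity, 2 * √B, by positivity,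
    fun P hP Q hQ hPr hQr hPQ => ?_⟩
  rw [mem_closedBall_iff_norm, le_min_iff, le_min_iff] at hPr hQr
  set xP : E n := chartAt (E n) p P
  set xQ : E n := chartAt (E n) p Q
  have hne : xQ ≠ xP := fun h => hPQ ((chartAt (E n) p).injOn hP hQ h.symm)
  have hd : 0 < ‖xQ - xP‖ := norm_pos_iff.mpr (sub_ne_zero.mpr hne)
  have hdt : ‖xQ - xP‖ ≤ t * ρ / 2 := by
    have := norm_sub_le (xQ - x₀) (xP - x₀)
    rw [sub_sub_sub_cancel_right] at this
    linarith [hPr.2, hQr.2]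
  have hρ' : 2 * ‖xQ - xP‖ / t ≤ ρ := by
    rw [div_le_iff₀ ht]
    linarith
  have hball : ∀ y ∈ Metric.closedBall (0 : E n) (2 * ‖xQ - xP‖ / t),
      (xP, y) ∈ Metric.closedBall (x₀, (0 : E n)) ρ := fun y hy => by
    rw [← closedBall_prod_same]
    exact ⟨mem_closedBall_iff_norm.mpr hPr.1.1, Metric.closedBall_subset_closedBall hρ' hy⟩
  -- The radius is chosen so that the ball covered around xP has radius exactly ‖xQ - xP‖.
  have hsurj := surjOn_of_near_smul (f := fun y => (Φ (xP, y) t).1) (y₀ := (0 : E n))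
    (ρ := 2 * ‖xQ - xP‖ / t) (by positivity) hC ht htC (fun y hy y' hy' => by
      have := h2 _ (hball y hy) _ (hball y' hy') t htm
      simpa [Prod.norm_def] using this)
  have h00 : (0 : E n) ∈ Metric.closedBall (0 : E n) (2 * ‖xQ - xP‖ / t) :=
    Metric.mem_closedBall_self (by positivity)
  obtain ⟨y, hy, hyQ⟩ := hsurj (show xQ ∈ _ by
    rw [mem_closedBall_iff_norm]
    simp only [hconst xP (hball 0 h00)]
    exact le_of_eq (by field_simp))
  have hz := hball y hy
  simp only at hyQ
  have hy0 : y ≠ 0 := by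
    rintro rfl
    exact hne (hyQ.symm.trans (hconst xP hz))
  have hxP : xP ∈ (chartAt (E n) p).target := (chartAt (E n) p).map_source hP
  have hslit : ∀ τ ∈ Ioo (-ε) ε, Φ (xP, y) τ ∈ slit (chartAt (E n) p).target := by
    refine fun τ hτ => ⟨((h1 _ hz).2 τ hτ).2.1, fun h3 => ?_⟩
    have h4 := hspeed _ hz τ hτ
    rw [h3, map_zero] at h4
    exact (form_pos hn hneg hpar p hxP y hy0).ne h4
  obtain ⟨hγ, hj⟩ := isGeodesicOn_of_hasDerivAt (𝓕 := 𝓕) p isOpen_Ioo hslit (fun τ hτ => by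
    rw [sprayVec_eq_metricSpray hn hneg hpar p (hslit τ hτ)]
    exact ((h1 _ hz).2 τ hτ).1)
  obtain ⟨c, hc0, hu, hc2⟩ := hγ.exists_unit hn hneg hpar.firstIntegral isOpen_Ioo ordConnected_Ioo h0
  have e0 : (chartAt (E n) p).symm (Φ (xP, y) 0).1 = P := by
    rw [(h1 _ hz).1]
    exact (chartAt (E n) p).left_inv hP
  have et : (chartAt (E n) p).symm (Φ (xP, y) t).1 = Q := by
    rw [hyQ]
    exact (chartAt (E n) p).left_inv hQ
  rw [← hγ.ricSq_eq isOpen_Ioo h0 (p := p) (by rw [e0]; exact hP), hj 0 h0, (h1 _ hz).1,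
    ← form_self hn hpar p (z := (xP, y)) ⟨hxP, hy0⟩] at hc2
  have hcy : c ≤ √B * ‖y‖ := by
    refine (sq_le_sq₀ hc0.le (by positivity)).mp ?_
    rw [hc2, mul_pow, Real.sq_sqrt hB.le]
    have h3 : ‖𝓕.form p xP y y‖ ≤ ‖𝓕.form p xP‖ * ‖y‖ * ‖y‖ := (𝓕.form p xP).le_opNorm₂ y y
    have h4 : ‖𝓕.form p xP‖ ≤ B := hr₁B (mem_closedBall_iff_norm.mpr hPr.1.2)
    refine (le_abs_self _).trans (h3.trans ?_)
    rw [mul_assoc, ← pow_two]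
    gcongr
  have h0' : (0 : ℝ) ∈ {t | c⁻¹ * t ∈ Ioo (-ε) ε} := by simpa using h0
  have ht' : c * t ∈ {t | c⁻¹ * t ∈ Ioo (-ε) ε} := by
    rw [mem_ofPred_eq, inv_mul_cancel_left₀ hc0.ne']
    exact htm
  obtain ⟨σ, hσ, heq⟩ := hu.exists_extension hn hneg hpar hc h0'
  refine ⟨σ, c * t, hσ, ?_, ?_, mul_pos hc0 ht, ?_⟩
  · rw [heq h0']
    simpa using e0
  · rw [heq ht']
    simpa only [inv_mul_cancel_left₀ hc0.ne'] using et
  · have h3 : ‖y‖ ≤ 2 * ‖xQ - xP‖ / t := by simpa using hy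
    rw [le_div_iff₀ ht] at h3
    calc c * t ≤ √B * ‖y‖ * t := by gcongr
      _ = √B * (‖y‖ * t) := mul_assoc _ _ _
      _ ≤ √B * (2 * ‖xQ - xP‖) := by gcongr
      _ = _ := by ring

variable (𝓕) in
/-- A coordinate ball in which any two points are joined by a short geodesic, with the constants
needed for calibration arguments. -/
structure NormalBall (p : M) (r C A K : ℝ) : Prop extends 𝓕.CalibBall p r C A where
  K_pos : 0 < K
  exists_geodesic : ∀ P ∈ (chartAt (E n) p).source, ∀ Q ∈ (chartAt (E n) p).source,
    chartAt (E n) p P ∈ Metric.closedBall (chartAt (E n) p p) r →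
    chartAt (E n) p Q ∈ Metric.closedBall (chartAt (E n) p p) r → P ≠ Q →
    ∃ (σ : ℝ → M) (l : ℝ), 𝓕.IsUnitGeod σ univ ∧ σ 0 = P ∧ σ l = Q ∧ 0 < l ∧
      l ≤ K * ‖chartAt (E n) p Q - chartAt (E n) p P‖

theorem CalibBall.mono {p : M} {r r' C A : ℝ} (h : 𝓕.CalibBall p r C A) (hr' : 0 < r')
    (hle : r' ≤ r) : 𝓕.CalibBall p r' C A :=
  have hsub := Metric.closedBall_subset_closedBall hle
  ⟨hr', h.C_pos, h.A_pos, hsub.trans h.subset, fun z hz => h.speed z (hsub hz),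
    fun x hx c hc => h.ineq x (hsub hx) c (hsub hc)⟩

theorem exists_normalBall [T2Space M] (hn : 2 ≤ n) (hneg : 𝓕.RicciNegDef)
    (hpar : 𝓕.RicciParallel) (hc : 𝓕.IsComplete) (p : M) : ∃ r C A K, 𝓕.NormalBall p r C A K := by
  obtain ⟨r₁, C, A, h₁⟩ := exists_calibBall hn hneg hpar p
  obtain ⟨r₂, hr₂, K, hK, h₂⟩ := exists_short_geodesic hn hneg hpar hc p
  have hsub := Metric.closedBall_subset_closedBall (x := chartAt (E n) p p) (min_le_right r₁ r₂)
  exact ⟨min r₁ r₂, C, A, K, h₁.mono (lt_min h₁.r_pos hr₂) (min_le_left _ _), hK,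
    fun P hP Q hQ hPr hQr => h₂ P hP Q hQ (hsub hPr) (hsub hQr)⟩

/-! ### The distance as a real number -/

theorem Step.exists_cut {x y : M} {ℓ δ : ℝ} (h : 𝓕.Step x y ℓ) (h0 : 0 ≤ δ) (hδ : δ ≤ ℓ) :
    ∃ q, 𝓕.Step x q δ ∧ 𝓕.Step q y (ℓ - δ) := by
  obtain ⟨σ, J, s, t, hσ, hs, ht, rfl, rfl, rfl⟩ := h
  rcases le_total s t with hst | hst
  · have e : |s - t| = t - s := by rw [abs_sub_comm, abs_of_nonneg (sub_nonneg.mpr hst)]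
    rw [e] at hδ ⊢
    have hm : s + δ ∈ J := hσ.ordConnected.out hs ht ⟨by linarith, by linarith⟩
    refine ⟨σ (s + δ), ⟨σ, J, s, s + δ, hσ, hs, hm, rfl, rfl, ?_⟩,
      ⟨σ, J, s + δ, t, hσ, hm, ht, rfl, rfl, ?_⟩⟩
    · rw [sub_add_cancel_left, abs_neg, abs_of_nonneg h0]
    · rw [abs_sub_comm, abs_of_nonneg (by linarith)]
      ring
  · have e : |s - t| = s - t := abs_of_nonneg (sub_nonneg.mpr hst)
    rw [e] at hδ ⊢
    have hm : s - δ ∈ J := hσ.ordConnected.out ht hs ⟨by linarith, by linarith⟩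
    refine ⟨σ (s - δ), ⟨σ, J, s, s - δ, hσ, hs, hm, rfl, rfl, ?_⟩,
      ⟨σ, J, s - δ, t, hσ, hm, ht, rfl, rfl, ?_⟩⟩
    · rw [sub_sub_cancel, abs_of_nonneg h0]
    · rw [abs_of_nonneg (by linarith)]
      ring

/-- It provides, on an almost shortest chain, a point at a prescribed length from the start. -/
theorem exists_cut_chain {x y : M} {ℓ δ : ℝ} (h : Chain 𝓕.Step x y ℓ) (h0 : 0 ≤ δ) (hδ : δ ≤ ℓ) :
    ∃ q, Chain 𝓕.Step x q δ ∧ Chain 𝓕.Step q y (ℓ - δ) := by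
  induction h generalizing δ with
  | single h =>
    obtain ⟨q, h1, h2⟩ := h.exists_cut h0 hδ
    exact ⟨q, .single h1, .single h2⟩
  | @cons x y z ℓ ℓ' h h' ih =>
    rcases le_total δ ℓ with hle | hle
    · obtain ⟨q, h1, h2⟩ := h.exists_cut h0 hle
      refine ⟨q, .single h1, ?_⟩
      rw [add_sub_right_comm]
      exact .cons h2 h'
    · obtain ⟨q, h1, h2⟩ := ih (δ := δ - ℓ) (by linarith) (by linarith)
      refine ⟨q, ?_, ?_⟩
      · rw [← add_sub_cancel ℓ δ]
        exact .cons h h1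
      · rwa [sub_sub_eq_add_sub, add_comm ℓ' ℓ] at h2

variable (𝓕) in
/-- The intrinsic distance as a real number. -/
def realDist (x y : M) : ℝ := (𝓕.projDist x y).toReal

theorem realDist_nonneg (x y : M) : 0 ≤ 𝓕.realDist x y := ENNReal.toReal_nonneg

theorem realDist_comm (x y : M) : 𝓕.realDist x y = 𝓕.realDist y x := by
  rw [realDist, realDist, projDist_comm]

theorem realDist_self (hn : 2 ≤ n) (hneg : 𝓕.RicciNegDef) (hpar : 𝓕.RicciParallel) (x : M) :
    𝓕.realDist x x = 0 := by
  rw [realDist, projDist_self hn hneg hpar.firstIntegral, ENNReal.toReal_zero]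

theorem realDist_triangle [ConnectedSpace M] (hn : 2 ≤ n) (hneg : 𝓕.RicciNegDef)
    (hpar : 𝓕.RicciParallel) (x y z : M) :
    𝓕.realDist x z ≤ 𝓕.realDist x y + 𝓕.realDist y z := by
  have h := projDist_ne_top hn hneg hpar.firstIntegral
  rw [realDist, realDist, realDist, ← ENNReal.toReal_add (h x y) (h y z)]
  exact ENNReal.toReal_mono (ENNReal.add_ne_top.mpr ⟨h x y, h y z⟩) (projDist_triangle x y z)

/-- Each step is a link of the same length by `Step.link`; this is where completeness of F enters
the metric estimates. -/
theorem realDist_le_of_chain [T2Space M] (hn : 2 ≤ n) (hneg : 𝓕.RicciNegDef)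
    (hpar : 𝓕.RicciParallel) (hc : 𝓕.IsComplete) {x y : M} {ℓ : ℝ} (h : Chain 𝓕.Step x y ℓ) :
    𝓕.realDist x y ≤ ℓ := by
  obtain ⟨ℓ', h', hle⟩ := h.exists_le (R' := 𝓕.Link)
    fun x y ℓ hs => ⟨ℓ, hs.link hn hneg hpar hc, le_rfl⟩
  exact (ENNReal.toReal_le_of_le_ofReal (chain_nonneg h') (projDist_le h')).trans hle

theorem exists_chain_of_realDist_lt [ConnectedSpace M] (hn : 2 ≤ n) (hneg : 𝓕.RicciNegDef)
    (hpar : 𝓕.RicciParallel) {x y : M} {c : ℝ} (h : 𝓕.realDist x y < c) :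
    ∃ ℓ < c, Chain 𝓕.Step x y ℓ :=
  exists_step_chain_of_projDist_lt hn hneg hpar.firstIntegral
    ((ENNReal.lt_ofReal_iff_toReal_lt (projDist_ne_top hn hneg hpar.firstIntegral x y)).mpr h)

theorem Calibrates.le_realDist [T2Space M] [ConnectedSpace M] (hn : 2 ≤ n) (hneg : 𝓕.RicciNegDef)
    (hpar : 𝓕.RicciParallel) {p : M} {r C A T : ℝ} {γ : ℝ → M} (h : 𝓕.Calibrates p r C A γ T) :
    T ≤ 𝓕.realDist (γ 0) (γ T) := by
  refine le_of_forall_gt_imp_ge_of_dense fun c hc => ?_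
  obtain ⟨ℓ, hℓ, hs⟩ := exists_chain_of_realDist_lt hn hneg hpar hc
  exact (h.le_chain hn hneg hpar (stepChain_nonneg hs) hs).trans hℓ.le

theorem IsUnitGeod.step {γ : ℝ → M} (h : 𝓕.IsUnitGeod γ univ) {s t : ℝ} (hst : s ≤ t) :
    𝓕.Step (γ s) (γ t) (t - s) :=
  ⟨γ, univ, s, t, h, mem_univ _, mem_univ _, rfl, rfl, by
    rw [abs_sub_comm, abs_of_nonneg (sub_nonneg.mpr hst)]⟩

end FinslerStructure

end

section

variable {n : ℕ}


variable {M : Type*} [TopologicalSpace M] [ChartedSpace (E n) M]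

namespace FinslerStructure

variable [IsManifold (𝓡 n) ∞ M] {𝓕 : FinslerStructure n M}

/-! ### Completeness of the distance -/

theorem eventually_mul_lt (κ : ℝ) {b : ℝ} (hb : 0 < b) : ∀ᶠ δ in 𝓝[>] (0 : ℝ), κ * δ < b :=
  ((by fun_prop : ContinuousAt (fun δ : ℝ => κ * δ) 0).eventually
    (gt_mem_nhds (by simpa using hb))).filter_mono nhdsWithin_le_nhds

/-- The distance is controlled by the coordinate distance, so limits taken in a chart can be carried
over to d_M. -/
theorem NormalBall.realDist_le [T2Space M] (hn : 2 ≤ n) (hneg : 𝓕.RicciNegDef)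
    (hpar : 𝓕.RicciParallel) (hc : 𝓕.IsComplete) {p : M} {r C A K : ℝ} (h : 𝓕.NormalBall p r C A K)
    {P Q : M} (hP : P ∈ (chartAt (E n) p).source) (hQ : Q ∈ (chartAt (E n) p).source)
    (hPr : chartAt (E n) p P ∈ Metric.closedBall (chartAt (E n) p p) r)
    (hQr : chartAt (E n) p Q ∈ Metric.closedBall (chartAt (E n) p p) r) :
    𝓕.realDist P Q ≤ K * ‖chartAt (E n) p Q - chartAt (E n) p P‖ := by
  by_cases hPQ : P = Q
  · rw [hPQ, realDist_self hn hneg hpar, sub_self, norm_zero, mul_zero]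
  · obtain ⟨σ, l, hσ, rfl, rfl, hl, hle⟩ := h.exists_geodesic P hP Q hQ hPr hQr hPQ
    have := realDist_le_of_chain hn hneg hpar hc (.single (hσ.step hl.le))
    rw [sub_zero] at this
    exact this.trans hle

variable (𝓕) in
/-- `f x` is the limit of the distances from `x` to the terms of a sequence. -/
def IsLimitDist (u : ℕ → M) (f : M → ℝ) : Prop :=
  ∀ x, Tendsto (fun l => 𝓕.realDist x (u l)) atTop (𝓝 (f x))

section Limit

variable [ConnectedSpace M] {u : ℕ → M} {f : M → ℝ}

theorem IsLimitDist.le_add (hn : 2 ≤ n) (hneg : 𝓕.RicciNegDef) (hpar : 𝓕.RicciParallel)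
    (hf : 𝓕.IsLimitDist u f) (x y : M) : f x ≤ 𝓕.realDist x y + f y :=
  le_of_tendsto_of_tendsto' (hf x) ((hf y).const_add _) fun l =>
    realDist_triangle hn hneg hpar x y (u l)

variable [T2Space M]

theorem IsLimitDist.le_add_of_unitGeod (hn : 2 ≤ n) (hneg : 𝓕.RicciNegDef)
    (hpar : 𝓕.RicciParallel) (hc : 𝓕.IsComplete) (hf : 𝓕.IsLimitDist u f) {γ : ℝ → M}
    (hγ : 𝓕.IsUnitGeod γ univ) {s t : ℝ} (hst : s ≤ t) :
    f (γ s) ≤ t - s + f (γ t) ∧ f (γ t) ≤ t - s + f (γ s) := by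
  have h1 := realDist_le_of_chain hn hneg hpar hc (.single (hγ.step hst))
  have h2 := hf.le_add hn hneg hpar (γ s) (γ t)
  have h3 := hf.le_add hn hneg hpar (γ t) (γ s)
  rw [realDist_comm] at h3
  exact ⟨by linarith, by linarith⟩

/-- There is a nearby point at a given distance, in the direction of the sequence. -/
theorem IsLimitDist.exists_descent (hn : 2 ≤ n) (hneg : 𝓕.RicciNegDef)
    (hpar : 𝓕.RicciParallel) (hc : 𝓕.IsComplete) (hf : 𝓕.IsLimitDist u f) {z : M} {r C A K : ℝ}
    (h : 𝓕.NormalBall z r C A K) {δ : ℝ} (h0 : 0 < δ) (hδ : δ < f z) (hδr : C * δ < r) :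
    ∃ q ∈ (chartAt (E n) z).source, ‖chartAt (E n) z q - chartAt (E n) z z‖ ≤ C * δ ∧
      𝓕.realDist z q ≤ δ ∧ f q = f z - δ := by
  have hzs := mem_chart_source (E n) z
  have hstep : ∀ l, ∃ q, δ < 𝓕.realDist z (u l) → Chain 𝓕.Step z q δ ∧
      𝓕.realDist q (u l) ≤ 𝓕.realDist z (u l) + 1 / ((l : ℝ) + 1) - δ := by
    intro l
    -- An almost shortest chain to u_l, of excess 1/(l + 1), is cut at length δ. When u_l is too
    -- close to z the choice is irrelevant, and this does not happen for large l because δ < f(z).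
    by_cases hl : δ < 𝓕.realDist z (u l)
    · obtain ⟨ℓ, hℓ, hs⟩ := exists_chain_of_realDist_lt hn hneg hpar
        (lt_add_of_pos_right (𝓕.realDist z (u l)) (Nat.one_div_pos_of_nat (α := ℝ) (n := l)))
      obtain ⟨q, h1, h2⟩ := exists_cut_chain hs h0.le
        (hl.le.trans (realDist_le_of_chain hn hneg hpar hc hs))
      refine ⟨q, fun _ => ⟨h1, (realDist_le_of_chain hn hneg hpar hc h2).trans ?_⟩⟩
      linarith
    · exact ⟨z, fun h => absurd h hl⟩
  choose q hq using hstep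
  have hev : ∀ᶠ l in atTop, δ < 𝓕.realDist z (u l) := (hf z).eventually (lt_mem_nhds hδ)
  have hqs : ∀ᶠ l in atTop, q l ∈ (chartAt (E n) z).source ∧
      chartAt (E n) z (q l) ∈ Metric.closedBall (chartAt (E n) z z) (C * δ) := by
    filter_upwards [hev] with l hl
    have := chain_stays (hq l hl).1 h.subset h.C_pos h.speed hzs (by simpa using hδr)
    exact ⟨this.1, mem_closedBall_iff_norm.mpr this.2⟩
  -- The cut points stay in a compact coordinate ball, so a subsequence converges; its limit is the
  -- required point.
  obtain ⟨a, ha, φ, hφ, hlim⟩ := (isCompact_closedBall (chartAt (E n) z z) (C * δ)).tendsto_subseq'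
    (hqs.mono fun l hl => hl.2).frequently
  have hφt := hφ.tendsto_atTop
  have hball := Metric.closedBall_subset_closedBall (x := chartAt (E n) z z) hδr.le
  have hat := h.subset (hball ha)
  have hr := (chartAt (E n) z).right_inv hat
  refine ⟨(chartAt (E n) z).symm a, (chartAt (E n) z).map_target hat, ?_, ?_⟩
  · rw [hr]
    exact mem_closedBall_iff_norm.mp ha
  set b := (chartAt (E n) z).symm a
  have hK : ∀ᶠ k in atTop, 𝓕.realDist (q (φ k)) b ≤ K * ‖a - chartAt (E n) z (q (φ k))‖ := by
    filter_upwards [hφt.eventually hqs] with k hk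
    have := h.realDist_le hn hneg hpar hc hk.1 ((chartAt (E n) z).map_target hat) (hball hk.2)
      (by rw [hr]; exact hball ha)
    rwa [hr] at this
  have hK0 : Tendsto (fun k => K * ‖a - chartAt (E n) z (q (φ k))‖) atTop (𝓝 0) := by
    have h1 := ((tendsto_const_nhds (x := a)).sub hlim).norm.const_mul K
    simpa using h1
  have h1 : 𝓕.realDist z b ≤ δ := by
    refine ge_of_tendsto (x := atTop) (f := fun k => δ + K * ‖a - chartAt (E n) z (q (φ k))‖)
      (by simpa using hK0.const_add δ) ?_
    filter_upwards [hK, hφt.eventually hev] with k hk hk'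
    exact (realDist_triangle hn hneg hpar z (q (φ k)) b).trans
      (add_le_add (realDist_le_of_chain hn hneg hpar hc (hq _ hk').1) hk)
  have h2 : f b ≤ f z - δ := by
    have h3 : Tendsto (fun k => K * ‖a - chartAt (E n) z (q (φ k))‖ +
        (𝓕.realDist z (u (φ k)) + 1 / ((φ k : ℝ) + 1) - δ)) atTop (𝓝 (0 + (f z + 0 - δ))) :=
      hK0.add ((((hf z).comp hφt).add (tendsto_one_div_add_atTop_nhds_zero_nat.comp hφt)).sub_const δ)
    rw [zero_add, add_zero] at h3
    refine le_of_tendsto_of_tendsto ((hf b).comp hφt) h3 ?_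
    filter_upwards [hK, hφt.eventually hev] with k hk hk'
    refine (realDist_triangle hn hneg hpar b (q (φ k)) _).trans ?_
    rw [realDist_comm b]
    exact add_le_add hk (hq _ hk').2
  exact ⟨h1, le_antisymm h2 (by linarith [hf.le_add hn hneg hpar z b])⟩

/-- Join z to the point of `exists_descent` by a short geodesic of length l. Calibration gives l ≤
d(z, q) ≤ δ, and l ≥ δ because f is 1-Lipschitz and drops by δ. -/
theorem IsLimitDist.eventually_exists_unitGeod (hn : 2 ≤ n) (hneg : 𝓕.RicciNegDef)
    (hpar : 𝓕.RicciParallel) (hc : 𝓕.IsComplete) (hf : 𝓕.IsLimitDist u f) {z : M} (hz : 0 < f z) :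
    ∀ᶠ δ in 𝓝[>] (0 : ℝ), ∃ c, 𝓕.IsUnitGeod c univ ∧ c 0 = z ∧ f (c δ) = f z - δ := by
  obtain ⟨r, C, A, K, h⟩ := exists_normalBall hn hneg hpar hc z
  have hzs := mem_chart_source (E n) z
  filter_upwards [eventually_mul_lt 1 hz, eventually_mul_lt C h.r_pos,
    eventually_mul_lt (C * (K * C)) h.r_pos, eventually_mul_lt (2 * A * (K * C)) one_pos,
    self_mem_nhdsWithin] with δ h1 h2 h3 h4 (h5 : 0 < δ)
  rw [one_mul] at h1
  obtain ⟨q, hq, hqn, hqd, hqf⟩ := hf.exists_descent hn hneg hpar hc h h5 h1 h2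
  have hne : z ≠ q := by
    rintro rfl
    linarith
  obtain ⟨σ, l, hσ, h0, hl, hl0, hle⟩ := h.exists_geodesic z hzs q hq
    (Metric.mem_closedBall_self h.r_pos.le) (mem_closedBall_iff_norm.mpr (hqn.trans h2.le)) hne
  have hlδ : l ≤ K * C * δ := by
    rw [mul_assoc]
    exact hle.trans (mul_le_mul_of_nonneg_left hqn h.K_pos.le)
  have hcal : 𝓕.Calibrates z r C A σ l := by
    refine ⟨h.toCalibBall, hσ, ?_, hl0.le, h0 ▸ hzs, ?_⟩
    · have := mul_le_mul_of_nonneg_left hlδ (mul_nonneg zero_le_two h.A_pos.le)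
      linarith
    · rw [h0, sub_self, norm_zero, zero_add]
      have := mul_le_mul_of_nonneg_left hlδ h.C_pos.le
      linarith
  have h6 := hcal.le_realDist hn hneg hpar
  have h7 := (hf.le_add_of_unitGeod hn hneg hpar hc hσ hl0.le).1
  rw [h0, hl] at h6 h7
  have h8 : l = δ := le_antisymm (h6.trans hqd) (by linarith)
  exact ⟨σ, hσ, h0, by rw [← h8, hl, h8]; exact hqf⟩

/-- A geodesic along which the limiting distance decreases at unit rate keeps this property. -/
theorem IsLimitDist.eventually_extend (hn : 2 ≤ n) (hneg : 𝓕.RicciNegDef)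
    (hpar : 𝓕.RicciParallel) (hc : 𝓕.IsComplete) (hf : 𝓕.IsLimitDist u f) {γ : ℝ → M}
    (hγ : 𝓕.IsUnitGeod γ univ) {T : ℝ} (hT : 0 < f (γ T))
    (hback : ∀ᶠ s in 𝓝[>] (0 : ℝ), f (γ (T - s)) = f (γ T) + s) :
    ∀ᶠ δ in 𝓝[>] (0 : ℝ), f (γ (T + δ)) = f (γ T) - δ := by
  obtain ⟨z, hz⟩ : ∃ z, z = γ T := ⟨_, rfl⟩
  rw [← hz] at hT hback ⊢
  obtain ⟨r, C, A, K, h⟩ := exists_normalBall hn hneg hpar hc z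
  have hzs := mem_chart_source (E n) z
  have hr := h.r_pos
  have hsmall : ∀ᶠ δ in 𝓝[>] (0 : ℝ), C * δ < r / 4 ∧ C * (K * C) * δ < r / 4 ∧
      2 * A * (K * C) * δ < 1 / 2 ∧ 0 < δ := by
    filter_upwards [eventually_mul_lt C (b := r / 4) (by positivity),
      eventually_mul_lt (C * (K * C)) (b := r / 4) (by positivity),
      eventually_mul_lt (2 * A * (K * C)) (b := 1 / 2) (by norm_num),
      self_mem_nhdsWithin] with δ h1 h2 h3 h4 using ⟨h1, h2, h3, h4⟩
  -- A small backward time s is fixed before δ; the corner at z is examined on the broken path from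
  -- γ(T - s) through z to c(δ).
  obtain ⟨s, hs, hs1, hs2, hs3, hs0⟩ := (hback.and hsmall).exists
  filter_upwards [hf.eventually_exists_unitGeod hn hneg hpar hc hT, hsmall]
    with δ ⟨c, hcu, hc0, hcf⟩ ⟨hδ1, hδ2, hδ3, hδ0⟩
  obtain ⟨hP, hPn⟩ := hγ.stays h.subset h.C_pos h.speed (mem_univ T) (mem_univ (T - s)) (hz ▸ hzs)
    (by
      rw [readIn, ← hz, sub_self, norm_zero, zero_add, sub_sub_cancel, abs_of_pos hs0]
      linarith) _ right_mem_uIcc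
  obtain ⟨hq, hqn⟩ := hcu.stays h.subset h.C_pos h.speed (mem_univ 0) (mem_univ δ)
    (hc0.symm ▸ hzs) (by
      rw [readIn, hc0, sub_self, norm_zero, zero_add, zero_sub, abs_neg, abs_of_pos hδ0]
      linarith) _ right_mem_uIcc
  rw [sub_sub_cancel, abs_of_pos hs0, readIn, readIn, ← hz] at hPn
  rw [zero_sub, abs_neg, abs_of_pos hδ0, readIn, readIn, hc0] at hqn
  have hne : γ (T - s) ≠ c δ := by
    intro he
    rw [he] at hs
    linarith
  obtain ⟨σ, l, hσ, h0, hl, hl0, hle⟩ := h.exists_geodesic _ hP _ hq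
    (mem_closedBall_iff_norm.mpr (hPn.trans (by linarith)))
    (mem_closedBall_iff_norm.mpr (hqn.trans (by linarith))) hne
  have hlδ : l ≤ K * C * s + K * C * δ := by
    have h1 := norm_sub_le (chartAt (E n) z (c δ) - chartAt (E n) z z)
      (chartAt (E n) z (γ (T - s)) - chartAt (E n) z z)
    rw [sub_sub_sub_cancel_right] at h1
    have h2 := mul_le_mul_of_nonneg_left (h1.trans (add_le_add hqn hPn)) h.K_pos.le
    linarith
  have hcal : 𝓕.Calibrates z r C A σ l := by
    refine ⟨h.toCalibBall, hσ, ?_, hl0.le, h0 ▸ hP, ?_⟩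
    · have := mul_le_mul_of_nonneg_left hlδ (mul_nonneg zero_le_two h.A_pos.le)
      linarith
    · rw [h0]
      have := mul_le_mul_of_nonneg_left hlδ h.C_pos.le
      linarith
  have hzq : 𝓕.Step z (c δ) δ := by
    have := hcu.step hδ0.le
    rwa [hc0, sub_zero] at this
  have hPz : ∀ τ ∈ Icc 0 s, 𝓕.Step (γ (τ + (T - s))) z (s - τ) := fun τ hτ => by
    have := hγ.step (s := τ + (T - s)) (t := T) (by linarith [hτ.2])
    rwa [← hz, show T - (τ + (T - s)) = s - τ by ring] at this
  have hPq : ∀ τ ∈ Icc 0 s, Chain 𝓕.Step (γ (τ + (T - s))) (c δ) (s - τ + δ) := fun τ hτ =>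
    .cons (hPz τ hτ) (.single hzq)
  -- The decrease of f by s + δ forces this length on the short geodesic σ, so the broken path is
  -- itself a shortest one.
  have hls : l = s + δ := by
    have h1 := hcal.le_realDist hn hneg hpar
    have h2 := realDist_le_of_chain hn hneg hpar hc (hPq 0 ⟨le_rfl, hs0.le⟩)
    have h3 := (hf.le_add_of_unitGeod hn hneg hpar hc hσ hl0.le).1
    rw [h0, hl] at h1 h3
    rw [zero_add] at h2
    exact le_antisymm (by linarith) (by linarith)
  have hη := hγ.shift (T - s)
  simp only [mem_univ, ofPred_true] at hη
  have heq := hcal.eqOn hn hneg hpar hη (by rw [h0, zero_add]) (s₀ := s) (by linarith)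
    (fun τ hτ => by
      rw [hl, hls, add_sub_right_comm]
      exact hPq τ hτ)
  -- The shortest broken path has no corner: γ and σ agree on the first leg, hence everywhere by
  -- uniqueness, and γ passes through c(δ).
  have hall := hη.geod.eqOn hσ.geod isOpen_univ ordConnected_univ (mem_univ (s / 2))
    (heq.eventuallyEq_of_mem (Ioo_mem_nhds (half_pos hs0) (half_lt_self hs0)))
  have hend : γ (l + (T - s)) = σ l := hall (mem_univ l)
  rw [hl, hls, show s + δ + (T - s) = T + δ by ring] at hend
  rw [hend, hcf]

/-- The Hopf-Rinow continuation: the set of times t with f(γ(t)) = f(x) - t is closed, and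
`eventually_extend` moves past each of its points before f(x). At t = f(x) the value is 0. -/
theorem IsLimitDist.exists_eq_zero (hn : 2 ≤ n) (hneg : 𝓕.RicciNegDef)
    (hpar : 𝓕.RicciParallel) (hc : 𝓕.IsComplete) (hf : 𝓕.IsLimitDist u f) (x : M) :
    ∃ y, f y = 0 := by
  have hf0 : 0 ≤ f x := ge_of_tendsto' (hf x) fun l => realDist_nonneg x (u l)
  rcases hf0.eq_or_lt with h0 | hpos
  · exact ⟨x, h0.symm⟩
  have hev := hf.eventually_exists_unitGeod hn hneg hpar hc hpos
  obtain ⟨δ, ⟨γ, hγ, hγ0, hγδ⟩, hδ0, hδx⟩ := (hev.and (Filter.Eventually.and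
    (self_mem_nhdsWithin : Ioi (0 : ℝ) ∈ 𝓝[>] (0 : ℝ)) (eventually_mul_lt 1 hpos))).exists
  rw [one_mul] at hδx
  have hlip := fun {s t : ℝ} (hst : s ≤ t) => hf.le_add_of_unitGeod hn hneg hpar hc hγ hst
  have hdown : ∀ {t : ℝ}, f (γ t) = f x - t → ∀ s ∈ Icc 0 t, f (γ s) = f x - s := by
    intro t ht s hs
    have h1 := (hlip hs.1).1
    have h2 := (hlip hs.2).1
    rw [hγ0] at h1
    exact le_antisymm (by linarith) (by linarith)
  have hcont : Continuous fun t => f (γ t) := by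
    refine (LipschitzWith.of_dist_le_mul (K := 1) fun s t => ?_).continuous
    rw [NNReal.coe_one, one_mul, Real.dist_eq, Real.dist_eq]
    rcases le_total s t with hst | hst
    · have := hlip hst
      rw [abs_sub_comm s t, abs_of_nonneg (sub_nonneg.mpr hst), abs_le]
      exact ⟨by linarith [this.2], by linarith [this.1]⟩
    · have := hlip hst
      rw [abs_of_nonneg (sub_nonneg.mpr hst), abs_le]
      exact ⟨by linarith [this.1], by linarith [this.2]⟩
  -- Continuation starts at δ and not at 0, because the extension step needs the decrease of f just
  -- before the current time.
  have hsub : Icc δ (f x) ⊆ {t | f (γ t) = f x - t} := by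
    refine IsClosed.Icc_subset_of_forall_exists_gt
      ((isClosed_eq hcont (by fun_prop)).inter isClosed_Icc) hγδ ?_
    rintro T ⟨hT, hTδ, hTx⟩ y hy
    simp only [mem_ofPred_eq] at hT
    have hTpos : 0 < T := lt_of_lt_of_le hδ0 hTδ
    have hext := hf.eventually_extend hn hneg hpar hc hγ (T := T) (by rw [hT]; linarith) (by
      filter_upwards [self_mem_nhdsWithin, eventually_mul_lt 1 hTpos] with s (hs0 : 0 < s) hs
      rw [hdown hT (T - s) ⟨by linarith, by linarith⟩, hT]
      ring)
    obtain ⟨η, hη, hη0, hηy⟩ := (hext.and (Filter.Eventually.and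
      (self_mem_nhdsWithin : Ioi (0 : ℝ) ∈ 𝓝[>] (0 : ℝ))
      (eventually_mul_lt 1 (sub_pos.mpr hy)))).exists
    rw [one_mul] at hηy
    refine ⟨T + η, ?_, lt_add_of_pos_right T hη0, by linarith⟩
    rw [mem_ofPred_eq, hη, hT]
    ring
  have := hsub (right_mem_Icc.mpr hδx.le)
  rw [mem_ofPred_eq, sub_self] at this
  exact ⟨_, this⟩

end Limit

/-- The intrinsic distance of a complete Finsler manifold with parallel negative definite Ricci
tensor is complete. -/
theorem isCompleteDistance_projDist [T2Space M] [ConnectedSpace M] (hn : 2 ≤ n)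
    (hneg : 𝓕.RicciNegDef) (hpar : 𝓕.RicciParallel) (hc : 𝓕.IsComplete) :
    IsCompleteDistance 𝓕.projDist where
  isDistance := isDistance_projDist hn hneg hpar.firstIntegral
  complete u hu := by
    have hfin := projDist_ne_top hn hneg hpar.firstIntegral
    have hlim : ∀ x, ∃ a, Tendsto (fun l => 𝓕.realDist x (u l)) atTop (𝓝 a) := by
      intro x
      refine cauchySeq_tendsto_of_complete (Metric.cauchySeq_iff.mpr fun ε hε => ?_)
      obtain ⟨N, hN⟩ := hu (ENNReal.ofReal ε) (ENNReal.ofReal_pos.mpr hε)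
      refine ⟨N, fun l hl m hm => ?_⟩
      have h1 : 𝓕.realDist (u l) (u m) < ε :=
        (ENNReal.lt_ofReal_iff_toReal_lt (hfin _ _)).mp (hN l hl m hm)
      have h2 := realDist_triangle hn hneg hpar x (u l) (u m)
      have h3 := realDist_triangle hn hneg hpar x (u m) (u l)
      rw [realDist_comm (u m)] at h3
      rw [Real.dist_eq, abs_lt]
      exact ⟨by linarith, by linarith⟩
    choose f hf using hlim
    -- A zero of f is a point y with d(y, u_l) → 0, that is, the limit of the sequence.
    obtain ⟨y, hy⟩ := IsLimitDist.exists_eq_zero hn hneg hpar hc hf (u 0)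
    refine ⟨y, fun ε hε => ?_⟩
    have h1 := ENNReal.tendsto_ofReal (hf y)
    rw [hy, ENNReal.ofReal_zero] at h1
    obtain ⟨N, hN⟩ := eventually_atTop.mp (h1.eventually (gt_mem_nhds hε))
    refine ⟨N, fun m hm => ?_⟩
    have := hN m hm
    rwa [realDist, ENNReal.ofReal_toReal (hfin _ _), projDist_comm] at this

end FinslerStructure

end

end Finsler

end

theorem theorem4 {n : ℕ} (hn : 2 ≤ n) {M : Type*} [TopologicalSpace M] [T2Space M]
    [SecondCountableTopology M] [ConnectedSpace M] [ChartedSpace (Finsler.E n) M]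
    [IsManifold (𝓡 n) ∞ M] (𝓕 : Finsler.FinslerStructure n M) (hneg : 𝓕.RicciNegDef) :
    (𝓕.BerwaldHorParallel ∨ 𝓕.ChernHorParallel → Finsler.IsDistance 𝓕.projDist) ∧
    (𝓕.BerwaldParallel ∨ 𝓕.ChernParallel → 𝓕.IsComplete →
      Finsler.IsCompleteDistance 𝓕.projDist) := by
  exact ⟨fun h => Finsler.FinslerStructure.isDistance_projDist hn hneg
      (Finsler.FinslerStructure.ricciFirstIntegral h),
    Finsler.FinslerStructure.isCompleteDistance_projDist hn hneg⟩
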